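/- Let $V=(V,Y,\mathbf 1,\omega)$ be a vertex operator superalgebra over $\mathbb C$ of central charge $c$, with weights in $\frac12\mathbb Z$, finite-dimensional weight spaces vanishing for sufficiently negative weights, and sign grading $V^{(j)}=\bigoplus_{n\in\mathbb Z+j/2}V_n$. Let $\sigma(v)=(-1)^{|v|}v$ be the parity automorphism of $V$, and let $\tilde\kappa(u\otimes v)=(-1)^{|u||v|}v\otimes u$ be the signed transposition automorphism of the vertex operator superalgebra $V\otimes V$ (which has central charge $2c$). Both are considered with period $2$. A weak $g$-twisted module (for $g$ of period $k$) is a $\mathbb Z/2$-graded space with modes $v^g_n\in(\mathrm{End}\,M)^{(|v|)}$, $n\in\frac1k\mathbb Z$, satisfying truncation, the vacuum axiom and the twisted Jacobi identity. It is ordinary if it is the direct sum of the eigenspaces $M_\lambda$, $\lambda\in\mathbb C$, of $L^g(0)=\omega^g_1$, every $M_\lambda$ is finite-dimensional, and for each $\lambda$ one has $M_{n/2k+\lambda}=0$ for all sufficiently small integers $n$. Define $a_j\in\mathbb Q$ $(j\ge1)$ by $\exp\bigl(-\sum_{j\ge1}a_jx^{j+1}\frac{\partial}{\partial x}\bigr)\cdot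 x=\frac12(1+x)^2-\frac12$ and put $$\Delta_2(x)=\exp\Bigl(\sum_{j\ge1}a_jx^{-j/2}L(j)\Bigr)(2^{1/2})^{-2L(0)}(x^{1/4})^{-2L(0)}.$$ For a weak $\sigma$-twisted $V$-module $(M,Y_\sigma)$ and a weak $\tilde\kappa$-twisted $(V\otimes V)$-module $(M,Y_{\tilde\kappa})$ on the same $\mathbb Z/2$-graded space, write $T^2(M,Y_\sigma)=(M,Y_{\tilde\kappa})$ if for all $v\in V$ $$Y_{\tilde\kappa}(v\otimes\mathbf 1,x)=Y_\sigma(\Delta_2(x)v,x^{1/2}),\qquad Y_{\tilde\kappa}(\mathbf 1\otimes v,x)=\lim_{x^{1/2}\to-x^{1/2}}Y_{\tilde\kappa}(v\otimes\mathbf 1,x).$$ Let $M_{\tilde\kappa}$ be a weak $\tilde\kappa$-twisted $(V\otimes V)$-module. Then there is exactly one weak $\sigma$-twisted $V$-module $(T^2)^{-1}(M_{\tilde\kappa})$ on the same space whose image under $T^2$ is $M_{\tilde\kappa}$, and $M_{\tilde\kappa}$ is an ordinary $\tilde\kappa$-twisted $(V\otimes V)$-module if and only if $(T^2)^{-1}(M_{\tilde\kappa})$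 is an ordinary $\sigma$-twisted $V$-module. In that case, as formal series in complex powers of $q$, where $M_\lambda$ denotes the eigenspace of $L^{\tilde\kappa}(0)$ in $M_{\tilde\kappa}$ for the eigenvalue $\lambda$, $$\dim_qM_{\tilde\kappa}=\mathrm{tr}_{M_{\tilde\kappa}}q^{-2c/24+L^{\tilde\kappa}(0)}=q^{-c/12}\sum_{\lambda\in\mathbb C}\dim(M_\lambda)\,q^\lambda,$$ $$\dim_q(T^2)^{-1}(M_{\tilde\kappa})=\mathrm{tr}_{M_{\tilde\kappa}}q^{-c/24+L^\sigma(0)}=\dim_{q^2}M_{\tilde\kappa}.$$ Equivalently, $\dim_qM_{\tilde\kappa}$ is the graded dimension of $(T^2)^{-1}(M_{\tilde\kappa})$ evaluated at $q^{1/2}$. -/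

import Mathlib

open scoped TensorProduct PowerSeries

noncomputable section

/-! ### Vertex operator superalgebras -/

/-- The data of a vertex operator superalgebra: the weight spaces, the vertex operators
`Y(v, x) = ∑ v_n x^{-n-1}` (Laurent series in `x` when applied to a vector, so that `u_n v = 0` for
`n` large), the vacuum and the conformal vector.  Weights lie in `½ℤ`, and `weight n` is the space
of vectors of weight `n / 2`.  The sign of a vector of `weight n` is `n` modulo `2`. -/
structure SuperVertexData (V : Type*) [AddCommGroup V] [Module ℂ V] where
  weight : ℤ → Submodule ℂ V
  Y : V →ₗ[ℂ] VertexOperator ℂ V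
  vac : V
  conf : V

namespace SuperVertexData

variable {V : Type*} [AddCommGroup V] [Module ℂ V]

/-- The mode `v_n`, the coefficient of `x^{-n-1}` in `Y(v, x)`. -/
def mode (A : SuperVertexData V) (v : V) (n : ℤ) : Module.End ℂ V :=
  VertexOperator.ncoeff (A.Y v) n

/-- The Virasoro mode `L(n) = ω_{n+1}`. -/
def L (A : SuperVertexData V) (n : ℤ) : Module.End ℂ V := A.mode A.conf (n + 1)

end SuperVertexData

/-- A vertex operator superalgebra with central charge `c`. -/
structure VOSA (V : Type*) [AddCommGroup V] [Module ℂ V] extends SuperVertexData V where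
  c : ℂ
  weight_internal : DirectSum.IsInternal weight
  weight_finite : ∀ n, FiniteDimensional ℂ (weight n)
  weight_bounded : ∃ N : ℤ, ∀ n < N, weight n = ⊥
  vac_mem : vac ∈ weight 0
  conf_mem : conf ∈ weight 4
  /-- `Y(𝟏, x) = id` -/
  vac_mode : ∀ (n : ℤ) (v : V), toSuperVertexData.mode vac n v = if n = -1 then v else 0
  /-- `Y(v, x)𝟏 ∈ V[[x]]` -/
  creation_regular : ∀ (v : V) (n : ℤ), 0 ≤ n → toSuperVertexData.mode v n vac = 0
  /-- `Y(v, x)𝟏` has constant term `v` -/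
  creation : ∀ v : V, toSuperVertexData.mode v (-1) vac = v
  /-- The Jacobi identity: the coefficient of `x₀^{-l-1} x₁^{-m-1} x₂^{-n-1}` of the identity of
  formal series in `x₀, x₁, x₂`.  All sums have finitely many non-zero terms. -/
  jacobi : ∀ (a b : ℤ) (u v w : V), u ∈ weight a → v ∈ weight b → ∀ l m n : ℤ,
    (∑ᶠ i : ℕ, ((-1 : ℂ) ^ i * (Ring.choose l i : ℂ)) •
        toSuperVertexData.mode u (m + l - i) (toSuperVertexData.mode v (n + i) w))
      - ((-1 : ℂ) ^ (a * b) * (-1 : ℂ) ^ l) •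
        (∑ᶠ i : ℕ, ((-1 : ℂ) ^ i * (Ring.choose l i : ℂ)) •
          toSuperVertexData.mode v (n + l - i) (toSuperVertexData.mode u (m + i) w))
      = ∑ᶠ i : ℕ, (Ring.choose m i : ℂ) •
          toSuperVertexData.mode (toSuperVertexData.mode u (l + i) v) (m + n - i) w
  virasoro : ∀ m n : ℤ,
    toSuperVertexData.L m * toSuperVertexData.L n - toSuperVertexData.L n * toSuperVertexData.L m
      = ((m : ℂ) - n) • toSuperVertexData.L (m + n)
        + (if m + n = 0 then ((m : ℂ) ^ 3 - m) / 12 * c else 0) • (1 : Module.End ℂ V)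
  L_zero : ∀ (n : ℤ), ∀ v ∈ weight n, toSuperVertexData.L 0 v = ((n : ℂ) / 2) • v
  /-- `d/dx Y(v, x) = Y(L(-1)v, x)` -/
  L_neg_one : ∀ (v : V) (n : ℤ),
    toSuperVertexData.mode (toSuperVertexData.L (-1) v) n
      = -(n : ℂ) • toSuperVertexData.mode v (n - 1)

namespace VOSA

variable {V : Type*} [AddCommGroup V] [Module ℂ V]

/-- The parity map `σ`, acting as `(-1)^n` on `weight n`. -/
def parity (A : VOSA V) : V →ₗ[ℂ] V :=
  (DirectSum.toModule ℂ ℤ V fun n => ((-1 : ℂ) ^ n) • (A.weight n).subtype) ∘ₗ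
    (LinearEquiv.ofBijective (DirectSum.coeLinearMap A.weight)
      (show Function.Bijective (DirectSum.coeLinearMap A.weight) from
        A.weight_internal)).symm.toLinearMap

theorem parity_apply (A : VOSA V) {n : ℤ} {v : V} (hv : v ∈ A.weight n) :
    A.parity v = ((-1 : ℂ) ^ n) • v := by
  have hb : Function.Bijective (DirectSum.coeLinearMap A.weight) := A.weight_internal
  have h : (LinearEquiv.ofBijective (DirectSum.coeLinearMap A.weight) hb).symm v
      = DirectSum.lof ℂ ℤ (fun n => A.weight n) n ⟨v, hv⟩ := by
    rw [LinearEquiv.symm_apply_eq, LinearEquiv.ofBijective_apply, DirectSum.coeLinearMap_lof]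
  simp [parity, h]

/-- The projection of `V` onto its even part. -/
def evenPart (A : VOSA V) : V →ₗ[ℂ] V := (1 / 2 : ℂ) • (LinearMap.id + A.parity)

/-- The projection of `V` onto its odd part. -/
def oddPart (A : VOSA V) : V →ₗ[ℂ] V := (1 / 2 : ℂ) • (LinearMap.id - A.parity)

end VOSA

/-! ### The tensor square `V ⊗ V` and the signed transposition -/

namespace VertexTensor

variable {V : Type*} [AddCommGroup V] [Module ℂ V]

theorem exists_coeff_eq_zero (A : VertexOperator ℂ V) (a : V) :
    ∃ N : ℤ, ∀ s < N, HVertexOperator.coeff A s a = 0 :=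
  ⟨_, fun s hs => VertexOperator.coeff_eq_zero_of_lt_order A s a hs⟩

theorem finite_support (A B : VertexOperator ℂ V) (s : ℤ) (a b : V) :
    (Function.support fun i : ℤ =>
      HVertexOperator.coeff A i a ⊗ₜ[ℂ] HVertexOperator.coeff B (s - i) b).Finite := by
  obtain ⟨N, hN⟩ := exists_coeff_eq_zero A a
  obtain ⟨K, hK⟩ := exists_coeff_eq_zero B b
  refine (Set.finite_Icc N (s - K)).subset fun i hi => ?_
  rw [Function.mem_support] at hi
  constructor
  · by_contra h
    exact hi (by rw [hN i (by omega), TensorProduct.zero_tmul])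
  · by_contra h
    exact hi (by rw [hK (s - i) (by omega), TensorProduct.tmul_zero])

/-- The coefficient of `x^s` in `A(x)a ⊗ B(x)b`, as a linear map in `a ⊗ b`. -/
def coeffMap (A B : VertexOperator ℂ V) (s : ℤ) : Module.End ℂ (V ⊗[ℂ] V) :=
  TensorProduct.lift (LinearMap.mk₂ ℂ
    (fun a b => ∑ᶠ i : ℤ,
      HVertexOperator.coeff A i a ⊗ₜ[ℂ] HVertexOperator.coeff B (s - i) b)
    (fun a a' b => by
      rw [← finsum_add_distrib (finite_support A B s a b) (finite_support A B s a' b)]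
      simp only [map_add, TensorProduct.add_tmul])
    (fun r a b => by
      rw [smul_finsum' r (finite_support A B s a b)]
      simp only [map_smul, TensorProduct.smul_tmul'])
    (fun a b b' => by
      rw [← finsum_add_distrib (finite_support A B s a b) (finite_support A B s a b')]
      simp only [map_add, TensorProduct.tmul_add])
    (fun r a b => by
      rw [smul_finsum' r (finite_support A B s a b)]
      simp only [map_smul, TensorProduct.tmul_smul]))

theorem coeffMap_tmul (A B : VertexOperator ℂ V) (s : ℤ) (a b : V) :
    coeffMap A B s (a ⊗ₜ b) = ∑ᶠ i : ℤ,
      HVertexOperator.coeff A i a ⊗ₜ[ℂ] HVertexOperator.coeff B (s - i) b := rfl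

theorem coeffMap_eq_zero (A B : VertexOperator ℂ V) (x : V ⊗[ℂ] V) :
    ∃ N : ℤ, ∀ s < N, coeffMap A B s x = 0 := by
  induction x with
  | zero => exact ⟨0, fun s _ => map_zero _⟩
  | tmul a b =>
    obtain ⟨N, hN⟩ := exists_coeff_eq_zero A a
    obtain ⟨K, hK⟩ := exists_coeff_eq_zero B b
    refine ⟨N + K, fun s hs => ?_⟩
    rw [coeffMap_tmul]
    refine finsum_eq_zero_of_forall_eq_zero fun i => ?_
    by_cases h : i < N
    · rw [hN i h, TensorProduct.zero_tmul]
    · rw [hK (s - i) (by omega), TensorProduct.tmul_zero]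
  | add x y hx hy =>
    obtain ⟨N, hN⟩ := hx
    obtain ⟨K, hK⟩ := hy
    refine ⟨min N K, fun s hs => ?_⟩
    rw [map_add, hN s (by omega), hK s (by omega), add_zero]

/-- The vertex operator `a ⊗ b ↦ A(x)a ⊗ B(x)b` on `V ⊗ V`. -/
def prod (A B : VertexOperator ℂ V) : VertexOperator ℂ (V ⊗[ℂ] V) :=
  VertexOperator.of_coeff (coeffMap A B) fun x => by
    obtain ⟨N, hN⟩ := coeffMap_eq_zero A B x
    exact ⟨N, fun s hs => by
      by_contra h
      exact hs (hN s (by omega))⟩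

theorem prod_coeff (A B : VertexOperator ℂ V) (s : ℤ) (x : V ⊗[ℂ] V) :
    HVertexOperator.coeff (prod A B) s x = coeffMap A B s x := rfl

theorem vertexOperator_ext {W : Type*} [AddCommGroup W] [Module ℂ W]
    {A B : VertexOperator ℂ (W ⊗[ℂ] W)}
    (h : ∀ s a b, HVertexOperator.coeff A s (a ⊗ₜ b) = HVertexOperator.coeff B s (a ⊗ₜ b)) :
    A = B := by
  apply HVertexOperator.coeff_inj
  funext s
  exact TensorProduct.ext' fun a b => h s a b

/-- `prod` as a bilinear map. -/
def prodₗ : VertexOperator ℂ V →ₗ[ℂ] VertexOperator ℂ V →ₗ[ℂ] VertexOperator ℂ (V ⊗[ℂ] V) :=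
  LinearMap.mk₂ ℂ prod
    (fun A A' B => vertexOperator_ext fun s a b => by
      rw [map_add, Pi.add_apply, LinearMap.add_apply]
      simp only [prod_coeff, coeffMap_tmul]
      rw [← finsum_add_distrib (finite_support A B s a b) (finite_support A' B s a b)]
      simp only [map_add, Pi.add_apply, LinearMap.add_apply, TensorProduct.add_tmul])
    (fun r A B => vertexOperator_ext fun s a b => by
      rw [map_smul, Pi.smul_apply, LinearMap.smul_apply]
      simp only [prod_coeff, coeffMap_tmul]
      rw [smul_finsum' r (finite_support A B s a b)]
      simp only [map_smul, Pi.smul_apply, LinearMap.smul_apply, TensorProduct.smul_tmul'])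
    (fun A B B' => vertexOperator_ext fun s a b => by
      rw [map_add, Pi.add_apply, LinearMap.add_apply]
      simp only [prod_coeff, coeffMap_tmul]
      rw [← finsum_add_distrib (finite_support A B s a b) (finite_support A B' s a b)]
      simp only [map_add, Pi.add_apply, LinearMap.add_apply, TensorProduct.tmul_add])
    (fun r A B => vertexOperator_ext fun s a b => by
      rw [map_smul, Pi.smul_apply, LinearMap.smul_apply]
      simp only [prod_coeff, coeffMap_tmul]
      rw [smul_finsum' r (finite_support A B s a b)]
      simp only [map_smul, Pi.smul_apply, LinearMap.smul_apply, TensorProduct.tmul_smul])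

end VertexTensor

namespace VOSA

variable {V : Type*} [AddCommGroup V] [Module ℂ V]

/-- The vertex operators of `V ⊗ V`:
`Y(u ⊗ v, x)(a ⊗ b) = (-1)^{|v||a|} Y(u, x)a ⊗ Y(v, x)b`; see `tensorY_coeff`. -/
def tensorY (A : VOSA V) : V ⊗[ℂ] V →ₗ[ℂ] VertexOperator ℂ (V ⊗[ℂ] V) :=
  TensorProduct.lift
    ((VertexTensor.prodₗ.compl₁₂ A.Y (A.Y ∘ₗ A.evenPart)) +
      (VertexTensor.prodₗ.compl₁₂ A.Y (A.Y ∘ₗ A.oddPart)).compr₂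
        (LinearMap.lcomp ℂ (HahnModule ℤ ℂ (V ⊗[ℂ] V))
          (TensorProduct.map A.parity LinearMap.id)))

theorem evenPart_apply (A : VOSA V) {n : ℤ} {v : V} (hv : v ∈ A.weight n) :
    A.evenPart v = if Even n then v else 0 := by
  rcases Int.even_or_odd n with h | h
  · simp only [evenPart, LinearMap.smul_apply, LinearMap.add_apply, LinearMap.id_apply,
      A.parity_apply hv, h.neg_one_zpow, if_pos h]
    module
  · simp only [evenPart, LinearMap.smul_apply, LinearMap.add_apply, LinearMap.id_apply,
      A.parity_apply hv, h.neg_one_zpow, if_neg (Int.not_even_iff_odd.2 h)]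
    module

theorem oddPart_apply (A : VOSA V) {n : ℤ} {v : V} (hv : v ∈ A.weight n) :
    A.oddPart v = if Even n then 0 else v := by
  rcases Int.even_or_odd n with h | h
  · simp only [oddPart, LinearMap.smul_apply, LinearMap.sub_apply, LinearMap.id_apply,
      A.parity_apply hv, h.neg_one_zpow, if_pos h]
    module
  · simp only [oddPart, LinearMap.smul_apply, LinearMap.sub_apply, LinearMap.id_apply,
      A.parity_apply hv, h.neg_one_zpow, if_neg (Int.not_even_iff_odd.2 h)]
    module

/-- The coefficient of `x^s` in `Y(u ⊗ v, x)(a ⊗ b)` for homogeneous `v` and `a`. -/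
theorem tensorY_coeff (A : VOSA V) (u v a b : V) {m n : ℤ} (hv : v ∈ A.weight m)
    (ha : a ∈ A.weight n) (s : ℤ) :
    HVertexOperator.coeff (A.tensorY (u ⊗ₜ v)) s (a ⊗ₜ b) = ((-1 : ℂ) ^ (m * n)) • ∑ᶠ i : ℤ,
      HVertexOperator.coeff (A.Y u) i a ⊗ₜ[ℂ] HVertexOperator.coeff (A.Y v) (s - i) b := by
  have key : A.tensorY (u ⊗ₜ v) = VertexTensor.prod (A.Y u) (A.Y (A.evenPart v)) +
      (VertexTensor.prod (A.Y u) (A.Y (A.oddPart v))) ∘ₗ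
        (TensorProduct.map A.parity LinearMap.id) := rfl
  have key2 : HVertexOperator.coeff (A.tensorY (u ⊗ₜ v)) s (a ⊗ₜ b) =
      VertexTensor.coeffMap (A.Y u) (A.Y (A.evenPart v)) s (a ⊗ₜ b) +
      VertexTensor.coeffMap (A.Y u) (A.Y (A.oddPart v)) s (A.parity a ⊗ₜ b) := by
    rw [key, map_add]; rfl
  rw [key2, A.evenPart_apply hv, A.oddPart_apply hv, A.parity_apply ha]
  rcases Int.even_or_odd m with h | h
  · have h2 : Even (m * n) := h.mul_right n
    simp [if_pos h, h2.neg_one_zpow, VertexTensor.coeffMap_tmul]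
  · have h2 : (-1 : ℂ) ^ (m * n) = (-1) ^ n := by rw [zpow_mul, h.neg_one_zpow]
    rw [if_neg (Int.not_even_iff_odd.2 h), if_neg (Int.not_even_iff_odd.2 h), h2,
      ← TensorProduct.smul_tmul', map_smul]
    simp [VertexTensor.coeffMap_tmul]

/-- The vertex operator superalgebra `V ⊗ V` (of central charge `2c`). -/
def tensorSquare (A : VOSA V) : SuperVertexData (V ⊗[ℂ] V) where
  weight n := ⨆ i : ℤ, Submodule.map₂ (TensorProduct.mk ℂ V V) (A.weight i) (A.weight (n - i))
  Y := A.tensorY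
  vac := A.vac ⊗ₜ A.vac
  conf := A.conf ⊗ₜ A.vac + A.vac ⊗ₜ A.conf

/-- The signed transposition `κ̃ : u ⊗ v ↦ (-1)^{|u||v|} v ⊗ u`; see `signedSwap_tmul`. -/
def signedSwap (A : VOSA V) : V ⊗[ℂ] V →ₗ[ℂ] V ⊗[ℂ] V :=
  (TensorProduct.comm ℂ V V).toLinearMap ∘ₗ
    (TensorProduct.map LinearMap.id A.evenPart + TensorProduct.map A.parity A.oddPart)

theorem signedSwap_tmul (A : VOSA V) {m n : ℤ} {u v : V} (hu : u ∈ A.weight m)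
    (hv : v ∈ A.weight n) : A.signedSwap (u ⊗ₜ v) = ((-1 : ℂ) ^ (m * n)) • (v ⊗ₜ u) := by
  rcases Int.even_or_odd n with h | h
  · have h2 : Even (m * n) := h.mul_left m
    simp [signedSwap, A.evenPart_apply hv, A.oddPart_apply hv, if_pos h, h2.neg_one_zpow]
  · have h2 : (-1 : ℂ) ^ (m * n) = (-1) ^ m := by rw [mul_comm, zpow_mul, h.neg_one_zpow]
    simp [signedSwap, A.evenPart_apply hv, A.oddPart_apply hv,
      if_neg (Int.not_even_iff_odd.2 h), A.parity_apply hu, h2]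

end VOSA

/-! ### Twisted modules -/

/-- A weak `g`-twisted module for an automorphism `g` of period `k`, with `η` the fixed primitive
`k`-th root of unity.  The mode `v^g_{p/k}` of `Y^g(v, x) = ∑_{n ∈ (1/k)ℤ} v^g_n x^{-n-1}` is written
`Y v p`, and `sign` is the `ℤ/2`-grading of the underlying space `M`. -/
@[ext]
structure WeakTwistedModule {V : Type*} [AddCommGroup V] [Module ℂ V] (A : SuperVertexData V)
    (k : ℕ) (η : ℂ) (g : V →ₗ[ℂ] V) (M : Type*) [AddCommGroup M] [Module ℂ M] where
  sign : ZMod 2 → Submodule ℂ M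
  Y : V →ₗ[ℂ] ℤ → Module.End ℂ M
  sign_internal : DirectSum.IsInternal sign
  /-- `v^g_n ∈ (End M)^{(|v|)}` -/
  mode_sign : ∀ (a : ℤ), ∀ v ∈ A.weight a, ∀ (p : ℤ) (j : ZMod 2), ∀ w ∈ sign j,
    Y v p w ∈ sign (j + a)
  truncation : ∀ (v : V) (w : M), ∃ N : ℤ, ∀ p ≥ N, Y v p w = 0
  /-- `Y^g(𝟏, x) = id` -/
  vac_mode : ∀ (p : ℤ) (w : M), Y A.vac p w = if p = -k then w else 0
  /-- The twisted Jacobi identity: the coefficient of `x₀^{-l-1} x₁^{-p/k-1} x₂^{-q/k-1}` of the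
  identity of formal series in `x₀, x₁^{1/k}, x₂^{1/k}`.  On the right, with `m = p/k`, the
  coefficient of `x₁^{-m-1} x₀^i` in `(1/k) ∑_j δ(η^j (x₁-x₀)^{1/k} / x₂^{1/k})` is
  `(1/k) ∑_j η^{-jp} (-1)^i binom(i-m-1, i)` times a power of `x₂`, and
  `(-1)^i binom(i-m-1, i) = binom(m, i)`.  All sums have finitely many non-zero terms. -/
  jacobi : ∀ (a b : ℤ) (u v : V), u ∈ A.weight a → v ∈ A.weight b → ∀ (w : M) (l p q : ℤ),
    (∑ᶠ i : ℕ, ((-1 : ℂ) ^ i * (Ring.choose l i : ℂ)) •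
        Y u (p + k * (l - i)) (Y v (q + k * i) w))
      - ((-1 : ℂ) ^ (a * b) * (-1 : ℂ) ^ l) •
        (∑ᶠ i : ℕ, ((-1 : ℂ) ^ i * (Ring.choose l i : ℂ)) •
          Y v (q + k * (l - i)) (Y u (p + k * i) w))
      = ∑ᶠ i : ℕ, Ring.choose ((p : ℂ) / k) i •
          ((k : ℂ)⁻¹ • ∑ j ∈ Finset.range k, (η ^ (-((j : ℤ) * p))) •
            Y (A.mode ((g ^ j) u) (l + i) v) (p + q - k * i) w)

/-- The formal trace `tr q^T` of an operator `T` acting semisimply with finite-dimensional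
eigenspaces: a formal series in complex powers of `q`, given by the function sending `μ` to the
coefficient of `q^μ`, which is the multiplicity of the eigenvalue `μ`. -/
def qTrace {M : Type*} [AddCommGroup M] [Module ℂ M] (T : Module.End ℂ M) : ℂ → ℕ :=
  fun μ => Module.finrank ℂ (T.eigenspace μ)

/-- The product `q^a F(q)` of `q^a` and a formal series in complex powers of `q`. -/
def qShift (a : ℂ) (F : ℂ → ℕ) : ℂ → ℕ := fun μ => F (μ - a)

/-- The formal series `F(q^r)` (for `r ≠ 0`), obtained by substituting `q^r` for `q`. -/
def qSubst (r : ℂ) (F : ℂ → ℕ) : ℂ → ℕ := fun μ => F (μ / r)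

namespace WeakTwistedModule

variable {V : Type*} [AddCommGroup V] [Module ℂ V] {A : SuperVertexData V} {k : ℕ} {η : ℂ}
  {g : V →ₗ[ℂ] V} {M : Type*} [AddCommGroup M] [Module ℂ M]

/-- `L^g(0) = ω^g_1`. -/
def L0 (W : WeakTwistedModule A k η g M) : Module.End ℂ M := W.Y A.conf k

/-- The weight space `M_λ`. -/
def weightSpace (W : WeakTwistedModule A k η g M) (μ : ℂ) : Submodule ℂ M := W.L0.eigenspace μ

/-- A weak twisted module is ordinary if it is the direct sum of the eigenspaces `M_λ` of `L^g(0)`,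
these are finite-dimensional, and for every `λ`, `M_{n/2k + λ} = 0` for all sufficiently small
integers `n`. -/
structure IsOrdinary (W : WeakTwistedModule A k η g M) : Prop where
  internal : DirectSum.IsInternal W.weightSpace
  finite : ∀ μ, FiniteDimensional ℂ (W.weightSpace μ)
  bounded : ∀ μ : ℂ, ∃ N : ℤ, ∀ n ≤ N, W.weightSpace ((n : ℂ) / (2 * k) + μ) = ⊥

/-- The graded dimension `tr_M q^{-C/24 + L^g(0)}`, where `C` is the central charge. -/
def gradedDim (W : WeakTwistedModule A k η g M) (C : ℂ) : ℂ → ℕ :=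
  qTrace (W.L0 - (C / 24) • (1 : Module.End ℂ M))

end WeakTwistedModule

/-! ### The numbers `a_j` and the operator `Δ_k(x)` -/

namespace DeltaCoeff

open PowerSeries

/-- The series `∑_{j ≥ 1} a_j x^{j+1}`. -/
def field (a : ℕ → ℚ) : ℚ⟦X⟧ := PowerSeries.mk fun n => if n < 2 then 0 else a (n - 1)

/-- The derivation `-∑_{j ≥ 1} a_j x^{j+1} d/dx`. -/
def der (a : ℕ → ℚ) (f : ℚ⟦X⟧) : ℚ⟦X⟧ := -(field a * PowerSeries.derivative ℚ f)

/-- The series `exp(-∑_{j ≥ 1} a_j x^{j+1} d/dx) · x`.  The `r`-th term of the exponential only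
involves powers of `x` larger than `r`, so the sum defining the coefficient of `x^n` is finite. -/
def flow (a : ℕ → ℚ) : ℚ⟦X⟧ := PowerSeries.mk fun n =>
  ∑ r ∈ Finset.range (n + 1), ((r.factorial : ℚ)⁻¹) * coeff n ((der a)^[r] X)

/-- The polynomial `(1/k)(1 + x)^k - 1/k`. -/
def target (k : ℕ) : ℚ⟦X⟧ := C (1 / (k : ℚ)) * (1 + X) ^ k - C (1 / (k : ℚ))

/-- The numbers `a_1, …, a_n`, followed by zeros. -/
def aux (k : ℕ) : ℕ → ℕ → ℚ
  | 0 => fun _ => 0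
  | n + 1 => Function.update (aux k n) (n + 1)
      (coeff (n + 2) (flow (aux k n)) - coeff (n + 2) (target k))

/-- The numbers `a_j`, `j ≥ 1` (with `a_0 = 0`), characterized by
`exp(-∑_{j ≥ 1} a_j x^{j+1} d/dx) · x = (1/k)(1 + x)^k - 1/k`; see `flow_a`. -/
def a (k j : ℕ) : ℚ := aux k j j

theorem field_dvd (b : ℕ → ℚ) : X ^ 2 ∣ field b := by
  rw [X_pow_dvd_iff]
  intro m hm
  rw [field, coeff_mk, if_pos hm]

theorem derivative_dvd {n : ℕ} {f : ℚ⟦X⟧} (h : X ^ (n + 1) ∣ f) :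
    X ^ n ∣ PowerSeries.derivative ℚ f := by
  rw [X_pow_dvd_iff] at h ⊢
  intro m hm
  rw [coeff_derivative, h (m + 1) (by omega), zero_mul]

theorem der_iterate_dvd (b : ℕ → ℚ) (r : ℕ) : X ^ (r + 1) ∣ (der b)^[r] X := by
  induction r with
  | zero => simp
  | succ r ih =>
    rw [Function.iterate_succ_apply', der, dvd_neg]
    have := mul_dvd_mul (field_dvd b) (derivative_dvd ih)
    rwa [← pow_add, show 2 + r = r + 1 + 1 by ring] at this

theorem field_sub_dvd {b b' : ℕ → ℚ} {n : ℕ} (h : ∀ j ≤ n, b j = b' j) :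
    X ^ (n + 2) ∣ field b - field b' := by
  rw [X_pow_dvd_iff]
  intro m hm
  by_cases h2 : m < 2
  · rw [map_sub, field, field, coeff_mk, coeff_mk, if_pos h2, if_pos h2, sub_zero]
  · rw [map_sub, field, field, coeff_mk, coeff_mk, if_neg h2, if_neg h2, h (m - 1) (by omega),
      sub_self]

theorem der_sub (b b' : ℕ → ℚ) (f f' : ℚ⟦X⟧) : der b f - der b' f' =
    -((field b - field b') * PowerSeries.derivative ℚ f)
      - field b' * PowerSeries.derivative ℚ (f - f') := by
  rw [der, der, map_sub]
  ring

theorem der_iterate_sub {b b' : ℕ → ℚ} {n : ℕ} (h : ∀ j ≤ n, b j = b' j) (r : ℕ) :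
    X ^ (n + 3) ∣ (der b)^[r + 2] X - (der b')^[r + 2] X := by
  have step : ∀ (r : ℕ), X ^ (n + 2) ∣ (der b)^[r + 1] X - (der b')^[r + 1] X →
      X ^ (n + 3) ∣ (der b)^[r + 2] X - (der b')^[r + 2] X := by
    intro r hr
    rw [Function.iterate_succ_apply' (der b) (r + 1), Function.iterate_succ_apply' (der b') (r + 1),
      der_sub]
    refine dvd_sub ((dvd_neg).2 ?_) ?_
    · have h1 : X ^ 1 ∣ PowerSeries.derivative ℚ ((der b)^[r + 1] X) :=
        (pow_dvd_pow X (by omega)).trans (derivative_dvd (der_iterate_dvd b (r + 1)))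
      have := mul_dvd_mul (field_sub_dvd h) h1
      rwa [← pow_add] at this
    · have := mul_dvd_mul (field_dvd b') (derivative_dvd hr)
      rwa [← pow_add, show 2 + (n + 1) = n + 3 by ring] at this
  induction r with
  | zero =>
    apply step
    have := field_sub_dvd h
    simpa [der, neg_add_eq_sub] using (dvd_sub_comm).1 this
  | succ r ih =>
    exact step (r + 1) ((pow_dvd_pow X (by omega)).trans ih)

theorem coeff_flow {b b' : ℕ → ℚ} {n : ℕ} (h : ∀ j ≤ n, b j = b' j) :
    coeff (n + 2) (flow b) + b (n + 1) = coeff (n + 2) (flow b') + b' (n + 1) := by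
  have hf : ∀ c : ℕ → ℚ, coeff (n + 2) (flow c) + c (n + 1) =
      ∑ r ∈ Finset.range (n + 1),
        (((r + 2).factorial : ℚ)⁻¹) * coeff (n + 2) ((der c)^[r + 2] X) := by
    intro c
    rw [flow, coeff_mk, Finset.sum_range_succ', Finset.sum_range_succ']
    simp [der, field, coeff_X]
  rw [hf, hf]
  refine Finset.sum_congr rfl fun r _ => ?_
  have := (X_pow_dvd_iff.1 (der_iterate_sub h r)) (n + 2) (by omega)
  rw [map_sub, sub_eq_zero] at this
  rw [this]

theorem aux_eq (k : ℕ) {n j : ℕ} (h : j ≤ n) : aux k n j = a k j := by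
  induction n with
  | zero => obtain rfl : j = 0 := by omega
            rfl
  | succ n ih =>
    by_cases hj : j = n + 1
    · subst hj; rfl
    · rw [aux, Function.update_of_ne hj, ih (by omega)]

theorem aux_eq_zero (k : ℕ) {n j : ℕ} (h : n < j) : aux k n j = 0 := by
  induction n with
  | zero => rfl
  | succ n ih => rw [aux, Function.update_of_ne (by omega), ih (by omega)]

/-- The identity that characterizes the numbers `a_j`. -/
theorem flow_a (k : ℕ) (hk : k ≠ 0) : flow (a k) = target k := by
  have hk' : (k : ℚ) ≠ 0 := by exact_mod_cast hk
  ext N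
  match N with
  | 0 => simp [flow, target]
  | 1 =>
    have h1 : coeff 1 ((1 + X : ℚ⟦X⟧) ^ k) = (k : ℚ) := by
      have : ((1 + X : ℚ⟦X⟧) ^ k) = (((1 + Polynomial.X) ^ k : Polynomial ℚ) : ℚ⟦X⟧) := by
        simp
      rw [this, Polynomial.coeff_coe, Polynomial.coeff_one_add_X_pow]
      simp
    simp [flow, target, Finset.sum_range_succ, der, field, coeff_C_mul, h1, hk']
  | n + 2 =>
    have h1 := coeff_flow (b := a k) (b' := aux k n) (n := n) fun j hj => (aux_eq k hj).symm
    have h2 : a k (n + 1) = coeff (n + 2) (flow (aux k n)) - coeff (n + 2) (target k) := by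
      rw [a, aux, Function.update_self]
    rw [aux_eq_zero k (by omega : n < n + 1), h2] at h1
    linarith

end DeltaCoeff

namespace VOSA

variable {V : Type*} [AddCommGroup V] [Module ℂ V]

/-- The operator `E_s` on `V` that is the coefficient of `y^s` in `exp(∑_{j ≥ 1} a_j y^j L(j))`,
where `y` stands for `x^{-1/k}`.  The `r`-th power of the exponent only involves powers of `y` at
least `r`, so the sum is finite. -/
def deltaExp (A : VOSA V) (k s : ℕ) : Module.End ℂ V :=
  ∑ r ∈ Finset.range (s + 1), ((r.factorial : ℂ)⁻¹) • PowerSeries.coeff s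
    ((PowerSeries.mk fun j : ℕ => ((DeltaCoeff.a k j : ℚ) : ℂ) • A.L j) ^ r)

/-- The relation `T²(M_σ, Y_σ) = (M, Y_κ̃)` between a weak `σ`-twisted `V`-module and a weak
`κ̃`-twisted `(V ⊗ V)`-module on the same `ℤ/2`-graded space `M`:
`Y_κ̃(v ⊗ 𝟏, x) = Y_σ(Δ₂(x)v, x^{1/2})` and
`Y_κ̃(𝟏 ⊗ v, x) = lim_{x^{1/2} → -x^{1/2}} Y_κ̃(v ⊗ 𝟏, x)`, where
`Δ₂(x) = exp(∑_{j ≥ 1} a_j x^{-j/2} L(j)) (2^{1/2})^{-2L(0)} (x^{1/4})^{-2L(0)}`.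

For `v` of weight `m / 2`, `Δ₂(x)v = (√2)^{-m} ∑_s x^{-s/2 - m/4} E_s v`, and the first equation is
stated by comparing coefficients of `x^{-p/2-1}`. -/
structure IsT2 (A : VOSA V) {M : Type*} [AddCommGroup M] [Module ℂ M]
    (N : WeakTwistedModule A.toSuperVertexData 2 (-1) A.parity M)
    (W : WeakTwistedModule A.tensorSquare 2 (-1) A.signedSwap M) : Prop where
  sign_eq : W.sign = N.sign
  first : ∀ (m : ℤ), ∀ v ∈ A.weight m, ∀ (p : ℤ) (w : M),
    W.Y (v ⊗ₜ A.vac) p w = (((Real.sqrt 2 : ℝ) : ℂ) ^ (-m)) •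
      ∑ᶠ s : ℕ, N.Y (A.deltaExp 2 s v) (2 * p + 2 - 2 * s - m) w
  second : ∀ (v : V) (p : ℤ), W.Y (A.vac ⊗ₜ v) p = ((-1 : ℂ) ^ p) • W.Y (v ⊗ₜ A.vac) p

end VOSA

end

/-!
The module `(T²)⁻¹(W)` is obtained by solving `Y_κ̃(v ⊗ 𝟏, x) = Y_σ(Δ₂(x)v, x^{1/2})` for `Y_σ`:
`Y_σ(v, y) = Y_κ̃(Δ₂(y²)⁻¹v ⊗ 𝟏, y²)`.  So uniqueness and the first equation of `T²` only need
`Δ₂(x)⁻¹`, together with the fact that in a `σ`-twisted module the modes of `v` have indices in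
`ℤ + |v|/2` (`Y_eq_zero_of_not_even`).  The second equation is the twisted Jacobi identity for
`v ⊗ 𝟏` and the vacuum (`Y_vac_tmul`).

Existence is the twisted Jacobi identity for `Y_σ` (`untwist`).  Two facts go into it.

* `T_jacobi_sqrt`, about `W` alone.  The twisted Jacobi identity for `u ⊗ 𝟏` and `v ⊗ 𝟏` is, in the
  variables `y_i = x_i^{1/2}`, a residue formula for test functions `y_1^m y_2^n (y_1² - y_2²)^l`,
  with contributions from `y_1 = y_2` (through `u_j v ⊗ 𝟏`) and from `y_1 = -y_2` (through
  `(𝟏 ⊗ u)_j (v ⊗ 𝟏)`).  Multiplication of the test function by `y_1 ± y_2` turns this into the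
  formula for `(y_1 - y_2)^l`.  As `Y(𝟏 ⊗ u, x)(v ⊗ 𝟏)` has no pole, only `y_1 = y_2` contributes
  then.  The remaining coefficients are the numbers `theta`: with `y_1 = y_2(1 + y)` one has
  `x_1 - x_2 = 2 x_2 (y + y²/2)`.

* `conjSum_eq`, about `V` alone: the conjugation of a vertex operator by
  `E = exp(∑ a_j L(j))`.  Huang's change of variables formula would give it; here it follows from a
  recursion.  The defining property of the numbers `a_j` says that the flow of the vector field
  `-∑ a_j x^{j+1} d/dx` is `x ↦ x + x²/2`, and this implies
  `E (2L(0) + 4L(1)) = (2L(0) + 3L(1) + L(2)) E` (`deltaSeries_relation`).  Together with the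
  commutators of `L(0)`, `L(1)`, `L(2)` with the modes it determines both sides of `conjSum_eq` by
  induction on the drop in weight (`SatisfiesRecursion.eq`).

Finally `Δ₂(x)ω = ¼ x⁻¹(ω + (c/8) x⁻¹)`, hence `2 L^κ̃(0) = L^σ(0) + c/8` (`L0_of_isT2`): the two
modules have the same eigenspaces, and the statements about ordinary modules and graded dimensions
are reparametrizations of the eigenvalues.
-/

/-! ### Formal exponentials of locally nilpotent operators -/

namespace FormalExp

open PowerSeries Finset

/-- The binomial theorem for an operator `T` that acts on a doubly indexed family as a
"product rule" `T (F i j) = F (i + 1) j + F i (j + 1)`. -/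
theorem iterate_eq_sum_choose {M : Type*} [AddCommGroup M] (T : M →+ M) (F : ℕ → ℕ → M)
    (hT : ∀ i j, T (F i j) = F (i + 1) j + F i (j + 1)) (r : ℕ) :
    T^[r] (F 0 0) = ∑ ij ∈ antidiagonal r, r.choose ij.1 • F ij.1 ij.2 := by
  induction r with
  | zero => simp
  | succ r ih =>
    rw [Function.iterate_succ_apply', ih, sum_antidiagonal_choose_succ_nsmul, map_sum,
      ← sum_add_distrib]
    refine sum_congr rfl fun ij hij => ?_
    have h : r.choose ij.2 = r.choose ij.1 :=
      Nat.choose_symm_of_eq_add (by rw [HasAntidiagonal.mem_antidiagonal] at hij; omega)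
    rw [map_nsmul, hT, h, smul_add, add_comm]

variable (𝕜 : Type*) [Field 𝕜] {R : Type*} [Ring R] [Algebra 𝕜 R]

/-- The sum `∑ S_r / r!` of a sequence of power series with `S_r ∈ X^r R⟦X⟧` (for other sequences,
only the terms with `r ≤ n` contribute to the coefficient of `X^n`). -/
noncomputable def expSum (S : ℕ → R⟦X⟧) : R⟦X⟧ :=
  mk fun n => ∑ r ∈ range (n + 1), ((r.factorial : 𝕜)⁻¹) • coeff n (S r)

/-- `S_r ∈ X^r R⟦X⟧` for all `r`. -/
def IsAdic (S : ℕ → R⟦X⟧) : Prop := ∀ r n, n < r → coeff n (S r) = 0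

variable {𝕜}

theorem coeff_expSum {S : ℕ → R⟦X⟧} (hS : IsAdic S) {n N : ℕ} (h : n ≤ N) :
    coeff n (expSum 𝕜 S) = ∑ r ∈ range (N + 1), ((r.factorial : 𝕜)⁻¹) • coeff n (S r) := by
  rw [expSum, coeff_mk]
  refine sum_subset (range_subset_range.2 (by omega)) fun r _ hr => ?_
  rw [hS r n (by simpa using hr), smul_zero]

theorem expSum_add (S S' : ℕ → R⟦X⟧) :
    expSum 𝕜 (fun r => S r + S' r) = expSum 𝕜 S + expSum 𝕜 S' := by
  ext n
  simp [expSum, smul_add, sum_add_distrib]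

theorem expSum_const_mul (c : R) (S : ℕ → R⟦X⟧) :
    expSum 𝕜 (fun r => C c * S r) = C c * expSum 𝕜 S := by
  ext n
  simp [expSum, mul_sum]

/-- The product of two exponential sums, in the form of a Cauchy product. -/
theorem expSum_mul [CharZero 𝕜] {S P Q : ℕ → R⟦X⟧} (hP : IsAdic P) (hQ : IsAdic Q)
    (h : ∀ r, S r = ∑ ij ∈ antidiagonal r, r.choose ij.1 • (P ij.1 * Q ij.2)) :
    expSum 𝕜 S = expSum 𝕜 P * expSum 𝕜 Q := by
  ext n
  have hPQ : ∀ i j, n < i + j → coeff n (P i * Q j) = 0 := by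
    intro i j hij
    rw [coeff_mul]
    refine sum_eq_zero fun p hp => ?_
    rw [HasAntidiagonal.mem_antidiagonal] at hp
    by_cases hi : p.1 < i
    · rw [hP i _ hi, zero_mul]
    · rw [hQ j p.2 (by omega), mul_zero]
  let f : ℕ → ℕ → R := fun i j =>
    ((i.factorial : 𝕜)⁻¹ * (j.factorial : 𝕜)⁻¹) • coeff n (P i * Q j)
  have hl : coeff n (expSum 𝕜 S) = ∑ r ∈ range (n + 1), ∑ k ∈ range (r + 1), f k (r - k) := by
    rw [expSum, coeff_mk]
    refine sum_congr rfl fun r _ => ?_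
    rw [h r, map_sum, smul_sum, Nat.sum_antidiagonal_eq_sum_range_succ_mk]
    refine sum_congr rfl fun k hk => ?_
    rw [mem_range] at hk
    have hfac : (r.choose k : 𝕜) * k.factorial * (r - k).factorial = r.factorial := by
      exact_mod_cast Nat.choose_mul_factorial_mul_factorial (by omega : k ≤ r)
    have h1 : (r.factorial : 𝕜) ≠ 0 := by exact_mod_cast r.factorial_ne_zero
    have h2 : (k.factorial : 𝕜) ≠ 0 := by exact_mod_cast k.factorial_ne_zero
    have h3 : ((r - k).factorial : 𝕜) ≠ 0 := by exact_mod_cast (r - k).factorial_ne_zero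
    rw [map_nsmul, ← Nat.cast_smul_eq_nsmul 𝕜, smul_smul]
    congr 1
    field_simp
    linear_combination hfac
  rw [hl, sum_range_diag_flip, coeff_mul]
  have hr : ∀ p ∈ antidiagonal n, coeff p.1 (expSum 𝕜 P) * coeff p.2 (expSum 𝕜 Q) =
      ∑ i ∈ range (n + 1), ∑ j ∈ range (n + 1),
        ((i.factorial : 𝕜)⁻¹ * (j.factorial : 𝕜)⁻¹) • (coeff p.1 (P i) * coeff p.2 (Q j)) := by
    intro p hp
    rw [HasAntidiagonal.mem_antidiagonal] at hp
    rw [coeff_expSum hP (by omega : p.1 ≤ n), coeff_expSum hQ (by omega : p.2 ≤ n), sum_mul_sum]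
    refine sum_congr rfl fun i _ => sum_congr rfl fun j _ => ?_
    rw [smul_mul_smul_comm]
  rw [sum_congr rfl hr, sum_comm]
  refine sum_congr rfl fun i hi => ?_
  rw [sum_comm]
  have hf : ∀ j, f i j = ∑ p ∈ antidiagonal n,
      ((i.factorial : 𝕜)⁻¹ * (j.factorial : 𝕜)⁻¹) • (coeff p.1 (P i) * coeff p.2 (Q j)) := by
    intro j
    simp only [f, coeff_mul, smul_sum]
  simp only [← hf]
  refine sum_subset (range_subset_range.2 (by omega)) fun j _ hj => ?_
  rw [mem_range] at hi hj
  simp only [f]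
  rw [hPQ i j (by omega), smul_zero]

end FormalExp

/-! ### Conjugation of vector fields by the flow defining the numbers `a_j` -/

namespace DeltaCoeff

open PowerSeries Finset FormalExp

/-- The power series `∑_{j ≥ 1} a_j x^j`, so that the flow is that of `-x (∑ a_j x^j) d/dx`. -/
noncomputable def gen (a : ℕ → ℚ) : ℚ⟦X⟧ := mk fun j => if j = 0 then 0 else a j

theorem field_eq (a : ℕ → ℚ) : field a = X * gen a := by
  ext n
  match n with
  | 0 => simp [field]
  | 1 => simp [field, gen, coeff_succ_X_mul]
  | n + 2 => simp [field, gen, coeff_succ_X_mul]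

/-- The Lie bracket of `-x f(x) d/dx` and `-x g(x) d/dx` is `-x (bracket f g)(x) d/dx`. -/
noncomputable def bracket (f g : ℚ⟦X⟧) : ℚ⟦X⟧ :=
  X * (PowerSeries.derivative ℚ f * g - f * PowerSeries.derivative ℚ g)

theorem coeff_bracket (f g : ℚ⟦X⟧) (n : ℕ) : coeff n (bracket f g) =
    ∑ ij ∈ antidiagonal n, ((ij.1 : ℚ) - ij.2) * (coeff ij.1 f * coeff ij.2 g) := by
  have hX : ∀ (h : ℚ⟦X⟧) (m : ℕ), coeff m (X * PowerSeries.derivative ℚ h) = m * coeff m h := by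
    intro h m
    cases m with
    | zero => simp
    | succ m => rw [coeff_succ_X_mul, coeff_derivative]; push_cast; ring
  have : bracket f g = (X * PowerSeries.derivative ℚ f) * g
      - f * (X * PowerSeries.derivative ℚ g) := by
    rw [bracket]; ring
  rw [this, map_sub, coeff_mul, coeff_mul, ← sum_sub_distrib]
  refine sum_congr rfl fun ij _ => ?_
  rw [hX, hX]
  ring

theorem bracket_gen_iterate_isAdic (a : ℕ → ℚ) (f : ℚ⟦X⟧) :
    IsAdic fun i => (bracket (gen a))^[i] f := by
  intro r
  induction r with
  | zero => intro n hn; omega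
  | succ r ih =>
    intro n hn
    simp only [Function.iterate_succ_apply'] at ih ⊢
    rw [coeff_bracket]
    refine sum_eq_zero fun ij hij => ?_
    rw [HasAntidiagonal.mem_antidiagonal] at hij
    by_cases h : ij.1 = 0
    · simp [h, gen]
    · rw [ih ij.2 (by omega)]; simp

theorem der_iterate_isAdic (a : ℕ → ℚ) : IsAdic fun r => (der a)^[r] X := fun r n hn =>
  X_pow_dvd_iff.1 (der_iterate_dvd a r) n (by omega)

/-- `der a` as an additive map. -/
noncomputable def derHom (a : ℕ → ℚ) : ℚ⟦X⟧ →+ ℚ⟦X⟧ where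
  toFun := der a
  map_zero' := by simp [der]
  map_add' f g := by simp only [der, map_add]; ring

theorem der_mul (a : ℕ → ℚ) (f g : ℚ⟦X⟧) : der a (f * g) = der a f * g + f * der a g := by
  simp only [der, Derivation.leibniz, smul_eq_mul]
  ring

theorem flow_eq_expSum (a : ℕ → ℚ) : flow a = expSum ℚ fun r => (der a)^[r] X := by
  ext n
  simp [flow, expSum]

theorem expSum_derivative (a : ℕ → ℚ) :
    expSum ℚ (fun r => PowerSeries.derivative ℚ ((der a)^[r] X))
      = PowerSeries.derivative ℚ (flow a) := by
  ext n
  rw [coeff_derivative, flow, coeff_mk, sum_range_succ,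
    X_pow_dvd_iff.1 (der_iterate_dvd a (n + 1)) (n + 1) (by omega), mul_zero, add_zero, expSum,
    coeff_mk, sum_mul]
  refine sum_congr rfl fun r _ => ?_
  rw [coeff_derivative, smul_eq_mul, mul_assoc]

/-- The exponential of a derivation is multiplicative. -/
theorem expSum_der_sq (a : ℕ → ℚ) :
    expSum ℚ (fun r => (der a)^[r] (X * X)) = flow a * flow a := by
  rw [flow_eq_expSum]
  refine expSum_mul (der_iterate_isAdic a) (der_iterate_isAdic a) fun r => ?_
  refine iterate_eq_sum_choose (derHom a) (fun i j => (der a)^[i] X * (der a)^[j] X) ?_ r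
  intro i j
  simp only [Function.iterate_succ_apply']
  exact der_mul a _ _

/-- For `D = der a` and a vector field `Z = -x f(x) d/dx`, both sides are, up to sign, `exp(D) Z`
applied to the coordinate `x`, as `exp(D) Z = (exp(ad D) Z) exp(D)`. -/
theorem expSum_der_mul (a : ℕ → ℚ) (f : ℚ⟦X⟧) :
    expSum ℚ (fun r => (der a)^[r] (X * f)) =
      X * expSum ℚ (fun i => (bracket (gen a))^[i] f) * PowerSeries.derivative ℚ (flow a) := by
  have h1 : X * expSum ℚ (fun i => (bracket (gen a))^[i] f)
      = expSum ℚ (fun i => X * (bracket (gen a))^[i] f) := by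
    ext n
    cases n with
    | zero => simp [expSum]
    | succ n =>
      rw [coeff_succ_X_mul, coeff_expSum (bracket_gen_iterate_isAdic a f) (Nat.le_succ n), expSum,
        coeff_mk]
      simp only [coeff_succ_X_mul]
  rw [h1, ← expSum_derivative]
  refine expSum_mul ?_ ?_ fun r => ?_
  · intro r n hn
    cases n with
    | zero => simp
    | succ n =>
      rw [coeff_succ_X_mul]
      exact bracket_gen_iterate_isAdic a f r n (by omega)
  · intro r n hn
    dsimp only
    rw [coeff_derivative, X_pow_dvd_iff.1 (der_iterate_dvd a r) (n + 1) (by omega), zero_mul]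
  · have := iterate_eq_sum_choose (derHom a)
      (fun i j => X * (bracket (gen a))^[i] f * PowerSeries.derivative ℚ ((der a)^[j] X)) ?_ r
    · simpa [derHom] using this
    · intro i j
      simp only [Function.iterate_succ_apply']
      change der a _ = _
      generalize (bracket (gen a))^[i] f = g
      generalize (der a)^[j] X = h
      simp only [der, bracket, field_eq, Derivation.leibniz, smul_eq_mul, map_neg, derivative_X]
      ring

/-- The flow `x ↦ x + x²/2` carries the vector field `(2x + 4x²) d/dx` to
`(2x + 3x² + x³) d/dx`. -/
theorem expSum_bracket_a :
    expSum ℚ (fun i => (bracket (gen (a 2)))^[i] (C 2 + C 4 * X)) = C 2 + C 3 * X + X ^ 2 := by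
  have hlin : ∀ r, (der (a 2))^[r] (X * (C 2 + C 4 * X)) =
      C 2 * (der (a 2))^[r] X + C 4 * (der (a 2))^[r] (X * X) := by
    intro r
    induction r with
    | zero => simp; ring
    | succ r ih =>
      simp only [Function.iterate_succ_apply', ih]
      generalize (der (a 2))^[r] X = g
      generalize (der (a 2))^[r] (X * X) = h
      have hC : ∀ c : ℚ, PowerSeries.derivative ℚ (C c : ℚ⟦X⟧) = 0 := fun _ => derivative_C
      simp only [der, map_add, Derivation.leibniz, smul_eq_mul, hC]
      ring
  have h1 := expSum_der_mul (a 2) (C 2 + C 4 * X)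
  simp only [hlin] at h1
  rw [expSum_add, expSum_const_mul, expSum_const_mul, expSum_der_sq, ← flow_eq_expSum,
    flow_a 2 two_ne_zero] at h1
  have hC : ∀ c : ℚ, PowerSeries.derivative ℚ (C c : ℚ⟦X⟧) = 0 := fun _ => derivative_C
  have hd : PowerSeries.derivative ℚ (target 2) = 1 + X := by
    simp only [target, map_sub, Derivation.leibniz, Derivation.leibniz_pow, hC, map_add,
      derivative_X, smul_eq_mul]
    have : (C (1 / ((2 : ℕ) : ℚ)) : ℚ⟦X⟧) * 2 = 1 := by
      rw [← map_ofNat (C (R := ℚ)) 2, ← map_mul]; norm_num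
    simp only [nsmul_eq_mul, Derivation.map_one_eq_zero]
    push_cast at this ⊢
    linear_combination (1 + X) * this
  have hne : (X * (1 + X) : ℚ⟦X⟧) ≠ 0 := by
    refine mul_ne_zero X_ne_zero fun h => ?_
    have := congrArg (coeff 0) h
    simp at this
  rw [hd] at h1
  refine mul_left_cancel₀ hne ?_
  have h2 : (target 2) = X + C (1 / 2) * X ^ 2 := by
    have : (C (1 / 2) : ℚ⟦X⟧) * 2 = 1 := by
      rw [← map_ofNat (C (R := ℚ)) 2, ← map_mul]; norm_num
    rw [target]
    push_cast
    linear_combination X * this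
  rw [h2] at h1
  have h3 : (C (1 / 2) : ℚ⟦X⟧) * 2 = 1 := by
    rw [← map_ofNat (C (R := ℚ)) 2, ← map_mul]; norm_num
  have h4 : (C 2 : ℚ⟦X⟧) = 2 := map_ofNat C 2
  have h5 : (C 4 : ℚ⟦X⟧) = 4 := map_ofNat C 4
  have h6 : (C 3 : ℚ⟦X⟧) = 3 := map_ofNat C 3
  rw [h4, h5] at h1
  rw [h4, h5, h6]
  linear_combination -h1 + (X ^ 2 + 4 * X ^ 3 + X ^ 4 * (1 + 2 * C (1 / 2))) * h3

end DeltaCoeff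

/-! ### Weights and Virasoro commutators in a vertex operator superalgebra -/

/-- For `l = 0` the sums on the left side of the Jacobi identity reduce to their first term. -/
theorem finsum_neg_one_pow_choose_zero {M : Type*} [AddCommGroup M] [Module ℂ M] (F : ℕ → M) :
    ∑ᶠ i : ℕ, ((-1 : ℂ) ^ i * (Ring.choose ((0 : ℤ) : ℂ) i : ℂ)) • F i = F 0 := by
  rw [finsum_eq_single _ 0]
  · simp
  · intro i hi
    simp [Ring.choose_zero_ite, hi]

namespace VOSA

variable {V : Type*} [AddCommGroup V] [Module ℂ V] (A : VOSA V)

theorem exists_mode_eq_zero (u v : V) : ∃ N : ℤ, ∀ n ≥ N, A.mode u n v = 0 := by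
  obtain ⟨N, hN⟩ := VertexTensor.exists_coeff_eq_zero (A.Y u) v
  refine ⟨-N, fun n hn => ?_⟩
  rw [SuperVertexData.mode, VertexOperator.ncoeff_apply]
  exact hN _ (by omega)

theorem mode_add (u v : V) (n : ℤ) : A.mode (u + v) n = A.mode u n + A.mode v n := by
  simp only [SuperVertexData.mode, map_add, Pi.add_apply]

theorem mode_smul (r : ℂ) (v : V) (n : ℤ) : A.mode (r • v) n = r • A.mode v n := by
  simp only [SuperVertexData.mode, map_smul, Pi.smul_apply]

theorem mode_zero (n : ℤ) : A.mode 0 n = 0 := by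
  simp only [SuperVertexData.mode, map_zero, Pi.zero_apply]

/-- The weight spaces are the full eigenspaces of `L(0)`. -/
theorem mem_weight {n : ℤ} {v : V} (h : A.L 0 v = ((n : ℂ) / 2) • v) : v ∈ A.weight n := by
  classical
  obtain ⟨f, rfl⟩ := A.weight_internal.2 v
  have hmap : (DirectSum.coeLinearMap A.weight) ∘ₗ
      (DFinsupp.mapRange.linearMap fun i : ℤ =>
        (((i : ℂ) - n) / 2) • (LinearMap.id : A.weight i →ₗ[ℂ] A.weight i))
      = (A.L 0 - ((n : ℂ) / 2) • LinearMap.id) ∘ₗ DirectSum.coeLinearMap A.weight := by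
    refine DirectSum.linearMap_ext ℂ fun i => LinearMap.ext fun x => ?_
    have : (DFinsupp.mapRange.linearMap fun i : ℤ =>
        (((i : ℂ) - n) / 2) • (LinearMap.id : A.weight i →ₗ[ℂ] A.weight i))
        (DirectSum.lof ℂ ℤ (fun i => A.weight i) i x)
        = DirectSum.lof ℂ ℤ (fun i => A.weight i) i ((((i : ℂ) - n) / 2) • x) :=
      DFinsupp.mapRange_single (hf := fun i => map_zero _)
    simp only [LinearMap.comp_apply]
    erw [this]
    rw [DirectSum.coeLinearMap_lof, DirectSum.coeLinearMap_lof]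
    simp only [LinearMap.sub_apply, LinearMap.smul_apply, LinearMap.id_apply,
      A.L_zero i x x.2, Submodule.coe_smul]
    module
  have h0 := LinearMap.congr_fun hmap f
  have h1 : (A.L 0 - ((n : ℂ) / 2) • LinearMap.id : V →ₗ[ℂ] V)
      (DirectSum.coeLinearMap A.weight f) = 0 := by
    have h' : A.L 0 (DirectSum.coeLinearMap A.weight f)
        = ((n : ℂ) / 2) • (DirectSum.coeLinearMap A.weight f) := h
    rw [LinearMap.sub_apply, h']
    simp
  rw [LinearMap.comp_apply, LinearMap.comp_apply, h1] at h0
  have h2 := A.weight_internal.1 (h0.trans (map_zero _).symm)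
  have h3 : ∀ i, i ≠ n → f i = 0 := by
    intro i hi
    have := DFunLike.congr_fun h2 i
    have h4 : (((i : ℂ) - n) / 2) • f i = 0 := by
      exact this
    refine (smul_eq_zero.1 h4).resolve_left ?_
    have : (i : ℂ) - n ≠ 0 := sub_ne_zero.2 (by exact_mod_cast hi)
    simpa using this
  have h4 : f = DirectSum.lof ℂ ℤ (fun i => A.weight i) n (f n) := by
    ext i
    by_cases hi : i = n
    · subst hi; simp [DirectSum.lof_eq_of, DirectSum.of_eq_same]
    · rw [h3 i hi, DirectSum.lof_eq_of, DirectSum.of_eq_of_ne _ _ _ (by simpa using hi)]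
  change DirectSum.coeLinearMap A.weight f ∈ A.weight n
  rw [h4, DirectSum.coeLinearMap_lof]
  exact (f n).2

/-- The commutator formula `[L(N-1), v_k] = ∑ binom(N, i) (L(i-1)v)_{N+k-i}`. -/
theorem L_mode (N : ℕ) {b : ℤ} {v : V} (hv : v ∈ A.weight b) (k : ℤ) (w : V) :
    A.L ((N : ℤ) - 1) (A.mode v k w) = A.mode v k (A.L ((N : ℤ) - 1) w) +
      ∑ i ∈ Finset.range (N + 1),
        (N.choose i : ℂ) • A.mode (A.L ((i : ℤ) - 1) v) (N + k - i) w := by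
  have h := A.jacobi 4 b A.conf v w A.conf_mem hv 0 N k
  rw [finsum_neg_one_pow_choose_zero, finsum_neg_one_pow_choose_zero] at h
  have hs : ((-1 : ℂ) ^ (4 * b) * (-1) ^ (0 : ℤ)) = 1 := by
    rw [(show Even (4 * b) from ⟨2 * b, by ring⟩).neg_one_zpow]; simp
  have hr : ∑ᶠ i : ℕ, (Ring.choose (((N : ℤ) : ℂ)) i : ℂ) •
        A.mode (A.mode A.conf (0 + i) v) (N + k - i) w
      = ∑ i ∈ Finset.range (N + 1),
        (N.choose i : ℂ) • A.mode (A.L ((i : ℤ) - 1) v) (N + k - i) w := by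
    rw [finsum_eq_sum_of_support_subset _ (s := Finset.range (N + 1))]
    · refine Finset.sum_congr rfl fun i _ => ?_
      rw [Int.cast_natCast, Ring.choose_natCast, SuperVertexData.L]
      simp
    · intro i hi
      rw [Function.mem_support, Int.cast_natCast, Ring.choose_natCast] at hi
      by_contra hi'
      rw [Finset.mem_coe, Finset.mem_range, not_lt] at hi'
      exact hi (by simp [Nat.choose_eq_zero_of_lt (by omega : N < i)])
  rw [hs, hr, one_smul] at h
  simp only [Nat.cast_zero, sub_zero, add_zero] at h
  rw [SuperVertexData.L, sub_add_cancel, ← h]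
  abel

theorem L_zero_mode {b : ℤ} {v : V} (hv : v ∈ A.weight b) (k : ℤ) (w : V) :
    A.L 0 (A.mode v k w) = A.mode v k (A.L 0 w) + ((b : ℂ) / 2 - k - 1) • A.mode v k w := by
  have h := A.L_mode 1 hv k w
  simp only [Finset.sum_range_succ, Finset.sum_range_zero] at h
  norm_num at h
  rw [h, A.L_neg_one, A.L_zero b v hv, A.mode_smul]
  simp only [LinearMap.smul_apply, show (1 : ℤ) + k - 1 = k by ring]
  push_cast
  module

theorem L_one_mode {b : ℤ} {v : V} (hv : v ∈ A.weight b) (k : ℤ) (w : V) :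
    A.L 1 (A.mode v k w) = A.mode v k (A.L 1 w) + ((b : ℂ) - k - 2) • A.mode v (k + 1) w
      + A.mode (A.L 1 v) k w := by
  have h := A.L_mode 2 hv k w
  simp only [Finset.sum_range_succ, Finset.sum_range_zero, Nat.choose] at h
  norm_num at h
  rw [h, A.L_neg_one, A.L_zero b v hv, A.mode_smul]
  simp only [LinearMap.smul_apply, show (2 : ℤ) + k - 1 = k + 1 by ring]
  push_cast
  module

theorem L_two_mode {b : ℤ} {v : V} (hv : v ∈ A.weight b) (k : ℤ) (w : V) :
    A.L 2 (A.mode v k w) = A.mode v k (A.L 2 w)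
      + (3 * (b : ℂ) / 2 - k - 3) • A.mode v (k + 2) w
      + (3 : ℂ) • A.mode (A.L 1 v) (k + 1) w + A.mode (A.L 2 v) k w := by
  have h := A.L_mode 3 hv k w
  simp only [Finset.sum_range_succ, Finset.sum_range_zero, Nat.choose] at h
  norm_num at h
  rw [h, A.L_neg_one, A.L_zero b v hv, A.mode_smul]
  simp only [LinearMap.smul_apply, show (3 : ℤ) + k - 1 = k + 2 by ring,
    show (3 : ℤ) + k - 2 = k + 1 by ring]
  push_cast
  module

theorem mode_mem {b c : ℤ} {v w : V} (hv : v ∈ A.weight b) (hw : w ∈ A.weight c) (k : ℤ) :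
    A.mode v k w ∈ A.weight (b + c - 2 * k - 2) := by
  refine A.mem_weight ?_
  rw [A.L_zero_mode hv, A.L_zero c w hw, map_smul]
  push_cast
  module

theorem L_mem {m : ℤ} {v : V} (hv : v ∈ A.weight m) (n : ℤ) :
    A.L n v ∈ A.weight (m - 2 * n) := by
  have := A.mode_mem A.conf_mem hv (n + 1)
  rwa [show 4 + m - 2 * (n + 1) - 2 = m - 2 * n by ring] at this

theorem L_vac {n : ℤ} (hn : -1 ≤ n) : A.L n A.vac = 0 :=
  A.creation_regular _ _ (by omega)

theorem L_neg_two_vac : A.L (-2) A.vac = A.conf := A.creation _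

theorem L_one_conf : A.L 1 A.conf = 0 := by
  have h := LinearMap.congr_fun (A.virasoro 1 (-2)) A.vac
  simpa [A.L_vac, L_neg_two_vac] using h

theorem L_two_conf : A.L 2 A.conf = (A.c / 2) • A.vac := by
  have h := LinearMap.congr_fun (A.virasoro 2 (-2)) A.vac
  simp [A.L_vac, L_neg_two_vac] at h
  rw [h]
  congr 1
  ring

end VOSA

/-! ### The exponential operator in `Δ₂(x)` and its inverse -/

namespace VOSA

open PowerSeries Finset FormalExp DeltaCoeff

variable {V : Type*} [AddCommGroup V] [Module ℂ V] (A : VOSA V)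

/-- The series `∑_{j ≥ 0} c_j L(j) y^j` of operators on `V` attached to `∑ c_j x^j`; it represents
the vector field `-x (∑ c_j y^j x^j) d/dx`. -/
noncomputable def vir (f : ℚ⟦X⟧) : (Module.End ℂ V)⟦X⟧ :=
  PowerSeries.mk fun j => ((coeff j f : ℚ) : ℂ) • A.L j

theorem vir_bracket (f g : ℚ⟦X⟧) :
    A.vir f * A.vir g - A.vir g * A.vir f = A.vir (bracket f g) := by
  ext1 n
  have h : coeff n (A.vir g * A.vir f) = ∑ ij ∈ antidiagonal n,
      coeff ij.2 (A.vir g) * coeff ij.1 (A.vir f) := by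
    rw [coeff_mul, ← Nat.sum_antidiagonal_swap]
    rfl
  rw [map_sub, h, coeff_mul, ← sum_sub_distrib, vir, vir, vir, coeff_mk, coeff_bracket,
    Rat.cast_sum, sum_smul]
  refine sum_congr rfl fun ij hij => ?_
  rw [HasAntidiagonal.mem_antidiagonal] at hij
  rw [coeff_mk, coeff_mk]
  have hv := A.virasoro ij.1 ij.2
  have hc : (if (ij.1 : ℤ) + ij.2 = 0 then (((ij.1 : ℤ) : ℂ) ^ 3 - ((ij.1 : ℤ) : ℂ)) / 12 * A.c
      else 0) = 0 := by
    split_ifs with h0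
    · have : ij.1 = 0 := by omega
      simp [this]
    · rfl
  rw [hc, zero_smul, add_zero, ← Nat.cast_add, hij] at hv
  have : ∀ (a b : ℂ) (S T : Module.End ℂ V), (a • S) * (b • T) - (b • T) * (a • S)
      = (a * b) • (S * T - T * S) := by
    intro a b S T
    rw [smul_mul_smul_comm, smul_mul_smul_comm, mul_comm b a, smul_sub]
  rw [this, hv, smul_smul]
  congr 1
  push_cast
  ring

/-- The exponent `∑_{j ≥ 1} a_j y^j L(j)`. -/
noncomputable def deltaLog : (Module.End ℂ V)⟦X⟧ := A.vir (gen (a 2))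

/-- The series `exp(∑_{j ≥ 1} a_j y^j L(j))`. -/
noncomputable def deltaSeries : (Module.End ℂ V)⟦X⟧ := expSum ℂ fun r => A.deltaLog ^ r

/-- The series `exp(-∑_{j ≥ 1} a_j y^j L(j))`. -/
noncomputable def deltaInv : (Module.End ℂ V)⟦X⟧ := expSum ℂ fun r => (-A.deltaLog) ^ r

theorem coeff_deltaSeries (s : ℕ) : coeff s A.deltaSeries = A.deltaExp 2 s := by
  have h : A.deltaLog = PowerSeries.mk fun j : ℕ => ((DeltaCoeff.a 2 j : ℚ) : ℂ) • A.L j := by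
    ext1 n
    rw [deltaLog, vir, coeff_mk, coeff_mk, gen, coeff_mk]
    split_ifs with h0
    · subst h0; simp [DeltaCoeff.a, DeltaCoeff.aux]
    · rfl
  rw [deltaSeries, expSum, coeff_mk, deltaExp, h]

theorem isAdic_pow {R : Type*} [Ring R] {f : R⟦X⟧} (hf : coeff 0 f = 0) :
    IsAdic fun r => f ^ r := by
  intro r
  induction r with
  | zero => intro n hn; omega
  | succ r ih =>
    intro n hn
    dsimp only at ih ⊢
    rw [pow_succ, coeff_mul]
    refine sum_eq_zero fun ij hij => ?_
    rw [HasAntidiagonal.mem_antidiagonal] at hij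
    by_cases h : ij.2 = 0
    · rw [h, hf, mul_zero]
    · rw [ih ij.1 (by omega), zero_mul]

theorem coeff_zero_deltaLog : coeff 0 A.deltaLog = 0 := by
  simp [deltaLog, vir, gen]

theorem expSum_zero_pow {R : Type*} [Ring R] [Algebra ℂ R] :
    expSum ℂ (fun r => (0 : R⟦X⟧) ^ r) = 1 := by
  ext1 n
  rw [expSum, coeff_mk, sum_range_succ']
  simp

theorem expSum_mul_neg {R : Type*} [Ring R] [Algebra ℂ R] {f : R⟦X⟧} (hf : coeff 0 f = 0) :
    (expSum ℂ fun r => f ^ r) * (expSum ℂ fun r => (-f) ^ r) = 1 := by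
  rw [← expSum_mul (S := fun r => (0 : R⟦X⟧) ^ r) (isAdic_pow hf)
    (isAdic_pow (by rw [map_neg, hf, neg_zero])), expSum_zero_pow]
  intro r
  rw [← add_neg_cancel f, (Commute.neg_right (Commute.refl f)).add_pow']

theorem deltaSeries_mul_deltaInv : A.deltaSeries * A.deltaInv = 1 :=
  expSum_mul_neg A.coeff_zero_deltaLog

theorem deltaInv_mul_deltaSeries : A.deltaInv * A.deltaSeries = 1 := by
  have := expSum_mul_neg (R := Module.End ℂ V) (f := -A.deltaLog)
    (by rw [map_neg, A.coeff_zero_deltaLog, neg_zero])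
  rwa [neg_neg] at this

/-- Hadamard's formula: conjugation of `∑ f_j L(j) y^j` by the exponential is computed by iterated
brackets. -/
theorem deltaSeries_mul_vir (f : ℚ⟦X⟧) : A.deltaSeries * A.vir f =
    A.vir (expSum ℚ fun i => (bracket (gen (a 2)))^[i] f) * A.deltaSeries := by
  have h1 : A.vir (expSum ℚ fun i => (bracket (gen (a 2)))^[i] f) =
      expSum ℂ fun i => A.vir ((bracket (gen (a 2)))^[i] f) := by
    ext1 n
    simp only [vir, expSum, coeff_mk, Rat.cast_sum, sum_smul]
    refine sum_congr rfl fun r _ => ?_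
    rw [smul_smul, smul_eq_mul]
    push_cast
    rfl
  have h2 : A.deltaSeries * A.vir f = expSum ℂ fun r => A.deltaLog ^ r * A.vir f := by
    ext1 n
    rw [coeff_mul, expSum, coeff_mk]
    simp only [coeff_mul, smul_sum]
    rw [sum_comm]
    refine sum_congr rfl fun ij hij => ?_
    rw [HasAntidiagonal.mem_antidiagonal] at hij
    rw [deltaSeries, coeff_expSum (isAdic_pow A.coeff_zero_deltaLog) (by omega : ij.1 ≤ n),
      sum_mul]
    simp only [smul_mul_assoc]
  rw [h1, h2]
  refine expSum_mul ?_ (isAdic_pow A.coeff_zero_deltaLog) fun r => ?_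
  · intro r n hn
    dsimp only
    rw [vir, coeff_mk, bracket_gen_iterate_isAdic (a 2) f r n hn]
    simp
  · have h := iterate_eq_sum_choose (AddMonoidHom.mulLeft A.deltaLog)
      (fun i j => A.vir ((bracket (gen (a 2)))^[i] f) * A.deltaLog ^ j) ?_ r
    · rw [← h]
      simp [AddMonoidHom.coe_mulLeft, mul_left_iterate]
    · intro i j
      rw [AddMonoidHom.coe_mulLeft, Function.iterate_succ_apply', ← vir_bracket, ← deltaLog,
        pow_succ']
      noncomm_ring

/-- The relation that replaces the coordinate change in the proofs below: conjugation by the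
exponential turns `2L(0) + 4yL(1)` into `2L(0) + 3yL(1) + y²L(2)`. -/
theorem deltaSeries_relation :
    A.deltaSeries * A.vir (C 2 + C 4 * X) = A.vir (C 2 + C 3 * X + X ^ 2) * A.deltaSeries := by
  rw [deltaSeries_mul_vir, expSum_bracket_a]

theorem deltaInv_relation :
    A.vir (C 2 + C 4 * X) * A.deltaInv = A.deltaInv * A.vir (C 2 + C 3 * X + X ^ 2) := by
  have h : A.deltaInv * (A.deltaSeries * A.vir (C 2 + C 4 * X)) * A.deltaInv =
      A.deltaInv * (A.vir (C 2 + C 3 * X + X ^ 2) * A.deltaSeries) * A.deltaInv := by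
    rw [A.deltaSeries_relation]
  rwa [← mul_assoc, deltaInv_mul_deltaSeries, one_mul, mul_assoc, mul_assoc,
    deltaSeries_mul_deltaInv, mul_one] at h

/-- The coefficient of `y^n`, `n ∈ ℤ`, in `exp(-∑_{j ≥ 1} a_j y^j L(j))`. -/
noncomputable def einv (n : ℤ) : Module.End ℂ V :=
  if 0 ≤ n then coeff n.toNat A.deltaInv else 0

theorem einv_of_neg {n : ℤ} (h : n < 0) : A.einv n = 0 := if_neg (by omega)

theorem einv_natCast (n : ℕ) : A.einv n = coeff n A.deltaInv := by
  rw [einv, if_pos (Int.natCast_nonneg n), Int.toNat_natCast]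

theorem einv_zero : A.einv 0 = 1 := by
  have := A.einv_natCast 0
  rw [Nat.cast_zero] at this
  rw [this, deltaInv, expSum, coeff_mk]
  simp

theorem vir_two_four : A.vir (C 2 + C 4 * X) =
    C ((2 : ℂ) • A.L 0) + C ((4 : ℂ) • A.L 1) * X := by
  ext1 n
  match n with
  | 0 => simp [vir]
  | 1 => simp [vir]
  | n + 2 => simp [vir, coeff_X]

theorem vir_two_three_one : A.vir (C 2 + C 3 * X + X ^ 2) =
    C ((2 : ℂ) • A.L 0) + C ((3 : ℂ) • A.L 1) * X + C (A.L 2) * X ^ 2 := by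
  ext1 n
  match n with
  | 0 => simp [vir]
  | 1 => simp [vir, coeff_X_pow]
  | 2 => simp [vir, coeff_X, coeff_X_pow]
  | n + 3 => simp [vir, coeff_X, coeff_X_pow]

theorem einv_relation (s : ℤ) :
    (2 : ℂ) • (A.L 0 * A.einv s) + (4 : ℂ) • (A.L 1 * A.einv (s - 1)) =
      (2 : ℂ) • (A.einv s * A.L 0) + (3 : ℂ) • (A.einv (s - 1) * A.L 1)
        + A.einv (s - 2) * A.L 2 := by
  have h := A.deltaInv_relation
  rw [vir_two_four, vir_two_three_one] at h
  rcases lt_or_ge s 0 with hs | hs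
  · rw [A.einv_of_neg hs, A.einv_of_neg (by omega : s - 1 < 0),
      A.einv_of_neg (by omega : s - 2 < 0)]
    simp
  obtain ⟨n, rfl⟩ := Int.eq_ofNat_of_zero_le hs
  have hn := congrArg (coeff n) h
  have hX : ∀ f : (Module.End ℂ V)⟦X⟧, X * f = f * X := fun f => ((commute_X f).eq).symm
  simp only [add_mul, mul_add, map_add, mul_assoc, hX] at hn
  simp only [← mul_assoc, coeff_C_mul, coeff_mul_C] at hn
  match n with
  | 0 =>
    rw [A.einv_of_neg (by omega : ((0 : ℕ) : ℤ) - 1 < 0),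
      A.einv_of_neg (by omega : ((0 : ℕ) : ℤ) - 2 < 0), A.einv_natCast]
    simpa [coeff_mul_X_pow'] using hn
  | 1 =>
    rw [A.einv_of_neg (by omega : ((1 : ℕ) : ℤ) - 2 < 0), A.einv_natCast,
      show ((1 : ℕ) : ℤ) - 1 = ((0 : ℕ) : ℤ) by omega, A.einv_natCast]
    simpa [coeff_mul_X_pow', coeff_succ_mul_X] using hn
  | n + 2 =>
    rw [A.einv_natCast, show ((n + 2 : ℕ) : ℤ) - 1 = ((n + 1 : ℕ) : ℤ) by omega, A.einv_natCast,
      show ((n + 2 : ℕ) : ℤ) - 2 = ((n : ℕ) : ℤ) by omega, A.einv_natCast]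
    simpa [coeff_mul_X_pow', coeff_succ_mul_X] using hn

end VOSA

namespace VOSA

open PowerSeries Finset FormalExp DeltaCoeff

variable {V : Type*} [AddCommGroup V] [Module ℂ V] (A : VOSA V)

/-- A series of operators whose coefficient of `y^s` lowers weights by `s`. -/
def IsLowering (F : (Module.End ℂ V)⟦X⟧) : Prop :=
  ∀ (s : ℕ) (m : ℤ), ∀ v ∈ A.weight m, coeff s F v ∈ A.weight (m - 2 * s)

variable {A}

theorem IsLowering.pow {F : (Module.End ℂ V)⟦X⟧} (hF : A.IsLowering F) (r : ℕ) :
    A.IsLowering (F ^ r) := by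
  induction r with
  | zero =>
    intro s m v hv
    rw [pow_zero, coeff_one]
    split_ifs with h
    · simpa [h] using hv
    · exact zero_mem _
  | succ r ih =>
    intro s m v hv
    rw [pow_succ, coeff_mul, LinearMap.sum_apply]
    refine sum_mem fun ij hij => ?_
    rw [HasAntidiagonal.mem_antidiagonal] at hij
    have := ih ij.1 _ _ (hF ij.2 m v hv)
    rwa [show m - 2 * (ij.2 : ℤ) - 2 * (ij.1 : ℤ) = m - 2 * s by push_cast [← hij]; ring] at this

theorem IsLowering.expSum {S : ℕ → (Module.End ℂ V)⟦X⟧} (hS : ∀ r, A.IsLowering (S r)) :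
    A.IsLowering (expSum ℂ S) := by
  intro s m v hv
  rw [FormalExp.expSum, coeff_mk, LinearMap.sum_apply]
  exact sum_mem fun r _ => Submodule.smul_mem _ _ (hS r s m v hv)

variable (A)

theorem isLowering_deltaLog : A.IsLowering A.deltaLog := by
  intro s m v hv
  rw [deltaLog, vir, coeff_mk]
  exact Submodule.smul_mem _ _ (A.L_mem hv s)

theorem isLowering_neg_deltaLog : A.IsLowering (-A.deltaLog) := by
  intro s m v hv
  rw [map_neg]
  exact Submodule.neg_mem _ (A.isLowering_deltaLog s m v hv)

theorem deltaExp_mem {m : ℤ} {v : V} (hv : v ∈ A.weight m) (s : ℕ) :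
    A.deltaExp 2 s v ∈ A.weight (m - 2 * s) := by
  rw [← coeff_deltaSeries]
  exact IsLowering.expSum (fun r => A.isLowering_deltaLog.pow r) s m v hv

theorem einv_mem {m : ℤ} {v : V} (hv : v ∈ A.weight m) (s : ℤ) :
    A.einv s v ∈ A.weight (m - 2 * s) := by
  rcases lt_or_ge s 0 with hs | hs
  · rw [A.einv_of_neg hs]; exact zero_mem _
  · obtain ⟨n, rfl⟩ := Int.eq_ofNat_of_zero_le hs
    rw [einv_natCast]
    exact IsLowering.expSum (fun r => A.isLowering_neg_deltaLog.pow r) n m v hv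

/-- A lower bound for the (doubled) weights of `V`. -/
noncomputable def minWeight : ℤ := A.weight_bounded.choose

theorem eq_zero_of_lt_minWeight {m : ℤ} {v : V} (hv : v ∈ A.weight m) (h : m < A.minWeight) :
    v = 0 := by
  rw [A.weight_bounded.choose_spec m h] at hv
  exact (Submodule.mem_bot ℂ).1 hv

theorem einv_eq_zero {m : ℤ} {v : V} (hv : v ∈ A.weight m) {s : ℤ}
    (h : m - 2 * s < A.minWeight) : A.einv s v = 0 :=
  A.eq_zero_of_lt_minWeight (A.einv_mem hv s) h

theorem deltaExp_eq_zero {m : ℤ} {v : V} (hv : v ∈ A.weight m) {s : ℕ}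
    (h : m - 2 * s < A.minWeight) : A.deltaExp 2 s v = 0 :=
  A.eq_zero_of_lt_minWeight (A.deltaExp_mem hv s) h

theorem sum_deltaExp_einv (n : ℕ) (v : V) :
    ∑ ij ∈ antidiagonal n, A.deltaExp 2 ij.1 (A.einv ij.2 v) = if n = 0 then v else 0 := by
  have h := LinearMap.congr_fun (congrArg (coeff n) A.deltaSeries_mul_deltaInv) v
  rw [coeff_mul, coeff_one, LinearMap.sum_apply] at h
  simp only [coeff_deltaSeries, ← einv_natCast] at h
  rw [show (∑ ij ∈ antidiagonal n, A.deltaExp 2 ij.1 (A.einv ij.2 v)) = _ from h]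
  split_ifs <;> rfl

theorem sum_einv_deltaExp (n : ℕ) (v : V) :
    ∑ ij ∈ antidiagonal n, A.einv ij.1 (A.deltaExp 2 ij.2 v) = if n = 0 then v else 0 := by
  have h := LinearMap.congr_fun (congrArg (coeff n) A.deltaInv_mul_deltaSeries) v
  rw [coeff_mul, coeff_one, LinearMap.sum_apply] at h
  simp only [coeff_deltaSeries, ← einv_natCast] at h
  rw [show (∑ ij ∈ antidiagonal n, A.einv ij.1 (A.deltaExp 2 ij.2 v)) = _ from h]
  split_ifs <;> rfl

theorem einv_relation_apply {m : ℤ} {v : V} (hv : v ∈ A.weight m) (s : ℤ) :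
    (4 : ℂ) • A.L 1 (A.einv (s - 1) v) = (2 * (s : ℂ)) • A.einv s v
      + (3 : ℂ) • A.einv (s - 1) (A.L 1 v) + A.einv (s - 2) (A.L 2 v) := by
  have h := LinearMap.congr_fun (A.einv_relation s) v
  simp only [LinearMap.add_apply, LinearMap.smul_apply, Module.End.mul_apply] at h
  rw [A.L_zero _ _ (A.einv_mem hv s), A.L_zero m v hv, map_smul] at h
  have h2 := eq_sub_of_add_eq' h
  rw [h2]
  push_cast
  module

theorem einv_vac {s : ℤ} (hs : s ≠ 0) : A.einv s A.vac = 0 := by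
  rcases lt_or_ge s 0 with h | h
  · rw [A.einv_of_neg h]; rfl
  obtain ⟨n, rfl⟩ := Int.eq_ofNat_of_zero_le h
  induction n using Nat.strong_induction_on with
  | _ n ih =>
    have h1 := A.einv_relation_apply A.vac_mem n
    have h2 : A.L 1 (A.einv ((n : ℤ) - 1) A.vac) = 0 := by
      by_cases hn : n = 1
      · subst hn
        rw [show ((1 : ℕ) : ℤ) - 1 = 0 by norm_num, einv_zero]
        exact A.L_vac (by norm_num)
      · have := ih (n - 1) (by omega) (by omega) (by omega)
        rw [show ((n : ℤ) - 1) = ((n - 1 : ℕ) : ℤ) by omega, this, map_zero]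
    rw [h2, A.L_vac (by norm_num : (-1 : ℤ) ≤ 1), A.L_vac (by norm_num : (-1 : ℤ) ≤ 2), map_zero,
      map_zero, smul_zero, smul_zero, add_zero, add_zero] at h1
    refine (smul_eq_zero.1 h1.symm).resolve_left ?_
    have : ((n : ℤ) : ℂ) ≠ 0 := by exact_mod_cast hs
    simpa using this

theorem deltaSeries_relation_apply {m : ℤ} {v : V} (hv : v ∈ A.weight m) (s : ℕ) :
    (2 * ((s : ℂ) + 2)) • A.deltaExp 2 (s + 2) v = (3 : ℂ) • A.L 1 (A.deltaExp 2 (s + 1) v)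
      + A.L 2 (A.deltaExp 2 s v) - (4 : ℂ) • A.deltaExp 2 (s + 1) (A.L 1 v) := by
  have h := A.deltaSeries_relation
  rw [vir_two_four, vir_two_three_one] at h
  have hn := congrArg (coeff (s + 2)) h
  have hX : ∀ f : (Module.End ℂ V)⟦X⟧, X * f = f * X := fun f => ((commute_X f).eq).symm
  have hX2 : ∀ f : (Module.End ℂ V)⟦X⟧, X ^ 2 * f = f * X ^ 2 :=
    fun f => ((commute_X_pow f 2).eq).symm
  simp only [add_mul, mul_add, map_add, mul_assoc, hX, hX2] at hn
  simp only [← mul_assoc, coeff_C_mul, coeff_mul_C, coeff_succ_mul_X, coeff_mul_X_pow,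
    coeff_deltaSeries] at hn
  have h3 := LinearMap.congr_fun hn v
  simp only [LinearMap.add_apply, Module.End.mul_apply, LinearMap.smul_apply, map_smul] at h3
  rw [A.L_zero _ _ (A.deltaExp_mem hv (s + 2)), A.L_zero m v hv, map_smul] at h3
  have h4 := eq_sub_of_add_eq' h3
  rw [eq_sub_iff_add_eq]
  rw [← sub_eq_zero] at h3 ⊢
  rw [← h3]
  push_cast
  module

theorem deltaExp_zero : A.deltaExp 2 0 = 1 := by
  simp [deltaExp]

theorem deltaExp_one_conf : A.deltaExp 2 1 A.conf = 0 := by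
  have h1 : PowerSeries.coeff 1 (1 : (Module.End ℂ V)⟦X⟧) = 0 := by
    rw [coeff_one, if_neg one_ne_zero]
  simp [deltaExp, sum_range_succ, h1, A.L_one_conf]

theorem deltaExp_two_conf : A.deltaExp 2 2 A.conf = (A.c / 8) • A.vac := by
  have h := A.deltaSeries_relation_apply A.conf_mem 0
  rw [zero_add, zero_add, deltaExp_one_conf, L_one_conf, map_zero, map_zero, deltaExp_zero,
    Module.End.one_apply, L_two_conf] at h
  have h2 : A.deltaExp 2 2 A.conf =
      (1 / 4 : ℂ) • ((2 * (((0 : ℕ) : ℂ) + 2)) • A.deltaExp 2 2 A.conf) := by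
    rw [smul_smul]; norm_num
  rw [h2, h]
  module

/-- Together with `deltaExp_one_conf` and `deltaExp_two_conf`, this says that
`exp(∑ a_j y^j L(j)) ω = ω + (c/8) y² 𝟏`. -/
theorem deltaExp_conf (s : ℕ) : A.deltaExp 2 (s + 3) A.conf = 0 := by
  have hvac1 : A.L 1 A.vac = 0 := A.L_vac (by norm_num)
  have hvac2 : A.L 2 A.vac = 0 := A.L_vac (by norm_num)
  have key : ∀ s : ℕ, A.L 1 (A.deltaExp 2 (s + 2) A.conf) = 0 →
      A.L 2 (A.deltaExp 2 (s + 1) A.conf) = 0 → A.deltaExp 2 (s + 3) A.conf = 0 := by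
    intro s h1 h2
    have h := A.deltaSeries_relation_apply A.conf_mem (s + 1)
    rw [show s + 1 + 1 = s + 2 from rfl, show s + 1 + 2 = s + 3 from rfl, h1, h2, L_one_conf,
      map_zero, smul_zero, smul_zero, add_zero, sub_zero] at h
    refine (smul_eq_zero.1 h).resolve_left ?_
    have : ((s + 3 : ℕ) : ℂ) ≠ 0 := by exact_mod_cast (by omega : s + 3 ≠ 0)
    push_cast at this ⊢
    intro h0
    exact this (by linear_combination h0 / 2)
  have h3 : A.deltaExp 2 3 A.conf = 0 :=
    key 0 (by rw [deltaExp_two_conf, map_smul, hvac1, smul_zero])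
      (by rw [deltaExp_one_conf, map_zero])
  have h4 : A.deltaExp 2 4 A.conf = 0 :=
    key 1 (by rw [h3, map_zero]) (by rw [deltaExp_two_conf, map_smul, hvac2, smul_zero])
  induction s using Nat.strong_induction_on with
  | _ s ih =>
    match s with
    | 0 => exact h3
    | 1 => exact h4
    | s + 2 =>
      refine key (s + 2) ?_ ?_
      · rw [show s + 2 + 2 = s + 1 + 3 from rfl, ih (s + 1) (by omega), map_zero]
      · rw [show s + 2 + 1 = s + 3 from rfl, ih s (by omega), map_zero]

end VOSA

/-! ### Residues in the coordinate `y` with `x = y + y²/2` -/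

namespace PowerSeries

/-- The coefficient of `X^n` for an integer `n`, which is zero for `n < 0`. -/
noncomputable def zcoeff (n : ℤ) : ℂ⟦X⟧ →ₗ[ℂ] ℂ := if 0 ≤ n then coeff n.toNat else 0

theorem zcoeff_natCast (n : ℕ) (f : ℂ⟦X⟧) : zcoeff n f = coeff n f := by
  rw [zcoeff, if_pos (Int.natCast_nonneg n), Int.toNat_natCast]

theorem zcoeff_of_neg {n : ℤ} (h : n < 0) (f : ℂ⟦X⟧) : zcoeff n f = 0 := by
  rw [zcoeff, if_neg (by omega), LinearMap.zero_apply]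

theorem zcoeff_X_mul (n : ℤ) (f : ℂ⟦X⟧) : zcoeff n (X * f) = zcoeff (n - 1) f := by
  rcases lt_or_ge n 0 with h | h
  · rw [zcoeff_of_neg h, zcoeff_of_neg (by omega)]
  obtain ⟨m, rfl⟩ := Int.eq_ofNat_of_zero_le h
  cases m with
  | zero => rw [zcoeff_natCast, zcoeff_of_neg (by norm_num)]; simp
  | succ m =>
    rw [zcoeff_natCast, coeff_succ_X_mul, show ((m + 1 : ℕ) : ℤ) - 1 = m by omega, zcoeff_natCast]

theorem zcoeff_X_pow_mul (r : ℕ) (n : ℤ) (f : ℂ⟦X⟧) : zcoeff n (X ^ r * f) = zcoeff (n - r) f := by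
  induction r generalizing n with
  | zero => simp
  | succ r ih =>
    rw [pow_succ', mul_assoc, zcoeff_X_mul, ih,
      show n - 1 - (r : ℤ) = n - ((r + 1 : ℕ) : ℤ) by push_cast; ring]

theorem zcoeff_C_mul (n : ℤ) (c : ℂ) (f : ℂ⟦X⟧) : zcoeff n (C c * f) = c * zcoeff n f := by
  rw [← smul_eq_C_mul, map_smul, smul_eq_mul]

theorem zcoeff_X_mul_derivative (n : ℤ) (f : ℂ⟦X⟧) :
    zcoeff n (X * derivative ℂ f) = n * zcoeff n f := by
  rcases lt_or_ge n 0 with h | h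
  · rw [zcoeff_of_neg h, zcoeff_of_neg h, mul_zero]
  obtain ⟨m, rfl⟩ := Int.eq_ofNat_of_zero_le h
  rw [zcoeff_natCast, zcoeff_natCast]
  cases m with
  | zero => simp
  | succ m => rw [coeff_succ_X_mul, coeff_derivative]; push_cast; ring

/-- The series `(1 + y)^γ`. -/
noncomputable def onePow (γ : ℂ) : ℂ⟦X⟧ := binomialSeries ℂ γ

/-- The series `(1 + y/2)^γ`. -/
noncomputable def halfPow (γ : ℂ) : ℂ⟦X⟧ := rescale (1 / 2) (binomialSeries ℂ γ)

theorem onePow_add (γ δ : ℂ) : onePow (γ + δ) = onePow γ * onePow δ := binomialSeries_add γ δ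

theorem halfPow_add (γ δ : ℂ) : halfPow (γ + δ) = halfPow γ * halfPow δ := by
  rw [halfPow, binomialSeries_add, map_mul]; rfl

theorem halfPow_zero : halfPow 0 = 1 := by rw [halfPow, binomialSeries_zero, map_one]

theorem onePow_one : onePow 1 = 1 + X := by
  simpa [onePow] using binomialSeries_nat (R := ℂ) (A := ℂ) 1

theorem halfPow_one : halfPow 1 = 1 + C (1 / 2) * X := by
  have h : binomialSeries ℂ (1 : ℂ) = 1 + X := onePow_one
  rw [halfPow, h, map_add, map_one, rescale_X]

theorem onePow_succ (γ : ℂ) : onePow (γ + 1) = (1 + X) * onePow γ := by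
  rw [onePow_add, onePow_one, mul_comm]

theorem halfPow_succ (γ : ℂ) : halfPow (γ + 1) = (1 + C (1 / 2) * X) * halfPow γ := by
  rw [halfPow_add, halfPow_one, mul_comm]

theorem succ_mul_choose (γ : ℂ) (n : ℕ) :
    ((n : ℂ) + 1) * Ring.choose γ (n + 1) = γ * Ring.choose (γ - 1) n := by
  have := Ring.choose_smul_choose γ (n := n + 1) (k := 1) (by omega)
  simpa using this

theorem derivative_onePow (γ : ℂ) : derivative ℂ (onePow γ) = C γ * onePow (γ - 1) := by
  ext n
  rw [coeff_derivative, coeff_C_mul, onePow, onePow, binomialSeries_coeff, binomialSeries_coeff]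
  have := succ_mul_choose γ n
  simp only [smul_eq_mul, mul_one]
  linear_combination this

theorem derivative_halfPow (γ : ℂ) :
    derivative ℂ (halfPow γ) = C (γ / 2) * halfPow (γ - 1) := by
  ext n
  rw [coeff_derivative, coeff_C_mul, halfPow, halfPow, coeff_rescale, coeff_rescale,
    binomialSeries_coeff, binomialSeries_coeff]
  have := succ_mul_choose γ n
  simp only [smul_eq_mul, mul_one, pow_succ]
  linear_combination (1 / 2) ^ n * (1 / 2) * this

/-- With `x = y + y²/2`, the coefficient of `x^j` in `y^k (1 + y)^(γ - 1)`, written as the residue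
of `x^(-j-1) y^k (1 + y)^γ dy`. -/
noncomputable def theta (j k : ℤ) (γ : ℂ) : ℂ :=
  zcoeff (j - k) (halfPow (-(j : ℂ) - 1) * onePow γ)

theorem theta_of_lt {j k : ℤ} (h : j < k) (γ : ℂ) : theta j k γ = 0 := zcoeff_of_neg (by omega) _

theorem theta_self (k : ℤ) (γ : ℂ) : theta k k γ = 1 := by
  rw [theta, show k - k = ((0 : ℕ) : ℤ) by simp, zcoeff_natCast]
  rw [coeff_zero_eq_constantCoeff_apply, map_mul, ← coeff_zero_eq_constantCoeff_apply, halfPow,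
    onePow, coeff_rescale]
  simp

theorem theta_add_one (j k : ℤ) (γ : ℂ) :
    theta j k (γ + 1) = theta j k γ + theta j (k + 1) γ := by
  simp only [theta]
  rw [onePow_succ, show halfPow (-(j : ℂ) - 1) * ((1 + X) * onePow γ) =
    halfPow (-(j : ℂ) - 1) * onePow γ + X * (halfPow (-(j : ℂ) - 1) * onePow γ) by ring, map_add,
    zcoeff_X_mul, show j - k - 1 = j - (k + 1) by ring]

theorem theta_sub_one (j k : ℤ) (γ : ℂ) :
    theta (j - 1) k γ = theta j (k + 1) γ + (1 / 2) * theta j (k + 2) γ := by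
  simp only [theta]
  rw [show (-((j - 1 : ℤ) : ℂ) - 1) = (-(j : ℂ) - 1) + 1 by push_cast; ring, halfPow_succ,
    show (1 + C (1 / 2) * X) * halfPow (-(j : ℂ) - 1) * onePow γ =
    halfPow (-(j : ℂ) - 1) * onePow γ +
      C (1 / 2) * (X * (halfPow (-(j : ℂ) - 1) * onePow γ)) by ring,
    map_add, zcoeff_C_mul, zcoeff_X_mul, show j - 1 - k - 1 = j - (k + 2) by ring,
    show j - 1 - k = j - (k + 1) by ring]

/-- The residue of the total derivative of `x^(-j) y^k (1 + y)^(γ + 1)` vanishes. -/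
theorem theta_total_derivative (j k : ℤ) (γ : ℂ) :
    (2 * ((j : ℂ) - k)) * theta j k γ = (2 * γ - 4 * j + 3 * k + 2) * theta j (k + 1) γ
      + (γ - 2 * j + k + 1) * theta j (k + 2) γ := by
  set Q : ℂ⟦X⟧ := halfPow (-(j : ℂ) - 1) * onePow γ with hQ
  have h := zcoeff_X_mul_derivative (j - k) (halfPow (-(j : ℂ)) * onePow (γ + 1))
  have h1 : halfPow (-(j : ℂ)) = (1 + C (1 / 2) * X) * halfPow (-(j : ℂ) - 1) := by
    rw [← halfPow_succ, sub_add_cancel]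
  have h2 : halfPow (-(j : ℂ)) * onePow (γ + 1) =
      Q + C (1 + 1 / 2) * (X * Q) + C (1 / 2) * (X * (X * Q)) := by
    rw [h1, onePow_succ, hQ, map_add, map_one]
    ring
  have h3 : X * derivative ℂ (halfPow (-(j : ℂ)) * onePow (γ + 1)) =
      C (-(j : ℂ) / 2 + (γ + 1)) * (X * Q)
        + C (-(j : ℂ) / 2 + 1 / 2 * (γ + 1)) * (X * (X * Q)) := by
    rw [Derivation.leibniz, derivative_onePow, derivative_halfPow, h1, onePow_succ,
      add_sub_cancel_right, hQ, map_add C (-(j : ℂ) / 2) (γ + 1),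
      map_add C (-(j : ℂ) / 2) (1 / 2 * (γ + 1)), map_mul C (1 / 2)]
    generalize C (γ + 1) = c
    simp only [smul_eq_mul]
    ring
  rw [h3, h2] at h
  simp only [map_add (zcoeff _), zcoeff_C_mul, zcoeff_X_mul] at h
  rw [theta, theta, theta, ← hQ]
  rw [show j - k - 1 - 1 = j - (k + 2) by ring, show j - k - 1 = j - (k + 1) by ring] at h
  push_cast at h
  linear_combination -2 * h

/-- The binomial coefficient `binom(m/2, i)` is, up to a power of `2`, the coefficient of `x^i` in
`(1 + 2x)^(m/2) = (1 + y)^m`. -/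
theorem theta_zero (i : ℕ) (m : ℂ) :
    theta i 0 (m + 1) = 2 ^ i * Ring.choose (m / 2) i := by
  induction i generalizing m with
  | zero => rw [Nat.cast_zero, theta_self]; simp
  | succ i ih =>
    have h1 := theta_total_derivative ((i + 1 : ℕ) : ℤ) 0 (m - 1)
    have h2 := theta_sub_one ((i + 1 : ℕ) : ℤ) 0 (m - 2 + 1)
    have h3 := theta_add_one ((i + 1 : ℕ) : ℤ) 0 m
    have h4 := theta_add_one ((i + 1 : ℕ) : ℤ) 0 (m - 1)
    have h5 := theta_add_one ((i + 1 : ℕ) : ℤ) 1 (m - 1)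
    rw [show (((i + 1 : ℕ) : ℤ) - 1) = i by omega, ih (m - 2)] at h2
    have h6 := succ_mul_choose (m / 2) i
    rw [show (m - 2) / 2 = m / 2 - 1 by ring] at h2
    rw [show m - 2 + 1 = m - 1 by ring] at h2
    norm_num at h1 h2 h3 h4 h5 ⊢
    have hne : (i : ℂ) + 1 ≠ 0 := by exact_mod_cast Nat.succ_ne_zero i
    refine mul_left_cancel₀ hne ?_
    rw [h3, h4, h5]
    linear_combination (1 / 2) * h1 - m * h2 - 2 ^ (i + 1) * h6

end PowerSeries

/-! ### The change of coordinates for vertex operators -/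

theorem hasFiniteSupport_of_box {M : Type*} [Zero M] {f : ℤ × ℤ → M} (B : ℤ)
    (h : ∀ p : ℤ × ℤ, p.1 < 0 ∨ p.2 < 0 ∨ B ≤ p.1 ∨ B ≤ p.2 → f p = 0) :
    Function.HasFiniteSupport f := by
  refine ((Set.finite_Ico (0 : ℤ) B).prod (Set.finite_Ico (0 : ℤ) B)).subset fun p hp => ?_
  rw [Function.mem_support] at hp
  by_contra hn
  refine hp (h p ?_)
  rw [Set.mem_prod, Set.mem_Ico, Set.mem_Ico] at hn
  omega

namespace VOSA

open PowerSeries Finset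

variable {V : Type*} [AddCommGroup V] [Module ℂ V] (A : VOSA V)

/-- The `(s, t)` term of the coefficient sum `conjSum`. -/
noncomputable def conjTerm (a : ℤ) (u v : V) (k D : ℤ) (p : ℤ × ℤ) : V :=
  theta (D - p.1 - p.2) k ((a : ℂ) / 2 - 2 * p.1) •
    A.mode (A.einv p.1 u) (D - p.1 - p.2) (A.einv p.2 v)

/-- With `x = y + y²/2`, `E⁻¹ = exp(-∑ a_j L(j))` and `E⁻¹ = ∑ e_s`, the component of weight
`wt u + wt v - D - 1` of the residue of `y^k Y((1 + y)^{2L(0)} E⁻¹ (1 + y)^{-L(0)} u, x) E⁻¹ v`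
with respect to `y`, for `u` of weight `a / 2`. -/
noncomputable def conjSum (a : ℤ) (u v : V) (k D : ℤ) : V := ∑ᶠ p, A.conjTerm a u v k D p

variable {A}

theorem conjTerm_eq_zero {a b : ℤ} {u v : V} (hu : u ∈ A.weight a) (hv : v ∈ A.weight b)
    (k D : ℤ) {p : ℤ × ℤ}
    (h : p.1 < 0 ∨ p.2 < 0 ∨ a - 2 * p.1 < A.minWeight ∨ b - 2 * p.2 < A.minWeight) :
    A.conjTerm a u v k D p = 0 := by
  rw [conjTerm]
  rcases h with h | h | h | h
  · rw [A.einv_of_neg h, LinearMap.zero_apply, mode_zero, LinearMap.zero_apply, smul_zero]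
  · rw [A.einv_of_neg h, LinearMap.zero_apply, map_zero, smul_zero]
  · rw [A.einv_eq_zero hu h, mode_zero, LinearMap.zero_apply, smul_zero]
  · rw [A.einv_eq_zero hv h, map_zero, smul_zero]

theorem conjTerm_hasFiniteSupport {a b : ℤ} {u v : V} (hu : u ∈ A.weight a)
    (hv : v ∈ A.weight b) (k D : ℤ) : Function.HasFiniteSupport (A.conjTerm a u v k D) :=
  hasFiniteSupport_of_box (|a| + |b| + |A.minWeight| + 1) fun p hp =>
    conjTerm_eq_zero hu hv k D (by
      have := le_abs_self a; have := le_abs_self b; have := neg_abs_le A.minWeight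
      have := abs_nonneg a; have := abs_nonneg b; have := abs_nonneg A.minWeight
      omega)

theorem conjSum_eq_zero {a b : ℤ} {u v : V} (hu : u ∈ A.weight a) (hv : v ∈ A.weight b)
    {k D : ℤ} (h : D < k) : A.conjSum a u v k D = 0 := by
  refine finsum_eq_zero_of_forall_eq_zero fun p => ?_
  by_cases hp : p.1 < 0 ∨ p.2 < 0
  · exact conjTerm_eq_zero hu hv k D (by tauto)
  · rw [conjTerm, theta_of_lt (by omega), zero_smul]

theorem conjSum_self {a b : ℤ} {u v : V} (hu : u ∈ A.weight a) (hv : v ∈ A.weight b)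
    (k : ℤ) : A.conjSum a u v k k = A.mode u k v := by
  rw [conjSum, finsum_eq_single _ (0, 0)]
  · simp [conjTerm, theta_self, einv_zero]
  · intro p hp
    by_cases hp' : p.1 < 0 ∨ p.2 < 0
    · exact conjTerm_eq_zero hu hv k k (by tauto)
    · have : p.1 ≠ 0 ∨ p.2 ≠ 0 := by
        by_contra h
        exact hp (Prod.ext (by simpa using (not_or.1 h).1) (by simpa using (not_or.1 h).2))
      rw [conjTerm, theta_of_lt (by omega), zero_smul]

theorem finsum_eq_sum_box {M : Type*} [AddCommMonoid M] {f : ℤ × ℤ → M} (B : ℤ)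
    (h : ∀ p : ℤ × ℤ, p.1 < 0 ∨ p.2 < 0 ∨ B ≤ p.1 ∨ B ≤ p.2 → f p = 0) :
    ∑ᶠ p, f p = ∑ p ∈ Ico (0 : ℤ) B ×ˢ Ico (0 : ℤ) B, f p := by
  refine finsum_eq_sum_of_support_subset _ fun p hp => ?_
  rw [Function.mem_support] at hp
  by_contra hn
  refine hp (h p ?_)
  rw [mem_coe, mem_product, mem_Ico, mem_Ico] at hn
  omega

/-- Shifting the summation indices of `conjSum` by a pair `q` of small integers. -/
theorem conjSum_eq_sum_box {a b : ℤ} {u v : V} (hu : u ∈ A.weight a) (hv : v ∈ A.weight b)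
    (k D : ℤ) {B : ℤ} (q : ℤ × ℤ) (hq1 : 0 ≤ q.1) (hq2 : 0 ≤ q.2)
    (ha : a - 2 * (B - q.1) < A.minWeight) (hb : b - 2 * (B - q.2) < A.minWeight) :
    A.conjSum a u v k D =
      ∑ p ∈ Ico (0 : ℤ) B ×ˢ Ico (0 : ℤ) B, A.conjTerm a u v k D (p - q) := by
  rw [conjSum, ← finsum_comp_equiv (Equiv.subRight q)]
  refine finsum_eq_sum_box B fun p hp => conjTerm_eq_zero hu hv k D ?_
  simp only [Equiv.subRight_apply, Prod.fst_sub, Prod.snd_sub]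
  omega

variable (A) in
/-- Both sides of the coordinate change formula satisfy this recursion, which determines them from
the terms with a smaller value of `D - k`. It is the component form of the relation between
`2L(0) + 4L(1)` and `2L(0) + 3L(1) + L(2)`. -/
def SatisfiesRecursion (F : ℤ → V → V → ℤ → ℤ → V) : Prop :=
  ∀ (a b : ℤ) (u v : V), u ∈ A.weight a → v ∈ A.weight b → ∀ k D : ℤ,
    (4 : ℂ) • A.L 1 (F a u v k (D - 1)) = (2 * ((D : ℂ) - k)) • F a u v k D
      + (3 : ℂ) • F a u (A.L 1 v) k (D - 1) + (3 * ((a : ℂ) - k - 2)) • F a u v (k + 1) D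
      + (3 : ℂ) • F (a - 2) (A.L 1 u) v k (D - 1)
      + F a u (A.L 2 v) k (D - 2) + (3 * (a : ℂ) / 2 - k - 3) • F a u v (k + 2) D
      + (3 : ℂ) • F (a - 2) (A.L 1 u) v (k + 1) (D - 1) + F (a - 4) (A.L 2 u) v k (D - 2)

variable (A) in
theorem satisfiesRecursion_einv_mode :
    A.SatisfiesRecursion fun _ u v k D => A.einv (D - k) (A.mode u k v) := by
  intro a b u v hu hv k D
  have h := A.einv_relation_apply (A.mode_mem hu hv k) (D - k)
  dsimp only
  rw [show D - 1 - k = D - k - 1 by ring, h, A.L_one_mode hu, A.L_two_mode hu]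
  simp only [map_add, map_smul, show D - 2 - k = D - k - 2 by ring,
    show D - (k + 1) = D - k - 1 by ring, show D - (k + 2) = D - k - 2 by ring,
    show D - 1 - (k + 1) = D - k - 2 by ring]
  push_cast
  module

variable (A) in
theorem satisfiesRecursion_conjSum : A.SatisfiesRecursion A.conjSum := by
  intro a b u v hu hv k D
  have hu1 : A.L 1 u ∈ A.weight (a - 2) := A.L_mem hu 1
  have hv1 : A.L 1 v ∈ A.weight (b - 2) := A.L_mem hv 1
  have hu2 : A.L 2 u ∈ A.weight (a - 4) := A.L_mem hu 2
  have hv2 : A.L 2 v ∈ A.weight (b - 4) := A.L_mem hv 2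
  -- the three parts of the commutator of `L(1)` with a mode, after shifting the summation indices
  let G1 : ℤ × ℤ → V := fun p => theta (D - p.1 - p.2) k ((a : ℂ) / 2 - 2 * p.1) •
    A.mode (A.einv p.1 u) (D - p.1 - p.2) ((4 : ℂ) • A.L 1 (A.einv (p.2 - 1) v))
  let G2 : ℤ × ℤ → V := fun p => (4 * ((a : ℂ) - p.1 - D + p.2 - 1)
      * theta (D - p.1 - p.2 - 1) k ((a : ℂ) / 2 - 2 * p.1)) •
    A.mode (A.einv p.1 u) (D - p.1 - p.2) (A.einv p.2 v)
  let G3 : ℤ × ℤ → V := fun p => theta (D - p.1 - p.2) k ((a : ℂ) / 2 - 2 * p.1 + 2) •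
    A.mode ((4 : ℂ) • A.L 1 (A.einv (p.1 - 1) u)) (D - p.1 - p.2) (A.einv p.2 v)
  set B : ℤ := |a| + |b| + |A.minWeight| + 10 with hB
  have hbound : ∀ {m : ℤ} {x : V}, x ∈ A.weight m → m ≤ |a| + |b| → ∀ s, B - 2 ≤ s →
      A.einv s x = 0 := by
    intro m x hx hm s hs
    refine A.einv_eq_zero hx ?_
    have := neg_abs_le A.minWeight
    have := abs_nonneg a; have := abs_nonneg b; have := abs_nonneg A.minWeight
    omega
  have ha := le_abs_self a
  have hb := le_abs_self b
  have ha0 := abs_nonneg a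
  have hb0 := abs_nonneg b
  have hmw := neg_abs_le A.minWeight
  have hmw0 := abs_nonneg A.minWeight
  have hG1 : ∀ p : ℤ × ℤ, p.1 < 0 ∨ p.2 < 0 ∨ B ≤ p.1 ∨ B ≤ p.2 → G1 p = 0 := by
    intro p hp
    simp only [G1]
    rcases hp with h | h | h | h
    · rw [A.einv_of_neg h]; simp [mode_zero]
    · rw [A.einv_of_neg (by omega : p.2 - 1 < 0)]; simp
    · rw [hbound hu (by omega) _ (by omega)]; simp [mode_zero]
    · rw [hbound hv (by omega) _ (by omega)]; simp
  have hG2 : ∀ p : ℤ × ℤ, p.1 < 0 ∨ p.2 < 0 ∨ B ≤ p.1 ∨ B ≤ p.2 → G2 p = 0 := by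
    intro p hp
    simp only [G2]
    rcases hp with h | h | h | h
    · rw [A.einv_of_neg h]; simp [mode_zero]
    · rw [A.einv_of_neg h]; simp
    · rw [hbound hu (by omega) _ (by omega)]; simp [mode_zero]
    · rw [hbound hv (by omega) _ (by omega)]; simp
  have hG3 : ∀ p : ℤ × ℤ, p.1 < 0 ∨ p.2 < 0 ∨ B ≤ p.1 ∨ B ≤ p.2 → G3 p = 0 := by
    intro p hp
    simp only [G3]
    rcases hp with h | h | h | h
    · rw [A.einv_of_neg (by omega : p.1 - 1 < 0)]; simp [mode_zero]
    · rw [A.einv_of_neg h]; simp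
    · rw [hbound hu (by omega) _ (by omega)]; simp [mode_zero]
    · rw [hbound hv (by omega) _ (by omega)]; simp
  have hL : (4 : ℂ) • A.L 1 (A.conjSum a u v k (D - 1)) =
      ∑ᶠ p, G1 p + ∑ᶠ p, G2 p + ∑ᶠ p, G3 p := by
    rw [← finsum_comp_equiv (Equiv.subRight ((0, -1) : ℤ × ℤ)) (f := G1),
      ← finsum_comp_equiv (Equiv.subRight ((-1, 0) : ℤ × ℤ)) (f := G3),
      ← finsum_add_distrib, ← finsum_add_distrib]
    · have hm := ((4 : ℂ) • A.L 1).toAddMonoidHom.map_finsum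
        (conjTerm_hasFiniteSupport hu hv k (D - 1))
      refine hm.trans (finsum_congr fun p => ?_)
      change (4 : ℂ) • A.L 1 (A.conjTerm a u v k (D - 1) p) = _
      obtain ⟨s, t⟩ := p
      simp only [conjTerm, G1, G2, G3, Equiv.subRight_apply, Prod.mk_sub_mk, sub_zero,
        sub_neg_eq_add, add_sub_cancel_right, map_smul, A.L_one_mode (A.einv_mem hu s), mode_smul,
        LinearMap.smul_apply]
      rw [show D - 1 - s - t + 1 = D - s - t by ring, show D - s - t - 1 = D - 1 - s - t by ring,
        show D - s - (t + 1) = D - 1 - s - t by ring, show D - (s + 1) - t = D - 1 - s - t by ring]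
      push_cast
      rw [show (a : ℂ) / 2 - 2 * (s + 1) + 2 = (a : ℂ) / 2 - 2 * s by ring]
      module
    · exact ((hasFiniteSupport_of_box B hG1).comp_of_injective (Equiv.injective _)).add
        (hasFiniteSupport_of_box B hG2)
    · exact (hasFiniteSupport_of_box B hG3).comp_of_injective (Equiv.injective _)
    · exact (hasFiniteSupport_of_box B hG1).comp_of_injective (Equiv.injective _)
    · exact hasFiniteSupport_of_box B hG2
  rw [hL, finsum_eq_sum_box B hG1, finsum_eq_sum_box B hG2, finsum_eq_sum_box B hG3,
    conjSum_eq_sum_box hu hv k D (B := B) (0, 0) le_rfl le_rfl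
      (by dsimp only; omega) (by dsimp only; omega),
    conjSum_eq_sum_box hu hv (k + 1) D (B := B) (0, 0) le_rfl le_rfl
      (by dsimp only; omega) (by dsimp only; omega),
    conjSum_eq_sum_box hu hv (k + 2) D (B := B) (0, 0) le_rfl le_rfl
      (by dsimp only; omega) (by dsimp only; omega),
    conjSum_eq_sum_box hu hv1 k (D - 1) (B := B) (0, 1) (by simp) (by simp)
      (by dsimp only; omega) (by dsimp only; omega),
    conjSum_eq_sum_box hu hv2 k (D - 2) (B := B) (0, 2) (by simp) (by simp)
      (by dsimp only; omega) (by dsimp only; omega),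
    conjSum_eq_sum_box hu1 hv k (D - 1) (B := B) (1, 0) (by simp) (by simp)
      (by dsimp only; omega) (by dsimp only; omega),
    conjSum_eq_sum_box hu1 hv (k + 1) (D - 1) (B := B) (1, 0) (by simp) (by simp)
      (by dsimp only; omega) (by dsimp only; omega),
    conjSum_eq_sum_box hu2 hv k (D - 2) (B := B) (2, 0) (by simp) (by simp)
      (by dsimp only; omega) (by dsimp only; omega)]
  simp only [smul_sum, ← sum_add_distrib]
  refine sum_congr rfl fun p _ => ?_
  obtain ⟨s, t⟩ := p
  simp only [conjTerm, G1, G2, G3, Prod.mk_sub_mk, sub_zero]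
  rw [A.einv_relation_apply hu s, A.einv_relation_apply hv t,
    show D - 1 - s - (t - 1) = D - s - t by ring, show D - 2 - s - (t - 2) = D - s - t by ring,
    show D - 1 - (s - 1) - t = D - s - t by ring, show D - 2 - (s - 2) - t = D - s - t by ring]
  push_cast
  set γ : ℂ := (a : ℂ) / 2 - 2 * s with hγ
  rw [show ((a : ℂ) - 2) / 2 - 2 * (s - 1) = γ + 1 by rw [hγ]; ring,
    show ((a : ℂ) - 4) / 2 - 2 * (s - 2) = γ + 1 + 1 by rw [hγ]; ring,
    show γ + 2 = γ + 1 + 1 by ring, theta_sub_one, theta_add_one _ k (γ + 1),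
    theta_add_one _ k γ, theta_add_one _ (k + 1) γ, show k + 1 + 1 = k + 2 by ring]
  have hθ := theta_total_derivative (D - s - t) k γ
  have ha' : (a : ℂ) = 2 * γ + 4 * s := by rw [hγ]; ring
  rw [ha']
  push_cast at hθ
  generalize theta (D - s - t) k γ = t0 at hθ ⊢
  generalize theta (D - s - t) (k + 1) γ = t1 at hθ ⊢
  generalize theta (D - s - t) (k + 2) γ = t2 at hθ ⊢
  simp only [mode_add, mode_smul, map_add, map_smul, LinearMap.add_apply, LinearMap.smul_apply]
  generalize A.mode (A.einv s u) (D - s - t) (A.einv t v) = x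
  have hθ' := congrArg (fun r : ℂ => r • x) hθ
  linear_combination (norm := module) -hθ'

/-- The recursion determines a family of vectors from its values for `D ≤ k`. -/
theorem SatisfiesRecursion.eq {F F' : ℤ → V → V → ℤ → ℤ → V}
    (hF : A.SatisfiesRecursion F) (hF' : A.SatisfiesRecursion F')
    (h0 : ∀ (a b : ℤ) (u v : V), u ∈ A.weight a → v ∈ A.weight b → ∀ k D : ℤ, D ≤ k →
      F a u v k D = F' a u v k D)
    {a b : ℤ} {u v : V} (hu : u ∈ A.weight a) (hv : v ∈ A.weight b) (k D : ℤ) :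
    F a u v k D = F' a u v k D := by
  obtain ⟨n, hn⟩ : ∃ n : ℕ, D - k ≤ n := ⟨(D - k).toNat, Int.self_le_toNat _⟩
  induction n using Nat.strong_induction_on generalizing a b u v k D with
  | _ n ih =>
    rcases le_or_gt D k with hD | hD
    · exact h0 a b u v hu hv k D hD
    have ih' : ∀ {a b : ℤ} {u v : V}, u ∈ A.weight a → v ∈ A.weight b → ∀ k' D' : ℤ,
        D' - k' < D - k → F a u v k' D' = F' a u v k' D' := by
      intro a b u v hu hv k' D' h
      exact ih (n - 1) (by omega) hu hv k' D' (by omega)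
    have hu1 : A.L 1 u ∈ A.weight (a - 2) := A.L_mem hu 1
    have hv1 : A.L 1 v ∈ A.weight (b - 2) := A.L_mem hv 1
    have hu2 : A.L 2 u ∈ A.weight (a - 4) := A.L_mem hu 2
    have hv2 : A.L 2 v ∈ A.weight (b - 4) := A.L_mem hv 2
    have h1 := hF a b u v hu hv k D
    have h2 := hF' a b u v hu hv k D
    rw [ih' hu hv k (D - 1) (by omega), ih' hu hv1 k (D - 1) (by omega),
      ih' hu hv (k + 1) D (by omega), ih' hu1 hv k (D - 1) (by omega),
      ih' hu hv2 k (D - 2) (by omega), ih' hu hv (k + 2) D (by omega),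
      ih' hu1 hv (k + 1) (D - 1) (by omega), ih' hu2 hv k (D - 2) (by omega), h2] at h1
    have h3 : (2 * ((D : ℂ) - k)) • F' a u v k D = (2 * ((D : ℂ) - k)) • F a u v k D := by
      simpa using h1
    have hne : (2 * ((D : ℂ) - k)) ≠ 0 := by
      have : (D : ℂ) - k ≠ 0 := sub_ne_zero.2 (by exact_mod_cast hD.ne')
      simpa using this
    exact (smul_right_injective V hne h3).symm

/-- The coordinate change formula: with `x = y + y²/2`,
`E⁻¹ Y(u, y) v = Y((1 + y)^{2L(0)} E⁻¹ (1 + y)^{-L(0)} u, x) E⁻¹ v`, in components. -/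
theorem conjSum_eq {a b : ℤ} {u v : V} (hu : u ∈ A.weight a) (hv : v ∈ A.weight b) (k D : ℤ) :
    A.conjSum a u v k D = A.einv (D - k) (A.mode u k v) := by
  refine A.satisfiesRecursion_conjSum.eq A.satisfiesRecursion_einv_mode ?_ hu hv k D
  intro a b u v hu hv k D hD
  rcases hD.lt_or_eq with h | rfl
  · rw [conjSum_eq_zero hu hv h, A.einv_of_neg (by omega), LinearMap.zero_apply]
  · rw [conjSum_self hu hv, sub_self, einv_zero, Module.End.one_apply]

end VOSA

/-! ### Pairing power series with sequences of vectors -/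

/-- Reindexing a sum along an injection whose range contains the support. -/
theorem finsum_comp_of_injective {α β M : Type*} [AddCommMonoid M] {g : β → α}
    (hg : Function.Injective g) (f : α → M) (h : ∀ i, f i ≠ 0 → i ∈ Set.range g) :
    ∑ᶠ j, f (g j) = ∑ᶠ i, f i := by
  rw [← finsum_mem_range hg, ← finsum_mem_univ f]
  refine finsum_mem_inter_support_eq' f _ _ fun i hi => ?_
  exact ⟨fun _ => Set.mem_univ i, fun _ => h i hi⟩

namespace PowerSeries

variable {M : Type*} [AddCommGroup M] [Module ℂ M]

/-- The sum `∑ c_i F_i`, for a sequence `F` that vanishes eventually. -/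
noncomputable def pair (c : ℂ⟦X⟧) (F : ℕ → M) : M := ∑ᶠ i : ℕ, coeff i c • F i

/-- A sequence that vanishes eventually. -/
def EventuallyZero (F : ℕ → M) : Prop := ∃ N, ∀ i ≥ N, F i = 0

theorem EventuallyZero.hasFiniteSupport {F : ℕ → M} (hF : EventuallyZero F) (c : ℂ⟦X⟧) :
    Function.HasFiniteSupport fun i => coeff i c • F i := by
  obtain ⟨N, hN⟩ := hF
  refine (Set.finite_lt_nat N).subset fun i hi => ?_
  rw [Function.mem_support] at hi
  by_contra h
  exact hi (by rw [hN i (not_lt.1 h), smul_zero])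

theorem pair_add {F : ℕ → M} (hF : EventuallyZero F) (c c' : ℂ⟦X⟧) :
    pair (c + c') F = pair c F + pair c' F := by
  simp only [pair, map_add, add_smul]
  exact finsum_add_distrib (hF.hasFiniteSupport c) (hF.hasFiniteSupport c')

theorem pair_C_mul {F : ℕ → M} (r : ℂ) (c : ℂ⟦X⟧) :
    pair (C r * c) F = r • pair c F := by
  simp only [pair, coeff_C_mul, mul_smul]
  exact (smul_finsum r _).symm

theorem pair_X_mul (F : ℕ → M) (c : ℂ⟦X⟧) :
    pair (X * c) F = pair c fun i => F (i + 1) := by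
  have h : ∀ i, coeff i (X * c) • F i ≠ 0 → i ∈ Set.range Nat.succ := by
    intro i hi
    cases i with
    | zero => simp at hi
    | succ i => exact ⟨i, rfl⟩
  rw [pair, ← finsum_comp_of_injective Nat.succ_injective _ h, pair]
  simp only [Nat.succ_eq_add_one, coeff_succ_X_mul]

theorem pair_one_add_mul {F : ℕ → M} (hF : EventuallyZero F) (r : ℂ) (c : ℂ⟦X⟧) :
    pair ((1 + C r * X) * c) F = pair c F + r • pair c fun i => F (i + 1) := by
  rw [add_mul, one_mul, mul_assoc, pair_add hF, pair_C_mul, pair_X_mul]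

/-- The series `(1 - X)^γ`. -/
noncomputable def negPow (γ : ℂ) : ℂ⟦X⟧ := rescale (-1) (binomialSeries ℂ γ)

theorem coeff_negPow (γ : ℂ) (i : ℕ) : coeff i (negPow γ) = (-1) ^ i * Ring.choose γ i := by
  rw [negPow, coeff_rescale, binomialSeries_coeff, smul_eq_mul, mul_one]

theorem negPow_zero : negPow 0 = 1 := by rw [negPow, binomialSeries_zero, map_one]

theorem negPow_succ (γ : ℂ) : negPow (γ + 1) = (1 + C (-1) * X) * negPow γ := by
  have h : binomialSeries ℂ (1 : ℂ) = 1 + X := onePow_one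
  rw [negPow, binomialSeries_add, h, map_mul, map_add, map_one, rescale_X, mul_comm]
  rfl

/-- The series `(1 - X²)^γ`. -/
noncomputable def sqPow (γ : ℂ) : ℂ⟦X⟧ :=
  mk fun i => if Even i then (-1) ^ (i / 2) * Ring.choose γ (i / 2) else 0

theorem sqPow_succ (γ : ℂ) : sqPow (γ + 1) = (1 - X ^ 2) * sqPow γ := by
  ext n
  rw [sub_mul, one_mul, map_sub]
  match n with
  | 0 => simp [sqPow, coeff_X_pow_mul']
  | 1 => simp [sqPow, coeff_X_pow_mul']
  | n + 2 =>
    rw [coeff_X_pow_mul, sqPow, sqPow, coeff_mk, coeff_mk, coeff_mk]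
    have h : (n + 2) / 2 = n / 2 + 1 := by omega
    by_cases hn : Even n
    · rw [if_pos hn, if_pos (hn.add even_two), if_pos (hn.add even_two), h, Ring.choose_succ_succ]
      ring
    · have hn' : ¬Even (n + 2) := fun h' => hn ((Nat.even_add.1 h').2 even_two)
      rw [if_neg hn, if_neg hn', if_neg hn', sub_zero]

theorem sqPow_zero : sqPow 0 = 1 := by
  ext n
  rw [sqPow, coeff_mk, coeff_one, Ring.choose_zero_ite]
  by_cases hn : n = 0
  · simp [hn]
  · by_cases h : Even n
    · have : n / 2 ≠ 0 := by obtain ⟨k, rfl⟩ := h; omega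
      simp [hn, this]
    · simp [hn, h]

theorem sqPow_neg_mul (r : ℕ) : (1 + X) ^ r * sqPow (-(r : ℂ)) = negPow (-(r : ℂ)) := by
  have h1 : ∀ r : ℕ, (1 - X ^ 2) ^ r * sqPow (-(r : ℂ)) = 1 := by
    intro r
    induction r with
    | zero => rw [pow_zero, Nat.cast_zero, neg_zero, sqPow_zero, one_mul]
    | succ r ih =>
      rw [pow_succ, mul_assoc, ← sqPow_succ]
      rwa [show -((r + 1 : ℕ) : ℂ) + 1 = -(r : ℂ) by push_cast; ring]
  have h2 : ∀ r : ℕ, (1 - X) ^ r * negPow (-(r : ℂ)) = 1 := by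
    intro r
    induction r with
    | zero => rw [pow_zero, Nat.cast_zero, neg_zero, negPow_zero, one_mul]
    | succ r ih =>
      have := negPow_succ (-((r + 1 : ℕ) : ℂ))
      rw [map_neg, map_one, neg_one_mul, ← sub_eq_add_neg] at this
      rw [pow_succ, mul_assoc, ← this]
      rwa [show -((r + 1 : ℕ) : ℂ) + 1 = -(r : ℂ) by push_cast; ring]
  calc (1 + X) ^ r * sqPow (-(r : ℂ))
      = ((1 - X) ^ r * negPow (-(r : ℂ))) * ((1 + X) ^ r * sqPow (-(r : ℂ))) := by
        rw [h2, one_mul]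
    _ = negPow (-(r : ℂ)) * ((1 - X ^ 2) ^ r * sqPow (-(r : ℂ))) := by
        rw [show (1 - X ^ 2 : ℂ⟦X⟧) = (1 - X) * (1 + X) by ring, mul_pow]; ring
    _ = _ := by rw [h1, mul_one]

theorem pair_sqPow (γ : ℂ) (F : ℕ → M) :
    pair (sqPow γ) F = ∑ᶠ i : ℕ, ((-1) ^ i * Ring.choose γ i) • F (2 * i) := by
  have hinj : Function.Injective fun i : ℕ => 2 * i := fun i j h => by
    simp only at h; omega
  rw [pair, ← finsum_comp_of_injective hinj]
  · simp [sqPow]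
  · intro i hi
    rw [sqPow, coeff_mk] at hi
    by_cases h : Even i
    · obtain ⟨k, rfl⟩ := h
      exact ⟨k, by simp only; ring⟩
    · simp [h] at hi

/-- For a family `x_j(p)` of vectors, `∑_j 2^{-j} c_j x_j(N - 2j)` where `c_j` is the residue of
`x^{-j-1} y^k f(y) (1 + y)^{m+1} dy`, `x = y + y²/2`. -/
noncomputable def resSum (x : ℤ → ℤ → M) (k : ℤ) (f : ℂ⟦X⟧) (m : ℂ) (N : ℤ) : M :=
  ∑ᶠ j : ℤ, ((2 : ℂ) ^ (-j) * zcoeff (j - k) (halfPow (-(j : ℂ) - 1) * onePow (m + 1) * f)) •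
    x j (N - 2 * j)

/-- The modes `x_j` vanish for large `j`. -/
def TruncatedAbove (x : ℤ → ℤ → M) : Prop := ∃ J, ∀ j ≥ J, x j = 0

theorem resSum_hasFiniteSupport {x : ℤ → ℤ → M} (hx : TruncatedAbove x) (k : ℤ) (f : ℂ⟦X⟧)
    (m : ℂ) (N : ℤ) : Function.HasFiniteSupport fun j : ℤ =>
      ((2 : ℂ) ^ (-j) * zcoeff (j - k) (halfPow (-(j : ℂ) - 1) * onePow (m + 1) * f)) •
        x j (N - 2 * j) := by
  obtain ⟨J, hJ⟩ := hx
  refine (Set.finite_Ico k J).subset fun j hj => ?_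
  rw [Function.mem_support] at hj
  rw [Set.mem_Ico]
  by_contra h
  refine hj ?_
  by_cases hk : j < k
  · rw [zcoeff_of_neg (by omega), mul_zero, zero_smul]
  · rw [hJ j (by omega), Pi.zero_apply, smul_zero]

/-- Multiplication of the test function by `y_1 + ζ y_2`. -/
theorem resSum_step {x : ℤ → ℤ → M} (hx : TruncatedAbove x) (k : ℤ) (f : ℂ⟦X⟧) (m r s : ℂ)
    (N : ℤ) : s • resSum x k f (m + 1) N + r • resSum x k f m N =
      resSum x k ((C s * (1 + X) + C r) * f) m N := by
  simp only [resSum]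
  rw [smul_finsum, smul_finsum, ← finsum_add_distrib]
  · refine finsum_congr fun j => ?_
    rw [onePow_succ (m + 1), show halfPow (-(j : ℂ) - 1) * onePow (m + 1) *
      ((C s * (1 + X) + C r) * f) =
      C s * (halfPow (-(j : ℂ) - 1) * ((1 + X) * onePow (m + 1)) * f) +
      C r * (halfPow (-(j : ℂ) - 1) * onePow (m + 1) * f) by ring, map_add, zcoeff_C_mul,
      zcoeff_C_mul]
    module
  · exact (resSum_hasFiniteSupport hx k f (m + 1) N).subset
      (Function.support_const_smul_subset s _)
  · exact (resSum_hasFiniteSupport hx k f m N).subset (Function.support_const_smul_subset r _)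

end PowerSeries

/-! ### The Jacobi identity for the modes of `v ⊗ 𝟏` -/

namespace VOSA

variable {V : Type*} [AddCommGroup V] [Module ℂ V] (A : VOSA V)

theorem tmul_vac_mem {a : ℤ} {u : V} (hu : u ∈ A.weight a) :
    u ⊗ₜ[ℂ] A.vac ∈ A.tensorSquare.weight a :=
  Submodule.mem_iSup_of_mem a
    (Submodule.apply_mem_map₂ _ hu (by rw [sub_self]; exact A.vac_mem))

theorem signedSwap_tmul_vac {a : ℤ} {u : V} (hu : u ∈ A.weight a) :
    A.signedSwap (u ⊗ₜ A.vac) = A.vac ⊗ₜ u := by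
  rw [A.signedSwap_tmul hu A.vac_mem, mul_zero, zpow_zero, one_smul]

theorem coeff_Y_vac (s : ℤ) (v : V) :
    HVertexOperator.coeff (A.Y A.vac) s v = if s = 0 then v else 0 := by
  have := A.vac_mode (-s - 1) v
  rw [SuperVertexData.mode, VertexOperator.ncoeff_apply,
    show -(-s - 1) - 1 = s by ring] at this
  rw [this]
  congr 1
  exact propext ⟨fun h => by omega, fun h => by omega⟩

/-- The modes of `u ⊗ 𝟏` act on the first tensor factor. -/
theorem tensorSquare_mode_tmul_vac (u : V) {n : ℤ} {v : V} (hv : v ∈ A.weight n) (w : V) (p : ℤ) :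
    A.tensorSquare.mode (u ⊗ₜ A.vac) p (v ⊗ₜ w) = A.mode u p v ⊗ₜ w := by
  have h := A.tensorY_coeff u A.vac v w A.vac_mem hv (-p - 1)
  rw [zero_mul, zpow_zero, one_smul, finsum_eq_single _ (-p - 1)] at h
  · rw [sub_self, A.coeff_Y_vac, if_pos rfl] at h
    exact h
  · intro i hi
    rw [A.coeff_Y_vac, if_neg (by omega), TensorProduct.tmul_zero]

/-- The modes of `𝟏 ⊗ u` act on the second tensor factor, up to a sign. -/
theorem tensorSquare_mode_vac_tmul {m n : ℤ} {u v : V} (hu : u ∈ A.weight m)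
    (hv : v ∈ A.weight n) (w : V) (p : ℤ) :
    A.tensorSquare.mode (A.vac ⊗ₜ u) p (v ⊗ₜ w) = ((-1 : ℂ) ^ (m * n)) • v ⊗ₜ A.mode u p w := by
  have h := A.tensorY_coeff A.vac u v w hu hv (-p - 1)
  rw [finsum_eq_single _ 0] at h
  · rw [sub_zero, A.coeff_Y_vac, if_pos rfl] at h
    exact h
  · intro i hi
    rw [A.coeff_Y_vac, if_neg hi, TensorProduct.zero_tmul]

end VOSA

namespace WeakTwistedModule

open PowerSeries

variable {V : Type*} [AddCommGroup V] [Module ℂ V] {A : VOSA V}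
  {M : Type*} [AddCommGroup M] [Module ℂ M]
  (W : WeakTwistedModule A.tensorSquare 2 (-1) A.signedSwap M)

/-- The mode `(v ⊗ 𝟏)_{p/2}` of a twisted `V ⊗ V`-module. -/
def T (v : V) (p : ℤ) : Module.End ℂ M := W.Y (v ⊗ₜ A.vac) p

theorem T_add (u v : V) (p : ℤ) : W.T (u + v) p = W.T u p + W.T v p := by
  simp only [T, TensorProduct.add_tmul, map_add, Pi.add_apply]

theorem T_smul (r : ℂ) (v : V) (p : ℤ) : W.T (r • v) p = r • W.T v p := by
  rw [T, T, ← TensorProduct.smul_tmul', map_smul, Pi.smul_apply]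

theorem T_zero (p : ℤ) : W.T 0 p = 0 := by
  simp only [T, TensorProduct.zero_tmul, map_zero, Pi.zero_apply]

theorem T_vac (p : ℤ) (w : M) : W.T A.vac p w = if p = -2 then w else 0 := W.vac_mode p w

theorem eventuallyZero_T (u v : V) (w : M) (m n : ℤ) :
    EventuallyZero fun i : ℕ => W.T u (m - i) (W.T v (n + i) w) := by
  obtain ⟨N, hN⟩ := W.truncation (v ⊗ₜ A.vac) w
  refine ⟨(N - n).toNat, fun i hi => ?_⟩
  dsimp only
  rw [show W.T v (n + i) w = 0 from hN _ (by omega), map_zero]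

/-- The twisted Jacobi identity for `u ⊗ 𝟏` and `v ⊗ 𝟏`. -/
theorem T_jacobi {a b : ℤ} {u v : V} (hu : u ∈ A.weight a) (hv : v ∈ A.weight b) (w : M)
    (l m n : ℤ) :
    pair (sqPow l) (fun i : ℕ => W.T u (m + 2 * l - i) (W.T v (n + i) w))
      - ((-1 : ℂ) ^ (a * b) * (-1 : ℂ) ^ l) •
        pair (sqPow l) (fun i : ℕ => W.T v (n + 2 * l - i) (W.T u (m + i) w))
      = ∑ᶠ i : ℕ, Ring.choose ((m : ℂ) / 2) i • ((1 / 2 : ℂ) •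
        (W.T (A.mode u (l + i) v) (m + n - 2 * i) w + (-1 : ℂ) ^ m •
          W.Y (A.tensorSquare.mode (A.vac ⊗ₜ u) (l + i) (v ⊗ₜ A.vac)) (m + n - 2 * i) w)) := by
  have h := W.jacobi a b (u ⊗ₜ A.vac) (v ⊗ₜ A.vac) (A.tmul_vac_mem hu) (A.tmul_vac_mem hv) w l m n
  have hs : ∀ (u v : V) (m n : ℤ), pair (sqPow l)
      (fun i : ℕ => W.T u (m + 2 * l - i) (W.T v (n + i) w)) =
      ∑ᶠ i : ℕ, ((-1 : ℂ) ^ i * (Ring.choose l i : ℂ)) •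
        W.Y (u ⊗ₜ A.vac) (m + (2 : ℕ) * (l - i)) (W.Y (v ⊗ₜ A.vac) (n + (2 : ℕ) * i) w) := by
    intro u v m n
    rw [pair_sqPow]
    refine finsum_congr fun i => ?_
    rw [T, T, show m + 2 * l - ((2 * i : ℕ) : ℤ) = m + (2 : ℕ) * (l - i) by push_cast; ring,
      show n + ((2 * i : ℕ) : ℤ) = n + (2 : ℕ) * i by push_cast; ring]
  rw [hs, hs, h]
  refine finsum_congr fun i => ?_
  rw [Finset.sum_range_succ, Finset.sum_range_one]
  have h1 : (-1 : ℂ) ^ (-(((1 : ℕ) : ℤ) * m)) = (-1 : ℂ) ^ m := by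
    rw [Nat.cast_one, one_mul, zpow_neg, ← inv_zpow]
    norm_num
  rw [h1, pow_one, A.signedSwap_tmul_vac hu]
  simp only [Nat.cast_zero, zero_mul, neg_zero, zpow_zero, one_smul, pow_zero, Module.End.one_apply,
    A.tensorSquare_mode_tmul_vac u hv, T]
  push_cast
  rw [one_div]

/-- The family of the vectors `((u_j v) ⊗ 𝟏)_{p/2} w`. -/
def firstRes (u v : V) (w : M) (j p : ℤ) : M := W.T (A.mode u j v) p w

/-- The family of the vectors `((𝟏 ⊗ u)_j (v ⊗ 𝟏))_{p/2} w`. -/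
noncomputable def secondRes (u v : V) (w : M) (j p : ℤ) : M :=
  W.Y (A.tensorSquare.mode (A.vac ⊗ₜ u) j (v ⊗ₜ A.vac)) p w

theorem truncatedAbove_firstRes (u v : V) (w : M) : TruncatedAbove (W.firstRes u v w) := by
  obtain ⟨J, hJ⟩ := A.exists_mode_eq_zero u v
  refine ⟨J, fun j hj => funext fun p => ?_⟩
  rw [firstRes, hJ j hj, T_zero]
  rfl

/-- `Y(𝟏 ⊗ u, x)(v ⊗ 𝟏)` has no pole. -/
theorem secondRes_eq_zero {a b : ℤ} {u v : V} (hu : u ∈ A.weight a) (hv : v ∈ A.weight b) (w : M)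
    {j : ℤ} (hj : 0 ≤ j) : W.secondRes u v w j = 0 := by
  funext p
  rw [secondRes, A.tensorSquare_mode_vac_tmul hu hv, A.creation_regular u j hj,
    TensorProduct.tmul_zero, smul_zero, map_zero]
  rfl

/-- The identity obtained from the twisted Jacobi identity with the test function
`y_1^m y_2^n h(y_1, y_2)`, `x_i = y_i²`, for a homogeneous function `h` of degree `d` with expansion
`y_1^d c(y_2/y_1)` for `|y_1| > |y_2|` and `ε y_2^d c(y_1/y_2)` for `|y_2| > |y_1|`, whose
restrictions to neighbourhoods of `y_1 = y_2` and of `y_1 = -y_2` are described by `f_0` and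
`f_1`. -/
def TestJacobi (a b : ℤ) (u v : V) (w : M) (k d : ℤ) (c : ℂ⟦X⟧) (ε : ℂ) (f₀ f₁ : ℂ⟦X⟧) : Prop :=
  ∀ m n : ℤ, pair c (fun i : ℕ => W.T u (m + d - i) (W.T v (n + i) w))
      - ((-1 : ℂ) ^ (a * b) * ε) • pair c (fun i : ℕ => W.T v (n + d - i) (W.T u (m + i) w))
    = (1 / 2 : ℂ) • (resSum (W.firstRes u v w) k f₀ m (m + n + d)
      + (-1 : ℂ) ^ m • resSum (W.secondRes u v w) k f₁ m (m + n + d))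

variable {W}

/-- The case `h = (y_1² - y_2²)^l`. -/
theorem testJacobi_sqPow {a b : ℤ} {u v : V} (hu : u ∈ A.weight a) (hv : v ∈ A.weight b) (w : M)
    (l : ℤ) : W.TestJacobi a b u v w l (2 * l) (sqPow l) ((-1 : ℂ) ^ l)
      (C ((2 : ℂ) ^ l) * halfPow l) (C ((2 : ℂ) ^ l) * halfPow l) := by
  intro m n
  rw [W.T_jacobi hu hv]
  have hres : ∀ x : ℤ → ℤ → M, resSum x l (C ((2 : ℂ) ^ l) * halfPow l) m (m + n + 2 * l) =
      ∑ᶠ i : ℕ, Ring.choose ((m : ℂ) / 2) i • x (l + i) (m + n - 2 * i) := by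
    intro x
    have hinj : Function.Injective fun i : ℕ => l + (i : ℤ) := fun i j h => by
      simpa using h
    rw [resSum, ← finsum_comp_of_injective hinj]
    · refine finsum_congr fun i => ?_
      rw [show m + n + 2 * l - 2 * (l + (i : ℤ)) = m + n - 2 * i by ring,
        show halfPow (-((l + i : ℤ) : ℂ) - 1) * onePow ((m : ℂ) + 1) * (C ((2 : ℂ) ^ l) * halfPow l)
          = C ((2 : ℂ) ^ l) * (halfPow (-((l + i : ℤ) : ℂ) - 1) * halfPow l * onePow ((m : ℂ) + 1))
          by ring, ← halfPow_add, zcoeff_C_mul,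
        show -((l + i : ℤ) : ℂ) - 1 + l = -((i : ℤ) : ℂ) - 1 by push_cast; ring,
        show l + (i : ℤ) - l = i - 0 by ring, ← theta, theta_zero]
      congr 1
      rw [neg_add, zpow_add₀ two_ne_zero, zpow_neg, zpow_neg, zpow_natCast]
      have h1 : (2 : ℂ) ^ l ≠ 0 := zpow_ne_zero _ two_ne_zero
      field_simp
    · intro j hj
      refine ⟨(j - l).toNat, ?_⟩
      by_contra h
      refine hj ?_
      rw [zcoeff_of_neg (by simp only at h; omega), mul_zero, zero_smul]
  have hfin : ∀ {x : ℤ → ℤ → M}, TruncatedAbove x → Function.HasFiniteSupport fun i : ℕ =>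
      (1 / 2 : ℂ) • Ring.choose ((m : ℂ) / 2) i • x (l + i) (m + n - 2 * i) := by
    rintro x ⟨J, hJ⟩
    refine (Set.finite_lt_nat (J - l).toNat).subset fun i hi => ?_
    rw [Function.mem_support] at hi
    by_contra h
    rw [Set.mem_ofPred_eq] at h
    exact hi (by rw [hJ _ (by omega), Pi.zero_apply, smul_zero, smul_zero])
  rw [hres, hres, smul_add, smul_comm (1 / 2 : ℂ) ((-1 : ℂ) ^ m), smul_finsum (1 / 2 : ℂ),
    smul_finsum (1 / 2 : ℂ), smul_finsum, ← finsum_add_distrib]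
  · refine finsum_congr fun i => ?_
    simp only [firstRes, secondRes]
    module
  · exact hfin (W.truncatedAbove_firstRes u v w)
  · exact (hfin ⟨0, fun j hj => W.secondRes_eq_zero hu hv w hj⟩).subset
      (Function.support_const_smul_subset _ _)

/-- Multiplication of the test function by `y_1 + ζ y_2`, `ζ = ±1`. -/
theorem TestJacobi.step {a b : ℤ} {u v : V} (hu : u ∈ A.weight a) (hv : v ∈ A.weight b) {w : M}
    {k d : ℤ} {c : ℂ⟦X⟧} {ε : ℂ} {f₀ f₁ : ℂ⟦X⟧} (h : W.TestJacobi a b u v w k d c ε f₀ f₁) {ζ : ℂ}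
    (hζ : ζ * ζ = 1) : W.TestJacobi a b u v w k (d + 1) ((1 + C ζ * X) * c) (ζ * ε)
      ((C 1 * (1 + X) + C ζ) * f₀) ((C (-1) * (1 + X) + C ζ) * f₁) := by
  intro m n
  have h1 := h (m + 1) n
  have h2 := h m (n + 1)
  rw [pair_one_add_mul (W.eventuallyZero_T u v w _ n),
    pair_one_add_mul (W.eventuallyZero_T v u w _ m),
    ← resSum_step (W.truncatedAbove_firstRes u v w),
    ← resSum_step ⟨0, fun j hj => W.secondRes_eq_zero hu hv w hj⟩]
  have e1 : ∀ (u v : V) (m n d : ℤ), (fun i : ℕ => W.T u (m + (d + 1) - ((i + 1 : ℕ) : ℤ))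
      (W.T v (n + ((i + 1 : ℕ) : ℤ)) w)) =
      fun i : ℕ => W.T u (m + d - i) (W.T v (n + 1 + i) w) := by
    intro u v m n d
    funext i
    rw [show m + (d + 1) - ((i + 1 : ℕ) : ℤ) = m + d - i by push_cast; ring,
      show n + ((i + 1 : ℕ) : ℤ) = n + 1 + i by push_cast; ring]
  rw [e1, e1]
  rw [show m + 1 + d = m + (d + 1) by ring, show m + 1 + n + d = m + n + (d + 1) by ring] at h1
  rw [show n + 1 + d = n + (d + 1) by ring, show m + (n + 1) + d = m + n + (d + 1) by ring] at h2
  have hz : (-1 : ℂ) ^ (m + 1) = -(-1 : ℂ) ^ m := by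
    rw [zpow_add₀ (by norm_num), zpow_one]; ring
  rw [hz] at h1
  push_cast at h1
  have hζ' := congrArg (fun r : ℂ => ((-1 : ℂ) ^ (a * b) * ε * r) •
    pair c (fun i : ℕ => W.T v (n + d - i) (W.T u (m + 1 + i) w))) hζ
  linear_combination (norm := module) h1 + ζ • h2 - hζ'

theorem TestJacobi.iterate {a b : ℤ} {u v : V} (hu : u ∈ A.weight a) (hv : v ∈ A.weight b)
    {w : M} {k d : ℤ} {c : ℂ⟦X⟧} {ε : ℂ} {f₀ f₁ : ℂ⟦X⟧}
    (h : W.TestJacobi a b u v w k d c ε f₀ f₁) {ζ : ℂ} (hζ : ζ * ζ = 1) (r : ℕ) :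
    W.TestJacobi a b u v w k (d + r) ((1 + C ζ * X) ^ r * c) (ζ ^ r * ε)
      ((C 1 * (1 + X) + C ζ) ^ r * f₀) ((C (-1) * (1 + X) + C ζ) ^ r * f₁) := by
  induction r with
  | zero => simpa using h
  | succ r ih =>
    have := ih.step hu hv hζ
    simp only [← mul_assoc, ← pow_succ'] at this
    rwa [show d + (r : ℤ) + 1 = d + ((r + 1 : ℕ) : ℤ) by push_cast; ring] at this

theorem resSum_secondRes_eq_zero {a b : ℤ} {u v : V} (hu : u ∈ A.weight a) (hv : v ∈ A.weight b)
    (w : M) {k : ℤ} {f : ℂ⟦X⟧} (hf : ∃ (r : ℕ) (g : ℂ⟦X⟧), 0 ≤ k + r ∧ f = X ^ r * g) (m : ℂ)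
    (N : ℤ) : resSum (W.secondRes u v w) k f m N = 0 := by
  refine finsum_eq_zero_of_forall_eq_zero fun j => ?_
  rcases lt_or_ge j 0 with hj | hj
  · obtain ⟨r, g, hk, rfl⟩ := hf
    rw [mul_left_comm, zcoeff_X_pow_mul, zcoeff_of_neg (by omega), mul_zero, zero_smul]
  · rw [W.secondRes_eq_zero hu hv w hj, Pi.zero_apply, smul_zero]

/-- The Jacobi identity for `u ⊗ 𝟏` and `v ⊗ 𝟏` in terms of the square roots `y_i` of the formal
variables: the test function is `y_1^m y_2^n (y_1 - y_2)^l`, and only `y_1 = y_2` contributes. -/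
theorem T_jacobi_sqrt {a b : ℤ} {u v : V} (hu : u ∈ A.weight a) (hv : v ∈ A.weight b) (w : M)
    (l m n : ℤ) :
    pair (negPow l) (fun i : ℕ => W.T u (m + l - i) (W.T v (n + i) w))
      - ((-1 : ℂ) ^ (a * b) * (-1 : ℂ) ^ l) •
        pair (negPow l) (fun i : ℕ => W.T v (n + l - i) (W.T u (m + i) w))
    = (1 / 2 : ℂ) • ∑ᶠ j : ℤ, ((2 : ℂ) ^ (-j) * theta j l ((m : ℂ) + 1)) •
        W.T (A.mode u j v) (m + n + l - 2 * j) w := by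
  rcases le_or_gt 0 l with hl | hl
  · obtain ⟨r, rfl⟩ := Int.eq_ofNat_of_zero_le hl
    have h0 := testJacobi_sqPow (W := W) hu hv w 0
    have h := (h0.iterate hu hv (ζ := -1) (by norm_num) r) m n
    have hc : ∀ r : ℕ, (1 + C (-1) * X) ^ r * sqPow ((0 : ℤ) : ℂ) = negPow ((r : ℤ) : ℂ) := by
      intro r
      induction r with
      | zero => simp [sqPow_zero, negPow_zero]
      | succ r ih =>
        rw [pow_succ', mul_assoc, ih, ← negPow_succ]
        push_cast
        rfl
    rw [hc, resSum_secondRes_eq_zero hu hv w ⟨0, _, le_rfl, by rw [pow_zero, one_mul]⟩,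
      smul_zero, add_zero, show (2 : ℤ) * 0 + r = r by ring] at h
    rw [zpow_zero, mul_one, ← zpow_natCast] at h
    rw [h, resSum]
    congr 1
    refine finsum_congr fun j => ?_
    have hf : (C 1 * (1 + X) + C (-1)) ^ r * (C ((2 : ℂ) ^ (0 : ℤ)) * halfPow ((0 : ℤ) : ℂ))
        = X ^ r := by
      rw [Int.cast_zero, halfPow_zero, zpow_zero, map_neg, map_one]
      ring
    rw [hf, mul_comm _ (X ^ r), zcoeff_X_pow_mul, sub_zero, ← theta, firstRes]
  · obtain ⟨r, rfl⟩ : ∃ r : ℕ, l = -r := ⟨l.natAbs, by omega⟩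
    have h0 := testJacobi_sqPow (W := W) hu hv w (-(r : ℤ))
    have h := (h0.iterate hu hv (ζ := 1) (by norm_num) r) m n
    have hc : (1 + C 1 * X) ^ r * sqPow ((-(r : ℤ) : ℤ) : ℂ) = negPow ((-(r : ℤ) : ℤ) : ℂ) := by
      have := sqPow_neg_mul r
      push_cast
      rwa [map_one, one_mul]
    have hf1 : (C (-1) * (1 + X) + C 1) ^ r *
        (C ((2 : ℂ) ^ (-(r : ℤ))) * halfPow ((-(r : ℤ) : ℤ) : ℂ))
        = X ^ r * ((-1) ^ r * (C ((2 : ℂ) ^ (-(r : ℤ))) * halfPow ((-(r : ℤ) : ℤ) : ℂ))) := by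
      rw [map_neg, map_one, show (-1 : ℂ⟦X⟧) * (1 + X) + 1 = X * (-1) by ring, mul_pow, mul_assoc]
    have hf0 : ∀ r : ℕ, (C 1 * (1 + X) + C 1) ^ r *
        (C ((2 : ℂ) ^ (-(r : ℤ))) * halfPow ((-(r : ℤ) : ℤ) : ℂ)) = 1 := by
      intro r
      have h2 : (C 1 * (1 + X) + C 1 : ℂ⟦X⟧) = C 2 * halfPow 1 := by
        have : (C 2 : ℂ⟦X⟧) * C (1 / 2) = 1 := by rw [← map_mul]; norm_num
        have h2' : (C 2 : ℂ⟦X⟧) = 2 := map_ofNat C 2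
        rw [halfPow_one, map_one]
        linear_combination (-X) * this - h2'
      have h3 : ∀ r : ℕ, halfPow 1 ^ r = halfPow (r : ℂ) := by
        intro r
        induction r with
        | zero => rw [pow_zero, Nat.cast_zero, halfPow_zero]
        | succ r ih => rw [pow_succ, ih, ← halfPow_add]; push_cast; rfl
      rw [h2, mul_pow, h3, ← map_pow, mul_mul_mul_comm, ← map_mul, ← halfPow_add]
      push_cast
      rw [add_neg_cancel, halfPow_zero, zpow_neg, zpow_natCast, mul_inv_cancel₀ (by simp), map_one,
        one_mul]
    rw [hc, hf1, hf0, resSum_secondRes_eq_zero hu hv w ⟨r, _, by omega, rfl⟩, smul_zero, add_zero,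
      show (2 : ℤ) * -(r : ℤ) + r = -(r : ℤ) by ring, one_pow, one_mul] at h
    rw [h, resSum]
    congr 1
    refine finsum_congr fun j => ?_
    rw [mul_one, ← theta, firstRes]

end WeakTwistedModule

/-! ### The inverse construction -/

namespace PowerSeries

theorem theta_add {j k : ℤ} {I : ℕ} (h : j - k < I) (δ γ : ℂ) :
    theta j k (δ + γ) = ∑ i ∈ Finset.range I, Ring.choose δ i * theta j (k + i) γ := by
  rcases lt_or_ge j k with hj | hj
  · rw [theta_of_lt hj]
    exact (Finset.sum_eq_zero fun i _ => by rw [theta_of_lt (by omega), mul_zero]).symm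
  obtain ⟨n, hn⟩ := Int.eq_ofNat_of_zero_le (sub_nonneg.2 hj)
  have hsub : Finset.range (n + 1) ⊆ Finset.range I := Finset.range_subset_range.2 (by omega)
  rw [theta, onePow_add, mul_left_comm, hn, zcoeff_natCast, coeff_mul,
    Finset.Nat.sum_antidiagonal_eq_sum_range_succ_mk]
  refine Eq.trans (Finset.sum_congr rfl fun i hi => ?_)
    (Finset.sum_subset hsub fun i _ hi => ?_)
  · rw [Finset.mem_range] at hi
    rw [onePow, binomialSeries_coeff, smul_eq_mul, mul_one, theta,
      show j - (k + i) = ((n - i : ℕ) : ℤ) by omega, zcoeff_natCast]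
  · rw [Finset.mem_range] at hi
    rw [theta_of_lt (by omega), mul_zero]

end PowerSeries

namespace VOSA

open PowerSeries

variable {V : Type*} [AddCommGroup V] [Module ℂ V] (A : VOSA V)

theorem weight_induction {P : V → Prop} (hom : ∀ m : ℤ, ∀ v ∈ A.weight m, P v) (zero : P 0)
    (add : ∀ u v, P u → P v → P (u + v)) (v : V) : P v := by
  have hv : v ∈ ⨆ m, A.weight m := by
    rw [A.weight_internal.submodule_iSup_eq_top]; trivial
  exact Submodule.iSup_induction A.weight (motive := P) hv hom zero add

theorem sub_two_mul_lt_minWeight (m : ℤ) :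
    m - 2 * (|m| + |A.minWeight| + 1) < A.minWeight := by
  have := le_abs_self m
  have := neg_abs_le A.minWeight
  have := abs_nonneg m
  have := abs_nonneg A.minWeight
  omega

/-- The linear map on `V` that restricts to `f m` on `weight m`. -/
noncomputable def gradedLift {X : Type*} [AddCommGroup X] [Module ℂ X] (f : ℤ → V →ₗ[ℂ] X) :
    V →ₗ[ℂ] X :=
  (DirectSum.toModule ℂ ℤ X fun m => f m ∘ₗ (A.weight m).subtype) ∘ₗ
    (LinearEquiv.ofBijective (DirectSum.coeLinearMap A.weight)
      (show Function.Bijective (DirectSum.coeLinearMap A.weight) from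
        A.weight_internal)).symm.toLinearMap

theorem gradedLift_apply {X : Type*} [AddCommGroup X] [Module ℂ X] (f : ℤ → V →ₗ[ℂ] X) {m : ℤ}
    {v : V} (hv : v ∈ A.weight m) : A.gradedLift f v = f m v := by
  have hb : Function.Bijective (DirectSum.coeLinearMap A.weight) := A.weight_internal
  have h : (LinearEquiv.ofBijective (DirectSum.coeLinearMap A.weight) hb).symm v
      = DirectSum.lof ℂ ℤ (fun n => A.weight n) m ⟨v, hv⟩ := by
    rw [LinearEquiv.symm_apply_eq, LinearEquiv.ofBijective_apply, DirectSum.coeLinearMap_lof]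
  simp [gradedLift, h]

variable {A}

/-- The generalization of `conjSum_eq` obtained by expanding `(1 + y)^δ`. -/
theorem sum_theta_add_smul_mode {a b : ℤ} {u v : V} (hu : u ∈ A.weight a) (hv : v ∈ A.weight b)
    (l D : ℤ) (δ : ℂ) {B : ℤ} (ha : a - 2 * B < A.minWeight) (hb : b - 2 * B < A.minWeight)
    {I : ℕ} (hI : ∀ i : ℕ, I ≤ i → A.mode u (l + i) v = 0) :
    ∑ p ∈ Finset.Ico (0 : ℤ) B ×ˢ Finset.Ico (0 : ℤ) B,
      theta (D - p.1 - p.2) l (δ + ((a : ℂ) / 2 - 2 * p.1)) •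
        A.mode (A.einv p.1 u) (D - p.1 - p.2) (A.einv p.2 v) =
    ∑ i ∈ Finset.range I, Ring.choose δ i • A.einv (D - (l + i)) (A.mode u (l + i) v) := by
  set J : ℕ := max I ((D - l).toNat + 1) with hJ
  have h1 : ∑ p ∈ Finset.Ico (0 : ℤ) B ×ˢ Finset.Ico (0 : ℤ) B,
      theta (D - p.1 - p.2) l (δ + ((a : ℂ) / 2 - 2 * p.1)) •
        A.mode (A.einv p.1 u) (D - p.1 - p.2) (A.einv p.2 v) =
      ∑ i ∈ Finset.range J, Ring.choose δ i • A.einv (D - (l + i)) (A.mode u (l + i) v) := by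
    simp only [← conjSum_eq hu hv, conjSum_eq_sum_box hu hv _ _ (0, 0) le_rfl le_rfl
      (by simpa using ha) (by simpa using hb), Finset.smul_sum]
    rw [Finset.sum_comm]
    refine Finset.sum_congr rfl fun p hp => ?_
    rw [Finset.mem_product, Finset.mem_Ico, Finset.mem_Ico] at hp
    rw [theta_add (I := J) (by omega), Finset.sum_smul]
    refine Finset.sum_congr rfl fun i _ => ?_
    rw [show p - ((0, 0) : ℤ × ℤ) = p from sub_zero p, conjTerm, mul_smul]
  rw [h1]
  refine (Finset.sum_subset (Finset.range_subset_range.2 (le_max_left _ _)) fun i _ hi => ?_).symm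
  rw [Finset.mem_range, not_lt] at hi
  rw [hI i hi, map_zero, smul_zero]

/-- Averaging over the powers of the parity map. -/
theorem parity_average {M : Type*} [AddCommGroup M] [Module ℂ M]
    (F : V →ₗ[ℂ] ℤ → Module.End ℂ M) {a : ℤ} {u : V} (hu : u ∈ A.weight a) (v : V) (p n r : ℤ)
    (w : M) : (((2 : ℕ) : ℂ)⁻¹ • ∑ j ∈ Finset.range 2, ((-1 : ℂ) ^ (-((j : ℤ) * p))) •
      F (A.mode ((A.parity ^ j) u) n v) r w) =
      if Even (p + a) then F (A.mode u n v) r w else 0 := by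
  have h1 : (-1 : ℂ) ^ (-(((1 : ℕ) : ℤ) * p)) = (-1 : ℂ) ^ p := by
    rw [Nat.cast_one, one_mul, zpow_neg, ← inv_zpow]
    norm_num
  rw [Finset.sum_range_succ, Finset.sum_range_one, h1, pow_one, pow_zero, Module.End.one_apply,
    A.parity_apply hu, mode_smul, LinearMap.smul_apply, map_smul, Pi.smul_apply,
    LinearMap.smul_apply, Nat.cast_zero, zero_mul, neg_zero, zpow_zero, one_smul, smul_smul,
    ← zpow_add₀ (by norm_num)]
  split_ifs with h
  · rw [h.neg_one_zpow]; push_cast; module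
  · rw [(Int.not_even_iff_odd.1 h).neg_one_zpow]; push_cast; module

end VOSA

namespace WeakTwistedModule

open PowerSeries

variable {V : Type*} [AddCommGroup V] [Module ℂ V] {A : VOSA V}
  {M : Type*} [AddCommGroup M] [Module ℂ M]
  (W : WeakTwistedModule A.tensorSquare 2 (-1) A.signedSwap M)

/-- The number `2^{1/2}`. -/
noncomputable def sqrtTwo : ℂ := ((Real.sqrt 2 : ℝ) : ℂ)

theorem sqrtTwo_ne_zero : sqrtTwo ≠ 0 := by
  rw [sqrtTwo, Complex.ofReal_ne_zero, Real.sqrt_ne_zero']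
  norm_num

theorem sqrtTwo_zpow_two_mul (n : ℤ) : sqrtTwo ^ (2 * n) = 2 ^ n := by
  rw [zpow_mul, zpow_ofNat, sqrtTwo, ← Complex.ofReal_pow, Real.sq_sqrt zero_le_two,
    Complex.ofReal_ofNat]

/-- The restriction of `untwistMode` to `weight m`; see `untwistMode_apply`. -/
noncomputable def untwistHom (m : ℤ) : V →ₗ[ℂ] ℤ → Module.End ℂ M where
  toFun v r := if Even (r + m) then sqrtTwo ^ m •
    ∑ s ∈ Finset.Ico (0 : ℤ) (|m| + |A.minWeight| + 1),
      (2 : ℂ) ^ (-s) • W.T (A.einv s v) ((r + m) / 2 - 1 - 2 * s) else 0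
  map_add' u v := by
    funext r
    rw [Pi.add_apply]
    split_ifs
    · simp only [map_add, T_add, smul_add, Finset.sum_add_distrib]
    · rw [add_zero]
  map_smul' c v := by
    funext r
    rw [Pi.smul_apply]
    split_ifs
    · simp only [map_smul, T_smul, Finset.smul_sum, RingHom.id_apply]
      refine Finset.sum_congr rfl fun s _ => ?_
      module
    · rw [smul_zero]

/-- The modes of the vertex operators `Y_σ(v, x) = Y_κ̃((Δ₂(x²)^{-1} v) ⊗ 𝟏, x²)`. -/
noncomputable def untwistMode : V →ₗ[ℂ] ℤ → Module.End ℂ M := A.gradedLift W.untwistHom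

variable {W}

theorem untwistMode_eq_zero {m : ℤ} {v : V} (hv : v ∈ A.weight m) {r : ℤ} (h : ¬Even (r + m)) :
    W.untwistMode v r = 0 := by
  rw [untwistMode, A.gradedLift_apply _ hv]
  exact if_neg h

theorem finsum_T_einv {m : ℤ} {v : V} (hv : v ∈ A.weight m) {B : ℤ}
    (hB : m - 2 * B < A.minWeight) (R : ℤ) :
    ∑ᶠ s : ℤ, (2 : ℂ) ^ (-s) • W.T (A.einv s v) (R - 2 * s) =
      ∑ s ∈ Finset.Ico (0 : ℤ) B, (2 : ℂ) ^ (-s) • W.T (A.einv s v) (R - 2 * s) := by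
  refine finsum_eq_sum_of_support_subset _ fun s hs => ?_
  rw [Function.mem_support] at hs
  rw [Finset.coe_Ico, Set.mem_Ico]
  constructor
  · by_contra h
    exact hs (by rw [A.einv_of_neg (by omega), LinearMap.zero_apply, T_zero, smul_zero])
  · by_contra h
    exact hs (by rw [A.einv_eq_zero hv (by omega), T_zero, smul_zero])

theorem untwistMode_eq_finsum {m : ℤ} {v : V} (hv : v ∈ A.weight m) (R : ℤ) :
    W.untwistMode v (2 * R + 2 - m) =
      sqrtTwo ^ m • ∑ᶠ s : ℤ, (2 : ℂ) ^ (-s) • W.T (A.einv s v) (R - 2 * s) := by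
  rw [finsum_T_einv hv (A.sub_two_mul_lt_minWeight m), untwistMode, A.gradedLift_apply _ hv]
  refine (if_pos (by rw [sub_add_cancel]; exact ⟨R + 1, by ring⟩)).trans ?_
  rw [show (2 * R + 2 - m + m) / 2 - 1 = R by omega]

theorem untwistMode_eq_sum {m : ℤ} {v : V} (hv : v ∈ A.weight m) {B : ℤ}
    (hB : m - 2 * B < A.minWeight) (R : ℤ) :
    W.untwistMode v (2 * R + 2 - m) =
      sqrtTwo ^ m • ∑ s ∈ Finset.Ico (0 : ℤ) B, (2 : ℂ) ^ (-s) • W.T (A.einv s v) (R - 2 * s) := by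
  rw [untwistMode_eq_finsum hv, finsum_T_einv hv hB]

theorem exists_index_of_even {r m : ℤ} (h : Even (r + m)) : ∃ R : ℤ, r = 2 * R + 2 - m := by
  obtain ⟨n, hn⟩ := h
  exact ⟨n - 1, by omega⟩

theorem untwistMode_sign {a : ℤ} {v : V} (hv : v ∈ A.weight a) (p : ℤ) (j : ZMod 2) {w : M}
    (hw : w ∈ W.sign j) : W.untwistMode v p w ∈ W.sign (j + a) := by
  by_cases h : Even (p + a)
  · obtain ⟨R, rfl⟩ := exists_index_of_even h
    rw [untwistMode_eq_sum hv (A.sub_two_mul_lt_minWeight a), LinearMap.smul_apply,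
      LinearMap.sum_apply]
    refine Submodule.smul_mem _ _ (sum_mem fun s _ => Submodule.smul_mem _ _ ?_)
    have := W.mode_sign (a - 2 * s) _ (A.tmul_vac_mem (A.einv_mem hv s)) (R - 2 * s) j w hw
    have h2 : ((a - 2 * s : ℤ) : ZMod 2) = a := by
      push_cast
      rw [show (2 : ZMod 2) = 0 from rfl, zero_mul, sub_zero]
    rwa [h2] at this
  · rw [untwistMode_eq_zero hv h]
    exact zero_mem _

theorem untwistMode_truncation (v : V) (w : M) : ∃ N : ℤ, ∀ p ≥ N, W.untwistMode v p w = 0 := by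
  induction v using A.weight_induction with
  | hom m v hv =>
    obtain ⟨B, hB, hB0⟩ : ∃ B : ℤ, m - 2 * B < A.minWeight ∧ 0 ≤ B :=
      ⟨_, A.sub_two_mul_lt_minWeight m, by positivity⟩
    have hN : ∀ s : ℤ, ∃ N : ℤ, ∀ p ≥ N, W.T (A.einv s v) p w = 0 := fun s =>
      W.truncation (A.einv s v ⊗ₜ A.vac) w
    choose N hN using hN
    refine ⟨∑ s ∈ Finset.Ico (0 : ℤ) B, 2 * |N s| + 4 * B + 2 + |m|, fun p hp => ?_⟩
    by_cases h : Even (p + m)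
    · obtain ⟨R, rfl⟩ := exists_index_of_even h
      rw [untwistMode_eq_sum hv hB, LinearMap.smul_apply, LinearMap.sum_apply,
        Finset.sum_eq_zero, smul_zero]
      intro s hs
      have h1 : 2 * |N s| ≤ ∑ s ∈ Finset.Ico (0 : ℤ) B, 2 * |N s| :=
        Finset.single_le_sum (f := fun s => 2 * |N s|) (fun i _ => by positivity) hs
      rw [Finset.mem_Ico] at hs
      have h2 := le_abs_self (N s)
      have h3 := neg_abs_le m
      rw [LinearMap.smul_apply, hN s _ (by omega), smul_zero]
    · rw [untwistMode_eq_zero hv h, LinearMap.zero_apply]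
  | zero => exact ⟨0, fun p _ => by rw [map_zero]; rfl⟩
  | add u v hu hv =>
    obtain ⟨N, hN⟩ := hu
    obtain ⟨K, hK⟩ := hv
    refine ⟨max N K, fun p hp => ?_⟩
    rw [map_add, Pi.add_apply, LinearMap.add_apply, hN p (le_trans (le_max_left _ _) hp),
      hK p (le_trans (le_max_right _ _) hp), add_zero]

theorem untwistMode_vac (p : ℤ) (w : M) :
    W.untwistMode A.vac p w = if p = -2 then w else 0 := by
  by_cases h : Even (p + 0)
  · obtain ⟨R, rfl⟩ := exists_index_of_even h
    rw [untwistMode_eq_finsum A.vac_mem, finsum_eq_single _ 0]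
    · rw [A.einv_zero, zpow_zero, neg_zero, zpow_zero, one_smul, one_smul, Module.End.one_apply,
        T_vac]
      congr 1
      exact propext ⟨fun h => by omega, fun h => by omega⟩
    · intro s hs
      rw [A.einv_vac hs, T_zero, smul_zero]
  · rw [untwistMode_eq_zero A.vac_mem h, if_neg]
    · rfl
    · rintro rfl
      exact h (by decide)

end WeakTwistedModule

namespace WeakTwistedModule

open PowerSeries

variable {V : Type*} [AddCommGroup V] [Module ℂ V] {A : VOSA V}
  {M : Type*} [AddCommGroup M] [Module ℂ M]
  {W : WeakTwistedModule A.tensorSquare 2 (-1) A.signedSwap M}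

theorem T_sum {ι : Type*} (t : Finset ι) (f : ι → V) (p : ℤ) :
    W.T (∑ i ∈ t, f i) p = ∑ i ∈ t, W.T (f i) p := by
  simp only [T, TensorProduct.sum_tmul, map_sum, Finset.sum_apply]

theorem untwistMode_apply {m : ℤ} {v : V} (hv : v ∈ A.weight m) (R : ℤ) (w : M) :
    W.untwistMode v (2 * R + 2 - m) w =
      sqrtTwo ^ m • ∑ᶠ s : ℤ, (2 : ℂ) ^ (-s) • W.T (A.einv s v) (R - 2 * s) w := by
  rw [untwistMode_eq_sum hv (A.sub_two_mul_lt_minWeight m), LinearMap.smul_apply,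
    LinearMap.sum_apply]
  congr 1
  refine (finsum_eq_sum_of_support_subset _ fun s hs => ?_).symm
  rw [Function.mem_support] at hs
  rw [Finset.coe_Ico, Set.mem_Ico]
  have h2 := A.sub_two_mul_lt_minWeight m
  constructor
  · by_contra h
    exact hs (by rw [A.einv_of_neg (by omega), LinearMap.zero_apply, T_zero, smul_zero,
      LinearMap.zero_apply])
  · by_contra h
    exact hs (by rw [A.einv_eq_zero hv (by omega), T_zero, smul_zero, LinearMap.zero_apply])

/-- Products of untwisted modes, summed against the expansion of `(x_1 - x_2)^l`. -/
theorem pair_untwistMode {a b : ℤ} {u v : V} (hu : u ∈ A.weight a) (hv : v ∈ A.weight b) {B : ℤ}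
    (ha : a - 2 * B < A.minWeight) (hb : b - 2 * B < A.minWeight) (w : M) (l P Q : ℤ) :
    pair (negPow l) (fun i : ℕ => W.untwistMode u (2 * P + 2 - a + 2 * (l - i))
      (W.untwistMode v (2 * Q + 2 - b + 2 * i) w)) =
    sqrtTwo ^ (a + b) • ∑ x ∈ Finset.Ico (0 : ℤ) B ×ˢ Finset.Ico (0 : ℤ) B,
      (2 : ℂ) ^ (-x.1 - x.2) • pair (negPow l) (fun i : ℕ =>
        W.T (A.einv x.1 u) (P - 2 * x.1 + l - i) (W.T (A.einv x.2 v) (Q - 2 * x.2 + i) w)) := by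
  have h1 : ∀ i : ℕ, coeff i (negPow l) • W.untwistMode u (2 * P + 2 - a + 2 * (l - i))
      (W.untwistMode v (2 * Q + 2 - b + 2 * i) w) =
      ∑ x ∈ Finset.Ico (0 : ℤ) B ×ˢ Finset.Ico (0 : ℤ) B,
        (sqrtTwo ^ (a + b) * (2 : ℂ) ^ (-x.1 - x.2)) • (coeff i (negPow l) •
        W.T (A.einv x.1 u) (P - 2 * x.1 + l - i)
          (W.T (A.einv x.2 v) (Q - 2 * x.2 + i) w)) := by
    intro i
    rw [show 2 * P + 2 - a + 2 * (l - i) = 2 * (P + l - i) + 2 - a by ring,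
      show 2 * Q + 2 - b + 2 * (i : ℤ) = 2 * (Q + i) + 2 - b by ring,
      untwistMode_eq_sum hu ha, untwistMode_eq_sum hv hb, Finset.sum_product]
    simp only [LinearMap.smul_apply, LinearMap.sum_apply, map_smul, map_sum, Finset.smul_sum]
    rw [Finset.sum_comm]
    refine Finset.sum_congr rfl fun s _ => Finset.sum_congr rfl fun t _ => ?_
    rw [zpow_add₀ sqrtTwo_ne_zero, sub_eq_add_neg (-s), zpow_add₀ two_ne_zero,
      show P + l - i - 2 * s = P - 2 * s + l - i by ring,
      show Q + i - 2 * t = Q - 2 * t + (i : ℤ) by ring]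
    module
  simp only [pair]
  rw [finsum_congr h1, finsum_sum_comm]
  · rw [Finset.smul_sum]
    refine Finset.sum_congr rfl fun x _ => ?_
    rw [← smul_finsum, mul_smul]
  · intro x _
    refine Set.Finite.subset
      ((W.eventuallyZero_T (A.einv x.1 u) (A.einv x.2 v) w (P - 2 * x.1 + l)
        (Q - 2 * x.2)).hasFiniteSupport (negPow l)) ?_
    exact Function.support_const_smul_subset _ _

/-- The twisted Jacobi identity for the untwisted modes, in the case of indices for which neither
side vanishes for trivial reasons. -/
theorem untwistMode_jacobi_of_even {a b : ℤ} {u v : V} (hu : u ∈ A.weight a)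
    (hv : v ∈ A.weight b) (w : M) (l P Q : ℤ) :
    pair (negPow l) (fun i : ℕ => W.untwistMode u (2 * P + 2 - a + 2 * (l - i))
      (W.untwistMode v (2 * Q + 2 - b + 2 * i) w))
    - ((-1 : ℂ) ^ (a * b) * (-1 : ℂ) ^ l) •
      pair (negPow l) (fun i : ℕ => W.untwistMode v (2 * Q + 2 - b + 2 * (l - i))
        (W.untwistMode u (2 * P + 2 - a + 2 * i) w)) =
    ∑ᶠ i : ℕ, Ring.choose (((2 * P + 2 - a : ℤ) : ℂ) / 2) i •
      W.untwistMode (A.mode u (l + i) v) (2 * P + 2 - a + (2 * Q + 2 - b) - 2 * i) w := by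
  set B : ℤ := max (|a| + |A.minWeight| + 1) (|b| + |A.minWeight| + 1) with hB
  have ha : a - 2 * B < A.minWeight :=
    lt_of_le_of_lt (by have := le_max_left (|a| + |A.minWeight| + 1) (|b| + |A.minWeight| + 1)
                       omega) (A.sub_two_mul_lt_minWeight a)
  have hb : b - 2 * B < A.minWeight :=
    lt_of_le_of_lt (by have := le_max_right (|a| + |A.minWeight| + 1) (|b| + |A.minWeight| + 1)
                       omega) (A.sub_two_mul_lt_minWeight b)
  obtain ⟨I, hI⟩ : ∃ I : ℕ, ∀ i : ℕ, I ≤ i → A.mode u (l + i) v = 0 := by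
    obtain ⟨J, hJ⟩ := A.exists_mode_eq_zero u v
    exact ⟨(J - l).toNat, fun i hi => hJ _ (by omega)⟩
  set δ : ℂ := ((2 * P + 2 - a : ℤ) : ℂ) / 2 with hδ
  set box := Finset.Ico (0 : ℤ) B ×ˢ Finset.Ico (0 : ℤ) B with hbox
  -- The summand for the indices `x = (s, t)` and `D = s + t + j`, where the index `j` comes from
  -- `T_jacobi_sqrt`.  The sum over `x` for fixed `D` is evaluated by `sum_theta_add_smul_mode`.
  set G : ℤ × ℤ → ℤ → M := fun x D => (2 : ℂ) ^ (-D) •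
    W.T (theta (D - x.1 - x.2) l (δ + ((a : ℂ) / 2 - 2 * x.1)) •
      A.mode (A.einv x.1 u) (D - x.1 - x.2) (A.einv x.2 v)) (P + Q + l - 2 * D) w with hG
  have hGfin : ∀ x, Function.HasFiniteSupport (G x) := by
    intro x
    obtain ⟨J, hJ⟩ := A.exists_mode_eq_zero (A.einv x.1 u) (A.einv x.2 v)
    refine (Set.finite_Ico (l + x.1 + x.2) (J + x.1 + x.2)).subset fun D hD => ?_
    rw [Function.mem_support] at hD
    constructor
    · by_contra h
      exact hD (by simp only [hG]; rw [theta_of_lt (by omega), zero_smul, T_zero,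
        LinearMap.zero_apply, smul_zero])
    · by_contra h
      exact hD (by simp only [hG]; rw [hJ _ (by omega), smul_zero, T_zero,
        LinearMap.zero_apply, smul_zero])
  have hleft : pair (negPow l) (fun i : ℕ => W.untwistMode u (2 * P + 2 - a + 2 * (l - i))
      (W.untwistMode v (2 * Q + 2 - b + 2 * i) w))
    - ((-1 : ℂ) ^ (a * b) * (-1 : ℂ) ^ l) •
      pair (negPow l) (fun i : ℕ => W.untwistMode v (2 * Q + 2 - b + 2 * (l - i))
        (W.untwistMode u (2 * P + 2 - a + 2 * i) w)) =
      (sqrtTwo ^ (a + b) * (1 / 2)) • ∑ x ∈ box, ∑ᶠ D : ℤ, G x D := by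
    have hvu := pair_untwistMode (W := W) hv hu hb ha w l Q P
    rw [Finset.sum_product_right, ← Finset.sum_product', add_comm b a] at hvu
    dsimp only at hvu
    rw [pair_untwistMode hu hv ha hb, hvu, Finset.smul_sum, Finset.smul_sum,
      Finset.smul_sum, Finset.smul_sum, ← Finset.sum_sub_distrib]
    refine Finset.sum_congr rfl fun x _ => ?_
    have hJ := T_jacobi_sqrt (W := W) (A.einv_mem hu x.1) (A.einv_mem hv x.2) w l (P - 2 * x.1)
      (Q - 2 * x.2)
    have hs : (-1 : ℂ) ^ ((a - 2 * x.1) * (b - 2 * x.2)) = (-1 : ℂ) ^ (a * b) := by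
      rw [show (a - 2 * x.1) * (b - 2 * x.2) = a * b + 2 * (2 * x.1 * x.2 - a * x.2 - b * x.1) by
        ring, zpow_add₀ (by norm_num), zpow_mul _ 2]
      norm_num
    rw [hs] at hJ
    have hD : ∑ᶠ D : ℤ, G x D = (2 : ℂ) ^ (-x.1 - x.2) • ∑ᶠ j : ℤ,
        ((2 : ℂ) ^ (-j) * theta j l (((P - 2 * x.1 : ℤ) : ℂ) + 1)) •
          W.T (A.mode (A.einv x.1 u) j (A.einv x.2 v))
            (P - 2 * x.1 + (Q - 2 * x.2) + l - 2 * j) w := by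
      rw [smul_finsum, ← finsum_comp_equiv (Equiv.addRight (x.1 + x.2))]
      refine finsum_congr fun j => ?_
      simp only [hG, Equiv.coe_addRight]
      rw [show j + (x.1 + x.2) - x.1 - x.2 = j by ring,
        show P + Q + l - 2 * (j + (x.1 + x.2)) = P - 2 * x.1 + (Q - 2 * x.2) + l - 2 * j by ring,
        show δ + ((a : ℂ) / 2 - 2 * x.1) = ((P - 2 * x.1 : ℤ) : ℂ) + 1 by
          rw [hδ]; push_cast; ring,
        T_smul, LinearMap.smul_apply, show -(j + (x.1 + x.2)) = (-x.1 - x.2) + -j by ring,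
        zpow_add₀ two_ne_zero, smul_smul, smul_smul, mul_assoc]
    rw [hD, show -x.2 - x.1 = -x.1 - x.2 by ring]
    linear_combination (norm := module) (sqrtTwo ^ (a + b) * (2 : ℂ) ^ (-x.1 - x.2)) • hJ
  have hright : ∀ D : ℤ, ∑ x ∈ box, G x D = ∑ i ∈ Finset.range I, Ring.choose δ i •
      (2 : ℂ) ^ (-D) • W.T (A.einv (D - (l + i)) (A.mode u (l + i) v)) (P + Q + l - 2 * D) w := by
    intro D
    simp only [hG]
    rw [← Finset.smul_sum, ← LinearMap.sum_apply, ← T_sum,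
      A.sum_theta_add_smul_mode hu hv l D δ ha hb hI, T_sum, LinearMap.sum_apply, Finset.smul_sum]
    refine Finset.sum_congr rfl fun i _ => ?_
    rw [T_smul, LinearMap.smul_apply, smul_comm]
  have hmem : ∀ i : ℕ, A.mode u (l + i) v ∈ A.weight (a + b - 2 * (l + i) - 2) := fun i =>
    A.mode_mem hu hv _
  have hfin2 : ∀ i : ℕ, Function.HasFiniteSupport fun D : ℤ =>
      W.T (A.einv (D - (l + i)) (A.mode u (l + i) v)) (P + Q + l - 2 * D) w := by
    intro i
    refine (Set.finite_Ico (l + (i : ℤ))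
      (|a + b - 2 * (l + i) - 2| + |A.minWeight| + 1 + (l + i))).subset fun D hD => ?_
    rw [Function.mem_support] at hD
    constructor
    · by_contra h
      exact hD (by rw [A.einv_of_neg (by omega), LinearMap.zero_apply, T_zero,
        LinearMap.zero_apply])
    · by_contra h
      have h2 := A.sub_two_mul_lt_minWeight (a + b - 2 * (l + i) - 2)
      exact hD (by rw [A.einv_eq_zero (hmem i) (by omega), T_zero, LinearMap.zero_apply])
  rw [hleft, ← finsum_sum_comm box (fun D x => G x D) fun x _ => hGfin x, finsum_congr hright,
    finsum_sum_comm _ _ fun i _ => ?_, Finset.smul_sum, finsum_eq_sum_of_support_subset]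
  · refine Finset.sum_congr rfl fun i _ => ?_
    rw [show 2 * P + 2 - a + (2 * Q + 2 - b) - 2 * (i : ℤ) =
      2 * (P + Q - l - 2 * i) + 2 - (a + b - 2 * (l + i) - 2) by ring,
      untwistMode_apply (hmem i), ← smul_finsum, smul_comm]
    congr 1
    rw [← finsum_comp_equiv (Equiv.addRight (l + (i : ℤ))), smul_finsum, smul_finsum]
    refine finsum_congr fun s => ?_
    simp only [Equiv.coe_addRight]
    rw [add_sub_cancel_right, smul_smul, smul_smul,
      show P + Q + l - 2 * (s + (l + i)) = P + Q - l - 2 * i - 2 * s by ring]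
    congr 1
    rw [show a + b - 2 * (l + i) - 2 = a + b + 2 * (-(l + i) - 1) by ring,
      zpow_add₀ sqrtTwo_ne_zero (a + b), sqrtTwo_zpow_two_mul, zpow_sub_one₀ two_ne_zero,
      show -(s + (l + (i : ℤ))) = -s + -(l + i) by ring, zpow_add₀ two_ne_zero]
    ring
  · intro i hi
    rw [Function.mem_support] at hi
    rw [Finset.coe_range, Set.mem_Iio]
    by_contra h
    exact hi (by rw [hI i (by omega), map_zero, Pi.zero_apply, LinearMap.zero_apply, smul_zero])
  · exact ((hfin2 i).subset
      (Function.support_smul_subset_right (fun D : ℤ => (2 : ℂ) ^ (-D)) _)).subset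
      (Function.support_const_smul_subset _ _)

variable (W) in
/-- The weak `σ`-twisted `V`-module whose image under `T²` is `W`. -/
noncomputable def untwist : WeakTwistedModule A.toSuperVertexData 2 (-1) A.parity M where
  sign := W.sign
  Y := W.untwistMode
  sign_internal := W.sign_internal
  mode_sign _ _ hv p j _ hw := untwistMode_sign hv p j hw
  truncation := untwistMode_truncation
  vac_mode := untwistMode_vac
  jacobi a b u v hu hv w l p q := by
    rw [finsum_congr fun i : ℕ => congrArg (Ring.choose ((p : ℂ) / (2 : ℕ)) i • ·)
      (A.parity_average W.untwistMode hu v p (l + i) (p + q - (2 : ℕ) * i) w)]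
    -- Unless `p ∈ 2ℤ + a` and `q ∈ 2ℤ + b`, both sides vanish term by term.
    have hodd : ∀ {c : ℤ} {x : V} {r : ℤ}, x ∈ A.weight c → ¬Even (r + c) → ∀ (n : ℤ) (y : M),
        W.untwistMode x (r + (2 : ℕ) * n) y = 0 := by
      intro c x r hx hr n y
      rw [untwistMode_eq_zero hx, LinearMap.zero_apply]
      rwa [show r + (2 : ℕ) * n + c = r + c + 2 * n by push_cast; ring, Int.even_add,
        iff_true_right (even_two_mul n)]
    by_cases hp : Even (p + a)
    · by_cases hq : Even (q + b)
      · obtain ⟨P, rfl⟩ := exists_index_of_even hp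
        obtain ⟨Q, rfl⟩ := exists_index_of_even hq
        have := untwistMode_jacobi_of_even (W := W) hu hv w l P Q
        simpa only [pair, coeff_negPow, if_pos hp, Nat.cast_ofNat] using this
      · have h0 : ∀ i : ℕ, W.untwistMode (A.mode u (l + i) v) (p + q - (2 : ℕ) * i) w = 0 := by
          intro i
          rw [untwistMode_eq_zero (A.mode_mem hu hv (l + i)), LinearMap.zero_apply]
          rwa [show p + q - (2 : ℕ) * (i : ℤ) + (a + b - 2 * (l + i) - 2) =
            p + a + (q + b + 2 * (-2 * i - l - 1)) by push_cast; ring, Int.even_add,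
            iff_true_left hp, Int.even_add, iff_true_right (even_two_mul _)]
        simp only [hodd hv hq, h0, map_zero, smul_zero, ite_self, finsum_zero, sub_zero]
    · simp only [hodd hu hp, if_neg hp, map_zero, smul_zero, finsum_zero, sub_zero]

end WeakTwistedModule

/-! ### The relation `T²` and uniqueness -/

theorem finsum_finsum_eq_sum_antidiagonal {M : Type*} [AddCommMonoid M] {F : ℕ → ℕ → M} {B : ℕ}
    (h : ∀ s t, B ≤ s ∨ B ≤ t → F s t = 0) :
    ∑ᶠ s, ∑ᶠ t, F s t =
      ∑ n ∈ Finset.range (2 * B), ∑ ij ∈ Finset.HasAntidiagonal.antidiagonal n, F ij.1 ij.2 := by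
  simp only [Finset.Nat.sum_antidiagonal_eq_sum_range_succ_mk]
  rw [Finset.sum_range_diag_flip, finsum_eq_sum_of_support_subset (s := Finset.range (2 * B))]
  · refine Finset.sum_congr rfl fun s _ => finsum_eq_sum_of_support_subset _ fun t ht => ?_
    rw [Function.mem_support] at ht
    rw [Finset.coe_range, Set.mem_Iio]
    by_contra h2
    exact ht (h s t (by omega))
  · intro s hs
    rw [Function.mem_support] at hs
    rw [Finset.coe_range, Set.mem_Iio]
    by_contra h2
    exact hs (finsum_eq_zero_of_forall_eq_zero fun t => h s t (by omega))

namespace WeakTwistedModule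

/-- The twisted Jacobi identity for `u` and the vacuum, with `l = -1`. -/
theorem Y_eq_finsum_vac {V : Type*} [AddCommGroup V] [Module ℂ V] {A : SuperVertexData V} {k : ℕ}
    {η : ℂ} {g : V →ₗ[ℂ] V} {M : Type*} [AddCommGroup M] [Module ℂ M]
    (W : WeakTwistedModule A k η g M) (hk : k ≠ 0) (hvac : A.vac ∈ A.weight 0) {a : ℤ} {u : V}
    (hu : u ∈ A.weight a) (p : ℤ) (w : M) :
    W.Y u p w = ∑ᶠ i : ℕ, Ring.choose ((p : ℂ) / k) i •
      ((k : ℂ)⁻¹ • ∑ j ∈ Finset.range k, (η ^ (-((j : ℤ) * p))) •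
        W.Y (A.mode ((g ^ j) u) (-1 + i) A.vac) (p - k * i) w) := by
  have h := W.jacobi a 0 u A.vac hu hvac w (-1) p 0
  have hk' : (0 : ℤ) < k := by omega
  have h1 : ∀ i : ℕ, W.Y A.vac (0 + k * i) w = 0 := by
    intro i
    rw [W.vac_mode, if_neg]
    have : (0 : ℤ) ≤ k * i := by positivity
    omega
  simp only [add_zero] at h
  rw [← h, finsum_eq_zero_of_forall_eq_zero fun i => by rw [h1, map_zero, smul_zero],
    finsum_eq_single _ 0]
  · rw [W.vac_mode, if_pos (by push_cast; ring)]
    simp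
  · intro i hi
    rw [W.vac_mode, if_neg, smul_zero]
    intro h2
    have : (k : ℤ) * i = 0 := by linarith
    rcases mul_eq_zero.1 this with h3 | h3 <;> omega

variable {V : Type*} [AddCommGroup V] [Module ℂ V] {A : VOSA V}
  {M : Type*} [AddCommGroup M] [Module ℂ M]

/-- The vertex operators of `𝟏 ⊗ v` are determined by those of `v ⊗ 𝟏`. -/
theorem Y_vac_tmul (W : WeakTwistedModule A.tensorSquare 2 (-1) A.signedSwap M) (v : V) (p : ℤ) :
    W.Y (A.vac ⊗ₜ v) p = ((-1 : ℂ) ^ p) • W.Y (v ⊗ₜ A.vac) p := by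
  induction v using A.weight_induction with
  | hom m v hv =>
    ext w
    have h := W.Y_eq_finsum_vac two_ne_zero (A.tmul_vac_mem A.vac_mem) (A.tmul_vac_mem hv) p w
    have h1 : (-1 : ℂ) ^ (-(((1 : ℕ) : ℤ) * p)) = (-1 : ℂ) ^ p := by
      rw [Nat.cast_one, one_mul, zpow_neg, ← inv_zpow]
      norm_num
    have hvac : A.tensorSquare.vac = A.vac ⊗ₜ A.vac := rfl
    simp only [Finset.sum_range_succ, Finset.sum_range_zero, h1, pow_one, pow_zero,
      Module.End.one_apply, A.signedSwap_tmul_vac hv, hvac,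
      A.tensorSquare_mode_tmul_vac v A.vac_mem, A.tensorSquare_mode_vac_tmul hv A.vac_mem] at h
    rw [finsum_eq_single _ 0] at h
    · have hsq : (-1 : ℂ) ^ p * (-1 : ℂ) ^ p = 1 := by
        rw [← mul_zpow]; norm_num
      simp [A.creation] at h
      have h2 := congrArg (fun r : ℂ => r • W.Y (A.vac ⊗ₜ v) p w) hsq
      rw [LinearMap.smul_apply]
      linear_combination (norm := module) (-2 * (-1 : ℂ) ^ p) • h - h2
    · intro i hi
      rw [A.creation_regular v _ (by omega)]
      simp
  | zero => simp
  | add u v hu hv =>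
    rw [TensorProduct.tmul_add, TensorProduct.add_tmul, map_add, map_add, Pi.add_apply,
      Pi.add_apply, hu, hv, smul_add]

/-- In a `σ`-twisted module the modes of `v` have indices in `ℤ + |v|/2`. -/
theorem Y_eq_zero_of_not_even (N : WeakTwistedModule A.toSuperVertexData 2 (-1) A.parity M)
    {m : ℤ} {v : V} (hv : v ∈ A.weight m) {r : ℤ} (h : ¬Even (r + m)) : N.Y v r = 0 := by
  ext w
  rw [N.Y_eq_finsum_vac two_ne_zero A.vac_mem hv]
  refine finsum_eq_zero_of_forall_eq_zero fun i => ?_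
  rw [A.parity_average N.Y hv, if_neg h, smul_zero]

variable {W : WeakTwistedModule A.tensorSquare 2 (-1) A.signedSwap M}

theorem untwistMode_apply_nat {m : ℤ} {v : V} (hv : v ∈ A.weight m) (R : ℤ) (w : M) :
    W.untwistMode v (2 * R + 2 - m) w =
      sqrtTwo ^ m • ∑ᶠ s : ℕ, (2 : ℂ) ^ (-(s : ℤ)) • W.T (A.einv s v) (R - 2 * s) w := by
  rw [untwistMode_apply hv, ← finsum_comp_of_injective (Nat.cast_injective (R := ℤ))]
  intro s hs
  refine ⟨s.toNat, Int.toNat_of_nonneg ?_⟩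
  by_contra h
  exact hs (by rw [A.einv_of_neg (by omega), LinearMap.zero_apply, T_zero, LinearMap.zero_apply,
    smul_zero])

variable (W) in
theorem isT2_untwist : A.IsT2 W.untwist W where
  sign_eq := rfl
  second := W.Y_vac_tmul
  first m v hv p w := by
    have hB := A.sub_two_mul_lt_minWeight m
    have hB0 : 0 ≤ |m| + |A.minWeight| := by positivity
    set B : ℕ := (|m| + |A.minWeight| + 1).toNat with hBdef
    have h1 : ∀ s : ℕ, W.untwist.Y (A.deltaExp 2 s v) (2 * p + 2 - 2 * s - m) w =
        ∑ᶠ t : ℕ, (sqrtTwo ^ m * (2 : ℂ) ^ (-((t + s : ℕ) : ℤ))) •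
          W.T (A.einv t (A.deltaExp 2 s v)) (p - 2 * (t + s : ℕ)) w := by
      intro s
      have := untwistMode_apply_nat (W := W) (A.deltaExp_mem hv s) (p - 2 * s) w
      rw [show 2 * (p - 2 * s) + 2 - (m - 2 * s) = 2 * p + 2 - 2 * (s : ℤ) - m by ring] at this
      refine this.trans ?_
      rw [smul_finsum]
      refine finsum_congr fun t => ?_
      rw [smul_smul, show m - 2 * (s : ℤ) = m + 2 * (-s) by ring, zpow_add₀ sqrtTwo_ne_zero,
        sqrtTwo_zpow_two_mul, mul_assoc, ← zpow_add₀ two_ne_zero,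
        show -(s : ℤ) + -(t : ℤ) = -((t + s : ℕ) : ℤ) by push_cast; ring,
        show p - 2 * (s : ℤ) - 2 * t = p - 2 * (t + s : ℕ) by push_cast; ring]
    rw [finsum_congr h1, finsum_finsum_eq_sum_antidiagonal (B := B)]
    · have h2 : ∀ n : ℕ, ∑ ij ∈ Finset.HasAntidiagonal.antidiagonal n,
          (sqrtTwo ^ m * (2 : ℂ) ^ (-((ij.2 + ij.1 : ℕ) : ℤ))) •
            W.T (A.einv ij.2 (A.deltaExp 2 ij.1 v)) (p - 2 * (ij.2 + ij.1 : ℕ)) w =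
          if n = 0 then sqrtTwo ^ m • W.T v p w else 0 := by
        intro n
        rw [← Finset.Nat.sum_antidiagonal_swap]
        have h3 : ∀ ij ∈ Finset.HasAntidiagonal.antidiagonal n, (sqrtTwo ^ m *
            (2 : ℂ) ^ (-((ij.swap.2 + ij.swap.1 : ℕ) : ℤ))) •
            W.T (A.einv ij.swap.2 (A.deltaExp 2 ij.swap.1 v))
              (p - 2 * (ij.swap.2 + ij.swap.1 : ℕ)) w =
            (sqrtTwo ^ m * (2 : ℂ) ^ (-(n : ℤ))) •
              W.T (A.einv ij.1 (A.deltaExp 2 ij.2 v)) (p - 2 * n) w := by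
          intro ij hij
          rw [Prod.fst_swap, Prod.snd_swap, Finset.HasAntidiagonal.mem_antidiagonal.1 hij]
        rw [Finset.sum_congr rfl h3, ← Finset.smul_sum, ← LinearMap.sum_apply, ← T_sum,
          A.sum_einv_deltaExp]
        split_ifs with hn
        · subst hn; simp
        · rw [T_zero, LinearMap.zero_apply, smul_zero]
      rw [Finset.sum_congr rfl fun n _ => h2 n, Finset.sum_ite_eq' (Finset.range (2 * B)) 0,
        if_pos (Finset.mem_range.2 (by omega)), smul_smul]
      change _ = (sqrtTwo ^ (-m) * sqrtTwo ^ m) • _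
      rw [← zpow_add₀ sqrtTwo_ne_zero, neg_add_cancel, zpow_zero, one_smul]
      rfl
    · intro s t hst
      rcases hst with h | h
      · rw [A.deltaExp_eq_zero hv (by omega), map_zero, T_zero, LinearMap.zero_apply, smul_zero]
      · rw [A.einv_eq_zero (A.deltaExp_mem hv s) (by omega), T_zero, LinearMap.zero_apply,
          smul_zero]

/-- The inverse image under `T²` is unique: inverting `Δ₂(x)` recovers `Y_σ` from `Y_κ̃`. -/
theorem eq_untwist_of_isT2 {N : WeakTwistedModule A.toSuperVertexData 2 (-1) A.parity M}
    (h : A.IsT2 N W) : N = W.untwist := by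
  refine WeakTwistedModule.ext h.sign_eq.symm (LinearMap.ext fun v => ?_)
  change N.Y v = W.untwistMode v
  induction v using A.weight_induction with
  | zero => rw [map_zero, map_zero]
  | add u v hu hv => rw [map_add, map_add, hu, hv]
  | hom m v hv =>
  funext r
  by_cases hr : Even (r + m)
  swap
  · rw [N.Y_eq_zero_of_not_even hv hr, untwistMode_eq_zero hv hr]
  obtain ⟨R, rfl⟩ := exists_index_of_even hr
  ext w
  have hB := A.sub_two_mul_lt_minWeight m
  have hB0 : 0 ≤ |m| + |A.minWeight| := by positivity
  set B : ℕ := (|m| + |A.minWeight| + 1).toNat with hBdef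
  have h1 : ∀ s : ℕ, sqrtTwo ^ m • (2 : ℂ) ^ (-(s : ℤ)) • W.T (A.einv s v) (R - 2 * s) w =
      ∑ᶠ t : ℕ, N.Y (A.deltaExp 2 t (A.einv s v)) (2 * R + 2 - m - 2 * (t + s : ℕ)) w := by
    intro s
    have h2 := h.first (m - 2 * s) _ (A.einv_mem hv s) (R - 2 * s) w
    change W.T (A.einv s v) (R - 2 * s) w = sqrtTwo ^ (-(m - 2 * (s : ℤ))) • _ at h2
    rw [h2, smul_smul, smul_smul, ← sqrtTwo_zpow_two_mul, ← zpow_add₀ sqrtTwo_ne_zero,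
      ← zpow_add₀ sqrtTwo_ne_zero,
      show m + 2 * -(s : ℤ) + -(m - 2 * (s : ℤ)) = 0 by ring, zpow_zero, one_smul]
    refine finsum_congr fun t => ?_
    rw [show 2 * (R - 2 * (s : ℤ)) + 2 - 2 * t - (m - 2 * s) =
      2 * R + 2 - m - 2 * (t + s : ℕ) by push_cast; ring]
  rw [untwistMode_apply_nat hv, smul_finsum, finsum_congr h1,
    finsum_finsum_eq_sum_antidiagonal (B := B)]
  · have h2 : ∀ n : ℕ, ∑ ij ∈ Finset.HasAntidiagonal.antidiagonal n,
        N.Y (A.deltaExp 2 ij.2 (A.einv ij.1 v)) (2 * R + 2 - m - 2 * (ij.2 + ij.1 : ℕ)) w =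
        if n = 0 then N.Y v (2 * R + 2 - m) w else 0 := by
      intro n
      rw [← Finset.Nat.sum_antidiagonal_swap]
      have h3 : ∀ ij ∈ Finset.HasAntidiagonal.antidiagonal n,
          N.Y (A.deltaExp 2 ij.swap.2 (A.einv ij.swap.1 v))
          (2 * R + 2 - m - 2 * (ij.swap.2 + ij.swap.1 : ℕ)) w =
          N.Y (A.deltaExp 2 ij.1 (A.einv ij.2 v)) (2 * R + 2 - m - 2 * n) w := by
        intro ij hij
        rw [Prod.fst_swap, Prod.snd_swap, Finset.HasAntidiagonal.mem_antidiagonal.1 hij]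
      rw [Finset.sum_congr rfl h3, ← LinearMap.sum_apply, ← Finset.sum_apply, ← map_sum,
        A.sum_deltaExp_einv]
      split_ifs with hn
      · subst hn; simp
      · simp
    rw [Finset.sum_congr rfl fun n _ => h2 n, Finset.sum_ite_eq' (Finset.range (2 * B)) 0,
      if_pos (Finset.mem_range.2 (by omega))]
  · intro s t hst
    rcases hst with h3 | h3
    · rw [A.einv_eq_zero hv (by omega), map_zero, map_zero]
      rfl
    · rw [A.deltaExp_eq_zero (A.einv_mem hv s) (by omega), map_zero]
      rfl

end WeakTwistedModule

/-! ### Weight spaces and graded dimensions -/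

namespace WeakTwistedModule

section Generic

variable {V : Type*} [AddCommGroup V] [Module ℂ V] {A : SuperVertexData V} {k : ℕ} {η : ℂ}
  {g : V →ₗ[ℂ] V} {M : Type*} [AddCommGroup M] [Module ℂ M]

theorem gradedDim_apply (W : WeakTwistedModule A k η g M) (C μ : ℂ) :
    W.gradedDim C μ = Module.finrank ℂ (W.weightSpace (μ + C / 24)) := by
  have h : (W.L0 - (C / 24) • (1 : Module.End ℂ M)).eigenspace μ = W.weightSpace (μ + C / 24) := by
    ext x
    rw [weightSpace, Module.End.mem_eigenspace_iff, Module.End.mem_eigenspace_iff,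
      LinearMap.sub_apply, LinearMap.smul_apply, Module.End.one_apply, sub_eq_iff_eq_add,
      ← add_smul]
  rw [gradedDim, qTrace, h]

theorem internal_iff_iSup_eq_top (W : WeakTwistedModule A k η g M) :
    DirectSum.IsInternal W.weightSpace ↔ ⨆ μ, W.weightSpace μ = ⊤ := by
  rw [DirectSum.isInternal_submodule_iff_iSupIndep_and_iSup_eq_top]
  exact ⟨fun h => h.2, fun h => ⟨W.L0.eigenspaces_iSupIndep, h⟩⟩

end Generic

variable {V : Type*} [AddCommGroup V] [Module ℂ V] {A : VOSA V}
  {M : Type*} [AddCommGroup M] [Module ℂ M]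
  {W : WeakTwistedModule A.tensorSquare 2 (-1) A.signedSwap M}
  {N : WeakTwistedModule A.toSuperVertexData 2 (-1) A.parity M}

/-- `2 L^κ̃(0) = L^σ(0) + c/8`, from `Δ₂(x)ω = ¼ x^{-1} (ω + (c/8) x^{-1})`. -/
theorem L0_of_isT2 (h : A.IsT2 N W) (w : M) :
    (2 : ℂ) • W.L0 w = N.L0 w + (A.c / 8) • w := by
  have h1 : W.L0 w = (2 : ℂ) • W.Y (A.conf ⊗ₜ A.vac) 2 w := by
    change W.Y (A.conf ⊗ₜ A.vac + A.vac ⊗ₜ A.conf) 2 w = _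
    rw [map_add, Pi.add_apply, LinearMap.add_apply, h.second, LinearMap.smul_apply]
    norm_num
    module
  have h2 : ∑ᶠ s : ℕ, N.Y (A.deltaExp 2 s A.conf) (2 * 2 + 2 - 2 * s - 4) w =
      N.L0 w + (A.c / 8) • w := by
    rw [finsum_eq_sum_of_support_subset (s := Finset.range 3)]
    · rw [Finset.sum_range_succ, Finset.sum_range_succ, Finset.sum_range_one, A.deltaExp_zero,
        A.deltaExp_one_conf, A.deltaExp_two_conf, map_zero, map_smul, Pi.smul_apply,
        LinearMap.smul_apply, N.vac_mode, if_pos (by norm_num), Pi.zero_apply,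
        LinearMap.zero_apply, add_zero, Module.End.one_apply]
      norm_num
      rfl
    · intro s hs
      rw [Function.mem_support] at hs
      rw [Finset.coe_range, Set.mem_Iio]
      by_contra h3
      obtain ⟨t, rfl⟩ : ∃ t, s = t + 3 := ⟨s - 3, by omega⟩
      exact hs (by rw [A.deltaExp_conf, map_zero]; rfl)
  have h3 := h.first 4 A.conf A.conf_mem 2 w
  rw [h2] at h3
  change _ = sqrtTwo ^ (-4 : ℤ) • _ at h3
  rw [show (-4 : ℤ) = 2 * (-2) by norm_num, sqrtTwo_zpow_two_mul] at h3
  rw [h1, h3, smul_smul, smul_smul]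
  norm_num

theorem weightSpace_of_isT2 (h : A.IsT2 N W) (μ : ℂ) :
    W.weightSpace μ = N.weightSpace (2 * μ - A.c / 8) := by
  ext x
  rw [weightSpace, weightSpace, Module.End.mem_eigenspace_iff, Module.End.mem_eigenspace_iff]
  have hx := L0_of_isT2 h x
  constructor
  · intro h1
    rw [h1] at hx
    linear_combination (norm := module) -hx
  · intro h1
    rw [h1] at hx
    linear_combination (norm := module) (1 / 2 : ℂ) • hx

theorem weightSpace_of_isT2' (h : A.IsT2 N W) (μ : ℂ) :
    N.weightSpace μ = W.weightSpace ((μ + A.c / 8) / 2) := by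
  rw [weightSpace_of_isT2 h]
  congr 1
  ring

theorem isOrdinary_iff_of_isT2 (h : A.IsT2 N W) : W.IsOrdinary ↔ N.IsOrdinary := by
  have hinternal : DirectSum.IsInternal W.weightSpace ↔ DirectSum.IsInternal N.weightSpace := by
    rw [internal_iff_iSup_eq_top, internal_iff_iSup_eq_top]
    have : ⨆ μ, W.weightSpace μ = ⨆ μ, N.weightSpace μ :=
      le_antisymm
        (iSup_le fun μ => (weightSpace_of_isT2 h μ).le.trans (le_iSup N.weightSpace _))
        (iSup_le fun μ => (weightSpace_of_isT2' h μ).le.trans (le_iSup W.weightSpace _))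
    rw [this]
  constructor
  · intro hW
    refine ⟨hinternal.1 hW.internal, fun μ => ?_, fun μ => ?_⟩
    · rw [weightSpace_of_isT2' h]
      exact hW.finite _
    · -- Half of `n / 4` is `m / 4` or `m / 4 + 1 / 8`, according to the parity of `n`.
      obtain ⟨K, hK⟩ := hW.bounded ((μ + A.c / 8) / 2)
      obtain ⟨K', hK'⟩ := hW.bounded (1 / 8 + (μ + A.c / 8) / 2)
      refine ⟨2 * min K K', fun n hn => ?_⟩
      rw [weightSpace_of_isT2' h]
      rcases Int.even_or_odd' n with ⟨m, rfl | rfl⟩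
      · rw [← hK m (by omega)]
        congr 1
        push_cast
        ring
      · rw [← hK' m (by omega)]
        congr 1
        push_cast
        ring
  · intro hN
    refine ⟨hinternal.2 hN.internal, fun μ => ?_, fun μ => ?_⟩
    · rw [weightSpace_of_isT2 h]
      exact hN.finite _
    · obtain ⟨K, hK⟩ := hN.bounded (2 * μ - A.c / 8)
      refine ⟨-|K|, fun n hn => ?_⟩
      have h1 := neg_abs_le K
      have h2 := abs_nonneg K
      rw [weightSpace_of_isT2 h, ← hK (2 * n) (by omega)]
      congr 1
      push_cast
      ring

theorem gradedDim_of_isT2 (h : A.IsT2 N W) (μ : ℂ) :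
    N.gradedDim A.c μ = W.gradedDim (2 * A.c) (μ / 2) := by
  rw [gradedDim_apply, gradedDim_apply, weightSpace_of_isT2 h,
    show 2 * (μ / 2 + 2 * A.c / 24) - A.c / 8 = μ + A.c / 24 by ring]

end WeakTwistedModule

theorem mainTheorem2 {V : Type*} [AddCommGroup V] [Module ℂ V] (A : VOSA V)
    {M : Type*} [AddCommGroup M] [Module ℂ M]
    (W : WeakTwistedModule A.tensorSquare 2 (-1) A.signedSwap M) :
    ∃ N : WeakTwistedModule A.toSuperVertexData 2 (-1) A.parity M,
      A.IsT2 N W ∧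
      (∀ N' : WeakTwistedModule A.toSuperVertexData 2 (-1) A.parity M, A.IsT2 N' W → N' = N) ∧
      (W.IsOrdinary ↔ N.IsOrdinary) ∧
      (W.IsOrdinary →
        W.gradedDim (2 * A.c) =
            qShift (-A.c / 12) (fun μ => Module.finrank ℂ (W.weightSpace μ)) ∧
        N.gradedDim A.c = qSubst 2 (W.gradedDim (2 * A.c)) ∧
        W.gradedDim (2 * A.c) = qSubst (1 / 2) (N.gradedDim A.c)) := by
  have h := W.isT2_untwist
  refine ⟨W.untwist, h, fun N' => WeakTwistedModule.eq_untwist_of_isT2,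
    WeakTwistedModule.isOrdinary_iff_of_isT2 h, fun _ => ⟨funext fun μ => ?_, funext fun μ => ?_,
    funext fun μ => ?_⟩⟩
  · rw [WeakTwistedModule.gradedDim_apply, qShift,
      show μ - -A.c / 12 = μ + 2 * A.c / 24 by ring]
  · exact WeakTwistedModule.gradedDim_of_isT2 h μ
  · rw [qSubst, WeakTwistedModule.gradedDim_of_isT2 h, show μ / (1 / 2) / 2 = μ by ring]
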